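/- For a monic polynomial $P\in\mathbb C[x]$ of degree $n$ let $\mathcal A_P$ be the $\mathbb C$-algebra generated by $u,v,z$ with relations $[z,u]=-u$, $[z,v]=v$, $vu=P(z-\tfrac12)$, $uv=P(z+\tfrac12)$. Let $s$ be the automorphism $s(u)=(-1)^nu$, $s(v)=(-1)^nv$, $s(z)=z$. If $P(-x)=(-1)^nP(x)$, let $\sigma$ be the antiautomorphism $\sigma(u)=i^nu$, $\sigma(v)=i^nv$, $\sigma(z)=-z$; if moreover $P\in\mathbb R[x]$, let $\rho_\pm$ be the antilinear ring automorphism with $\rho_\pm(z)=-z$ and, for $n=3$, $\rho_-(v)=-u$, $\rho_-(u)=v$, respectively, for $n=4$, $\rho_+(v)=u$, $\rho_+(u)=v$. An $s$-twisted trace is a linear map $T:\mathcal A_P\to\mathbb C$ with $T(ab)=T(b\,s(a))$. For a conjugation $\rho$ with $\rho^2=s$, it is unitary for $\rho$ if $T(\rho(a))=\overline{T(a)}$ for all $a$ and $T(a\rho(a))>0$ for all $a\neq0$. We say that $T$ has weight $w$ if $T(R(z))=\int_{i\mathbb R}R(x)w(x)\,|dx|$ for all $R\in\mathbb C[x]$,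 with absolutely convergent integrals. If $T(1)\ne0$, the parameter of $T$ is $\alpha=-T(z^2)/T(1)$. (a) Let $n=3$, $P(x)=x^3+\beta^2x$, where $\beta^2\in\mathbb R$, $\beta^2>-\tfrac14$, and put $\kappa=-\beta^2-\tfrac14$. A $\sigma$-invariant $s$-twisted trace with $T(1)=1$ is determined by its parameter. There is a trace, unitary for $\rho_-$, and it is unique up to positive scaling; it is $\sigma$-invariant, satisfies $T(1)\neq 0$, and (suitably scaled) has weight $$w(x)=\frac{1}{\cos\pi x\,\cos\pi(x-i\beta)\,\cos\pi(x+i\beta)} .$$ Its parameter is $$\alpha(\kappa)=\frac14-\frac{\kappa+\frac14}{1-\cos\left(\pi\sqrt{\kappa+\frac14}\right)}\quad(\kappa\ne-\tfrac14),\qquad \alpha(-\tfrac14)=\frac14-\frac{2}{\pi^2},$$ the last value being the limit of the formula as $\kappa\to-\tfrac14$. (b) Let $n=4$, $P(x)=(x^2+\beta^2)(x^2+\gamma^2)$, where $\beta^2,\gamma^2\in\mathbb R$ are greater than $-\tfrac14$. A $\sigma$-invariant $s$-twisted trace with $T(1)=1$ is determined by its parameter. There is a trace, unitary for $\rho_+$,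 and it is unique up to positive scaling; it is $\sigma$-invariant, satisfies $T(1)\neq 0$, and (suitably scaled) has weight $$w(x)=\frac{1}{\cos\pi(x-i\beta)\,\cos\pi(x+i\beta)\,\cos\pi(x-i\gamma)\,\cos\pi(x+i\gamma)} .$$ If $\beta\gamma(\beta^2-\gamma^2)\neq0$, its parameter is $$\alpha=\frac1{12}+\frac{\beta^3\sinh2\pi\gamma-\gamma^3\sinh2\pi\beta}{3(\beta\sinh2\pi\gamma-\gamma\sinh2\pi\beta)} ;$$ if $\beta\gamma(\beta^2-\gamma^2)=0$, it is the limit of this expression as the point $(\beta,\gamma)$ is approached through pairs $(\beta',\gamma')$ with $\beta'^2,\gamma'^2$ real, greater than $-\tfrac14$, and $\beta'\gamma'(\beta'^2-\gamma'^2)\ne0$. In particular $\alpha=\tfrac1{12}-\tfrac1{2\pi^2}$ for $\beta=\gamma=0$. -/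

import Mathlib

open Polynomial Filter Topology MeasureTheory

noncomputable section

namespace KleinianA

/-- Names of the three generators. -/
inductive Gen : Type
  | u
  | v
  | z

/-- The free associative complex algebra on `u`, `v`, `z`. -/
abbrev Free : Type := FreeAlgebra ℂ Gen

/-- A generator, as an element of the free algebra. -/
abbrev gen (g : Gen) : Free := FreeAlgebra.ι ℂ g

/-- The defining relations
`[z,u] = -u`, `[z,v] = v`, `vu = P(z - 1/2)`, `uv = P(z + 1/2)`. -/
inductive Rel (P : ℂ[X]) : Free → Free → Prop
  | zu : Rel P (gen .z * gen .u - gen .u * gen .z) (-gen .u)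
  | zv : Rel P (gen .z * gen .v - gen .v * gen .z) (gen .v)
  | vu : Rel P (gen .v * gen .u) (aeval (gen .z - algebraMap ℂ Free (1 / 2)) P)
  | uv : Rel P (gen .u * gen .v) (aeval (gen .z + algebraMap ℂ Free (1 / 2)) P)

/-- The quantization `𝒜_P` of the Kleinian singularity of type `A_{n-1}`, `n = deg P`: the
complex algebra generated by `u`, `v`, `z` with the relations above. -/
def Alg (P : ℂ[X]) : Type := RingQuot (Rel P)

instance (P : ℂ[X]) : Ring (Alg P) := inferInstanceAs (Ring (RingQuot (Rel P)))

instance (P : ℂ[X]) : Algebra ℂ (Alg P) := inferInstanceAs (Algebra ℂ (RingQuot (Rel P)))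

/-- The quotient map from the free algebra. -/
def mk (P : ℂ[X]) : Free →ₐ[ℂ] Alg P := RingQuot.mkAlgHom ℂ (Rel P)

/-- The generator `u`. -/
def u (P : ℂ[X]) : Alg P := mk P (gen .u)

/-- The generator `v`. -/
def v (P : ℂ[X]) : Alg P := mk P (gen .v)

/-- The generator `z`. -/
def z (P : ℂ[X]) : Alg P := mk P (gen .z)

theorem mk_rel {P : ℂ[X]} {a b : Free} (h : Rel P a b) : mk P a = mk P b :=
  RingQuot.mkAlgHom_rel ℂ h

theorem zu_eq (P : ℂ[X]) : z P * u P - u P * z P = -u P := by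
  simpa [u, z] using mk_rel (Rel.zu (P := P))

theorem zv_eq (P : ℂ[X]) : z P * v P - v P * z P = v P := by
  simpa [v, z] using mk_rel (Rel.zv (P := P))

theorem map_mk_aeval {B : Type*} [Ring B] [Algebra ℂ B] (f : Free →ₐ[ℂ] B) (a : Free)
    (P : ℂ[X]) : f (aeval a P) = aeval (f a) P :=
  (aeval_algHom_apply f a P).symm

theorem vu_eq (P : ℂ[X]) :
    v P * u P = aeval (z P - algebraMap ℂ (Alg P) (1 / 2)) P := by
  have h := mk_rel (Rel.vu (P := P))
  rw [map_mk_aeval, map_mul, map_sub, AlgHom.commutes] at h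
  exact h

theorem uv_eq (P : ℂ[X]) :
    u P * v P = aeval (z P + algebraMap ℂ (Alg P) (1 / 2)) P := by
  have h := mk_rel (Rel.uv (P := P))
  rw [map_mk_aeval, map_mul, map_add, AlgHom.commutes] at h
  exact h

/-! ### The automorphisms `g_t` -/

/-- Images of the generators under `g_t`: `u ↦ t⁻¹ u`, `v ↦ t v`, `z ↦ z`. -/
def gtGen (P : ℂ[X]) (t : ℂˣ) : Gen → Alg P
  | .u => (↑t⁻¹ : ℂ) • u P
  | .v => (t : ℂ) • v P
  | .z => z P

/-- The automorphism `g_t` of `𝒜_P`. -/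
def gt (P : ℂ[X]) (t : ℂˣ) : Alg P →ₐ[ℂ] Alg P :=
  RingQuot.liftAlgHom ℂ ⟨FreeAlgebra.lift ℂ (gtGen P t), by
    intro a b h
    cases h with
    | zu =>
      simp only [map_sub, map_mul, map_neg, FreeAlgebra.lift_ι_apply, gtGen, mul_smul_comm,
        smul_mul_assoc, ← smul_sub, zu_eq, smul_neg]
    | zv =>
      simp only [map_sub, map_mul, FreeAlgebra.lift_ι_apply, gtGen, mul_smul_comm,
        smul_mul_assoc, ← smul_sub, zv_eq]
    | vu =>
      rw [map_mk_aeval, map_mul, map_sub, AlgHom.commutes]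
      simp only [FreeAlgebra.lift_ι_apply, gtGen, mul_smul_comm, smul_mul_assoc, smul_smul,
        Units.inv_mul, one_smul, vu_eq]
    | uv =>
      rw [map_mk_aeval, map_mul, map_add, AlgHom.commutes]
      simp only [FreeAlgebra.lift_ι_apply, gtGen, mul_smul_comm, smul_mul_assoc, smul_smul,
        Units.mul_inv, one_smul, uv_eq]⟩

theorem gt_u (P : ℂ[X]) (t : ℂˣ) : gt P t (u P) = (↑t⁻¹ : ℂ) • u P :=
  (RingQuot.liftAlgHom_mkAlgHom_apply ℂ _ _ _).trans (FreeAlgebra.lift_ι_apply _ _)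

theorem gt_v (P : ℂ[X]) (t : ℂˣ) : gt P t (v P) = (t : ℂ) • v P :=
  (RingQuot.liftAlgHom_mkAlgHom_apply ℂ _ _ _).trans (FreeAlgebra.lift_ι_apply _ _)

theorem gt_z (P : ℂ[X]) (t : ℂˣ) : gt P t (z P) = z P :=
  (RingQuot.liftAlgHom_mkAlgHom_apply ℂ _ _ _).trans (FreeAlgebra.lift_ι_apply _ _)

/-! ### The antiautomorphism `σ` of an even quantization -/

/-- Images of the generators under `σ`: `u ↦ iⁿ u`, `v ↦ iⁿ v`, `z ↦ -z`. -/
def sigmaGen (P : ℂ[X]) (n : ℕ) : Gen → (Alg P)ᵐᵒᵖ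
  | .u => MulOpposite.op (Complex.I ^ n • u P)
  | .v => MulOpposite.op (Complex.I ^ n • v P)
  | .z => MulOpposite.op (-z P)

theorem aeval_op {B : Type*} [Ring B] [Algebra ℂ B] (b : B) (P : ℂ[X]) :
    aeval (MulOpposite.op b) P = MulOpposite.op (aeval b P) := by
  induction P using Polynomial.induction_on' with
  | add p q hp hq => simp [hp, hq]
  | monomial n a =>
    simp only [aeval_monomial, ← MulOpposite.op_pow, MulOpposite.algebraMap_apply,
      ← MulOpposite.op_mul]
    rw [Algebra.commutes]

theorem aeval_neg_arg {B : Type*} [Ring B] [Algebra ℂ B] {P Q : ℂ[X]} {c : ℂ}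
    (h : Q.comp (-X) = C c * P) (b : B) : aeval (-b) Q = c • aeval b P := by
  have := congrArg (aeval b) h
  rw [aeval_comp] at this
  simpa [Algebra.smul_def] using this

/-- The antiautomorphism `σ` of `𝒜_P` for `P(-x) = (-1)ⁿ P(x)`, as a homomorphism to the
opposite algebra. -/
def sigma (P : ℂ[X]) (n : ℕ) (hP : P.comp (-X) = C ((-1) ^ n) * P) :
    Alg P →ₐ[ℂ] (Alg P)ᵐᵒᵖ :=
  RingQuot.liftAlgHom ℂ ⟨FreeAlgebra.lift ℂ (sigmaGen P n), by
    have hI : Complex.I ^ n * Complex.I ^ n = (-1) ^ n := by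
      rw [← mul_pow, Complex.I_mul_I]
    intro a b h
    cases h with
    | zu =>
      simp only [map_sub, map_mul, map_neg, FreeAlgebra.lift_ι_apply, sigmaGen,
        ← MulOpposite.op_mul, ← MulOpposite.op_sub, ← MulOpposite.op_neg]
      congr 1
      simp only [mul_neg, neg_mul, mul_smul_comm, smul_mul_assoc, ← smul_neg, ← smul_sub]
      rw [← zu_eq]
      congr 1
      abel
    | zv =>
      simp only [map_sub, map_mul, FreeAlgebra.lift_ι_apply, sigmaGen,
        ← MulOpposite.op_mul, ← MulOpposite.op_sub]
      congr 1
      simp only [mul_neg, neg_mul, mul_smul_comm, smul_mul_assoc, ← smul_neg, ← smul_sub]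
      conv_rhs => rw [← zv_eq]
      congr 1
      abel
    | vu =>
      rw [map_mk_aeval, map_mul, map_sub, AlgHom.commutes]
      simp only [FreeAlgebra.lift_ι_apply, sigmaGen, MulOpposite.algebraMap_apply,
        ← MulOpposite.op_mul, ← MulOpposite.op_sub, aeval_op]
      congr 1
      rw [show -z P - algebraMap ℂ (Alg P) (1 / 2) = -(z P + algebraMap ℂ (Alg P) (1 / 2)) by
        abel, aeval_neg_arg hP, ← uv_eq]
      simp only [mul_smul_comm, smul_mul_assoc, smul_smul, hI]
    | uv =>
      rw [map_mk_aeval, map_mul, map_add, AlgHom.commutes]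
      simp only [FreeAlgebra.lift_ι_apply, sigmaGen, MulOpposite.algebraMap_apply,
        ← MulOpposite.op_mul, ← MulOpposite.op_add, aeval_op]
      congr 1
      rw [show -z P + algebraMap ℂ (Alg P) (1 / 2) = -(z P - algebraMap ℂ (Alg P) (1 / 2)) by
        abel, aeval_neg_arg hP, ← vu_eq]
      simp only [mul_smul_comm, smul_mul_assoc, smul_smul, hI]⟩

theorem sigma_u (P : ℂ[X]) (n : ℕ) (hP : P.comp (-X) = C ((-1) ^ n) * P) :
    sigma P n hP (u P) = MulOpposite.op (Complex.I ^ n • u P) :=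
  (RingQuot.liftAlgHom_mkAlgHom_apply ℂ _ _ _).trans (FreeAlgebra.lift_ι_apply _ _)

theorem sigma_v (P : ℂ[X]) (n : ℕ) (hP : P.comp (-X) = C ((-1) ^ n) * P) :
    sigma P n hP (v P) = MulOpposite.op (Complex.I ^ n • v P) :=
  (RingQuot.liftAlgHom_mkAlgHom_apply ℂ _ _ _).trans (FreeAlgebra.lift_ι_apply _ _)

theorem sigma_z (P : ℂ[X]) (n : ℕ) (hP : P.comp (-X) = C ((-1) ^ n) * P) :
    sigma P n hP (z P) = MulOpposite.op (-z P) :=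
  (RingQuot.liftAlgHom_mkAlgHom_apply ℂ _ _ _).trans (FreeAlgebra.lift_ι_apply _ _)

/-! ### Conjugations -/

/-- The ring `B` with complex scalars acting through complex conjugation. -/
def ConjAlg (B : Type*) : Type _ := B

instance (B : Type*) [Ring B] : Ring (ConjAlg B) := inferInstanceAs (Ring B)

instance (B : Type*) [Ring B] [Algebra ℂ B] : Algebra ℂ (ConjAlg B) :=
  RingHom.toAlgebra' (S := ConjAlg B) ((algebraMap ℂ B).comp (starRingEnd ℂ))
    fun c x => Algebra.commutes (A := B) (starRingEnd ℂ c) x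

/-- The antilinear ring homomorphism from the free algebra with given values on generators. -/
def conjLift {B : Type*} [Ring B] [Algebra ℂ B] (f : Gen → B) : Free →+* B :=
  (FreeAlgebra.lift ℂ (A := ConjAlg B) f).toRingHom

theorem conjLift_gen {B : Type*} [Ring B] [Algebra ℂ B] (f : Gen → B) (g : Gen) :
    conjLift f (gen g) = f g :=
  FreeAlgebra.lift_ι_apply (A := ConjAlg B) f g

theorem conjLift_algebraMap {B : Type*} [Ring B] [Algebra ℂ B] (f : Gen → B) (c : ℂ) :
    conjLift f (algebraMap ℂ Free c) = algebraMap ℂ B (starRingEnd ℂ c) :=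
  (FreeAlgebra.lift ℂ (A := ConjAlg B) f).commutes c

theorem conjLift_aeval {B : Type*} [Ring B] [Algebra ℂ B] (f : Gen → B) (a : Free)
    (P : ℂ[X]) :
    conjLift f (aeval a P) = aeval (conjLift f a) (P.map (starRingEnd ℂ)) := by
  induction P using Polynomial.induction_on' with
  | add p q hp hq => simp [hp, hq]
  | monomial n c =>
    simp only [aeval_monomial, map_mul, map_pow, conjLift_algebraMap, Polynomial.map_monomial]

/-- Images of the generators under a conjugation: `v ↦ l u`, `u ↦ l' v`, `z ↦ -z`. -/
def conjGen (P : ℂ[X]) (l l' : ℂ) : Gen → Alg P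
  | .u => l' • v P
  | .v => l • u P
  | .z => -z P

/-- The conjugation of `𝒜_P`: the antilinear ring homomorphism with
`ρ(v) = l u`, `ρ(u) = l' v`, `ρ(z) = -z`, which requires `P̄(-x) = l l' P(x)`. -/
def conjugation (P : ℂ[X]) (l l' : ℂ)
    (hP : (P.map (starRingEnd ℂ)).comp (-X) = C (l * l') * P) : Alg P →+* Alg P :=
  RingQuot.lift ⟨conjLift (conjGen P l l'), by
    have h2 : starRingEnd ℂ (1 / 2) = 1 / 2 := by
      rw [map_div₀, map_one, Complex.conj_ofNat]
    intro a b h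
    cases h with
    | zu =>
      simp only [map_sub, map_mul, map_neg, conjLift_gen, conjGen]
      conv_rhs => rw [← zv_eq]
      simp only [mul_neg, neg_mul, mul_smul_comm, smul_mul_assoc, smul_sub, smul_neg]
      abel
    | zv =>
      simp only [map_sub, map_mul, conjLift_gen, conjGen]
      simp only [mul_neg, neg_mul, mul_smul_comm, smul_mul_assoc]
      rw [← neg_neg (u P), ← zu_eq]
      simp only [mul_neg, neg_mul, neg_neg, smul_sub, smul_neg]
      have e := zu_eq P
      have : z P * u P = u P * z P - u P := by rw [← sub_eq_zero, ← sub_eq_zero.mpr e]; abel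
      simp only [neg_sub, sub_mul, mul_sub, this, smul_sub]
      abel
    | vu =>
      rw [conjLift_aeval, map_mul, map_sub, conjLift_algebraMap, h2]
      simp only [conjLift_gen, conjGen]
      rw [show -z P - algebraMap ℂ (Alg P) (1 / 2) = -(z P + algebraMap ℂ (Alg P) (1 / 2)) by
        abel, aeval_neg_arg hP, ← uv_eq]
      simp only [mul_smul_comm, smul_mul_assoc, smul_smul, mul_comm]
    | uv =>
      rw [conjLift_aeval, map_mul, map_add, conjLift_algebraMap, h2]
      simp only [conjLift_gen, conjGen]
      rw [show -z P + algebraMap ℂ (Alg P) (1 / 2) = -(z P - algebraMap ℂ (Alg P) (1 / 2)) by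
        abel, aeval_neg_arg hP, ← vu_eq]
      simp only [mul_smul_comm, smul_mul_assoc, smul_smul]⟩

theorem conjugation_mk (P : ℂ[X]) (l l' : ℂ)
    (hP : (P.map (starRingEnd ℂ)).comp (-X) = C (l * l') * P) (a : Free) :
    conjugation P l l' hP (mk P a) = conjLift (conjGen P l l') a := by
  have : mk P a = RingQuot.mkRingHom (Rel P) a := by
    rw [← RingQuot.mkAlgHom_coe ℂ]; rfl
  rw [this]
  exact RingQuot.lift_mkRingHom_apply _ _ _

theorem conjugation_u (P : ℂ[X]) (l l' : ℂ)
    (hP : (P.map (starRingEnd ℂ)).comp (-X) = C (l * l') * P) :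
    conjugation P l l' hP (u P) = l' • v P :=
  (conjugation_mk P l l' hP _).trans (conjLift_gen _ _)

theorem conjugation_v (P : ℂ[X]) (l l' : ℂ)
    (hP : (P.map (starRingEnd ℂ)).comp (-X) = C (l * l') * P) :
    conjugation P l l' hP (v P) = l • u P :=
  (conjugation_mk P l l' hP _).trans (conjLift_gen _ _)

theorem conjugation_z (P : ℂ[X]) (l l' : ℂ)
    (hP : (P.map (starRingEnd ℂ)).comp (-X) = C (l * l') * P) :
    conjugation P l l' hP (z P) = -z P :=
  (conjugation_mk P l l' hP _).trans (conjLift_gen _ _)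

theorem conjugation_smul (P : ℂ[X]) (l l' : ℂ)
    (hP : (P.map (starRingEnd ℂ)).comp (-X) = C (l * l') * P) (c : ℂ) (a : Alg P) :
    conjugation P l l' hP (c • a) = starRingEnd ℂ c • conjugation P l l' hP a := by
  rw [Algebra.smul_def, Algebra.smul_def, map_mul, ← (mk P).commutes, conjugation_mk,
    conjLift_algebraMap]

/-! ### Traces -/

/-- `T` is a `g`-twisted trace: `T(ab) = T(b g(a))`. -/
def IsTwistedTrace {P : ℂ[X]} (g : Alg P →ₐ[ℂ] Alg P) (T : Alg P →ₗ[ℂ] ℂ) : Prop :=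
  ∀ a b, T (a * b) = T (b * g a)

/-- `T` is unitary (positive) for the conjugation `ρ`, where `ρ² = g`: it is a `g`-twisted,
`ρ`-equivariant trace whose Hermitian form `(a, b) = T(a ρ(b))` is positive definite. -/
structure IsUnitaryTrace {P : ℂ[X]} (g : Alg P →ₐ[ℂ] Alg P) (ρ : Alg P →+* Alg P)
    (T : Alg P →ₗ[ℂ] ℂ) : Prop where
  trace : IsTwistedTrace g T
  equivariant : ∀ a, T (ρ a) = starRingEnd ℂ (T a)
  pos : ∀ a, a ≠ 0 → 0 < (T (a * ρ a)).re ∧ (T (a * ρ a)).im = 0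

/-- `T` is invariant under the antiautomorphism `σ`. -/
def IsSigmaInvariant {P : ℂ[X]} (σ : Alg P →ₐ[ℂ] (Alg P)ᵐᵒᵖ) (T : Alg P →ₗ[ℂ] ℂ) : Prop :=
  ∀ a, T (MulOpposite.unop (σ a)) = T a

/-- `T(R(z)) = ∫_{iℝ} R(x) w(x) |dx|` for all polynomials `R`, the integrals being absolutely
convergent; the imaginary axis is parametrized by `x = i y`. -/
def HasWeight {P : ℂ[X]} (T : Alg P →ₗ[ℂ] ℂ) (w : ℂ → ℂ) : Prop :=
  ∀ R : ℂ[X],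
    Integrable (fun y : ℝ => R.eval (Complex.I * y) * w (Complex.I * y)) ∧
      T (aeval (z P) R) = ∫ y : ℝ, R.eval (Complex.I * y) * w (Complex.I * y)

/-- The parameter `α` of `T`: for the multiple `T'` of `T` with `T'(1) = 1` it is given by
`T'(z²) = -α` (meaningful when `T(1) ≠ 0`). -/
def parameter {P : ℂ[X]} (T : Alg P →ₗ[ℂ] ℂ) : ℂ := -(T (z P ^ 2) / T 1)

/-! ### The case `n = 3` -/

/-- `P(x) = x³ + b x`, where `b = β²`. -/
def P₃ (b : ℝ) : ℂ[X] := X ^ 3 + C (b : ℂ) * X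

theorem P₃_even (b : ℝ) : (P₃ b).comp (-X) = C ((-1) ^ 3) * P₃ b := by
  simp [P₃]; ring

theorem P₃_conj (b : ℝ) :
    ((P₃ b).map (starRingEnd ℂ)).comp (-X) = C ((-1) * 1) * P₃ b := by
  simp [P₃]; ring

/-- The automorphism `s = g_{(-1)³}`. -/
def s₃ (b : ℝ) : Alg (P₃ b) →ₐ[ℂ] Alg (P₃ b) := gt (P₃ b) ((-1) ^ 3)

/-- The antiautomorphism `σ`. -/
def σ₃ (b : ℝ) : Alg (P₃ b) →ₐ[ℂ] (Alg (P₃ b))ᵐᵒᵖ := sigma (P₃ b) 3 (P₃_even b)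

/-- The conjugation `ρ_-`: `ρ_-(v) = -u`, `ρ_-(u) = v`, `ρ_-(z) = -z`. -/
def ρ₃ (b : ℝ) : Alg (P₃ b) →+* Alg (P₃ b) := conjugation (P₃ b) (-1) 1 (P₃_conj b)

/-- The weight function `1 / (cos πx cos π(x - iβ) cos π(x + iβ))`. -/
def w₃ (β x : ℂ) : ℂ :=
  1 / (Complex.cos (Real.pi * x) * Complex.cos (Real.pi * (x - Complex.I * β)) *
    Complex.cos (Real.pi * (x + Complex.I * β)))

/-- `1/4 - (κ + 1/4) / (1 - cos (π √(κ + 1/4)))`, with the principal square root (the cosine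
does not depend on the choice of the root); meaningful for `κ ≠ -1/4`, `κ < 0`. -/
def α₃ (κ : ℝ) : ℂ :=
  1 / 4 - ((κ : ℂ) + 1 / 4) /
    (1 - Complex.cos (Real.pi * ((κ : ℂ) + 1 / 4) ^ (1 / 2 : ℂ)))

/-! ### The case `n = 4` -/

/-- `P(x) = (x² + b)(x² + c)`, where `b = β²`, `c = γ²`. -/
def P₄ (b c : ℝ) : ℂ[X] := (X ^ 2 + C (b : ℂ)) * (X ^ 2 + C (c : ℂ))

theorem P₄_even (b c : ℝ) : (P₄ b c).comp (-X) = C ((-1) ^ 4) * P₄ b c := by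
  simp [P₄]; ring

theorem P₄_conj (b c : ℝ) :
    ((P₄ b c).map (starRingEnd ℂ)).comp (-X) = C (1 * 1) * P₄ b c := by
  simp [P₄]

/-- The automorphism `s = g_{(-1)⁴}`. -/
def s₄ (b c : ℝ) : Alg (P₄ b c) →ₐ[ℂ] Alg (P₄ b c) := gt (P₄ b c) ((-1) ^ 4)

/-- The antiautomorphism `σ`. -/
def σ₄ (b c : ℝ) : Alg (P₄ b c) →ₐ[ℂ] (Alg (P₄ b c))ᵐᵒᵖ :=
  sigma (P₄ b c) 4 (P₄_even b c)

/-- The conjugation `ρ_+`: `ρ_+(v) = u`, `ρ_+(u) = v`, `ρ_+(z) = -z`. -/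
def ρ₄ (b c : ℝ) : Alg (P₄ b c) →+* Alg (P₄ b c) :=
  conjugation (P₄ b c) 1 1 (P₄_conj b c)

/-- The weight function `1 / (cos π(x - iβ) cos π(x + iβ) cos π(x - iγ) cos π(x + iγ))`. -/
def w₄ (β γ x : ℂ) : ℂ :=
  1 / (Complex.cos (Real.pi * (x - Complex.I * β)) *
    Complex.cos (Real.pi * (x + Complex.I * β)) *
    Complex.cos (Real.pi * (x - Complex.I * γ)) *
    Complex.cos (Real.pi * (x + Complex.I * γ)))

/-- `1/12 + (β³ sinh 2πγ - γ³ sinh 2πβ) / (3 (β sinh 2πγ - γ sinh 2πβ))`. -/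
def α₄ (β γ : ℂ) : ℂ :=
  1 / 12 +
    (β ^ 3 * Complex.sinh (2 * Real.pi * γ) - γ ^ 3 * Complex.sinh (2 * Real.pi * β)) /
      (3 * (β * Complex.sinh (2 * Real.pi * γ) - γ * Complex.sinh (2 * Real.pi * β)))

/-- The pairs `(β, γ)` with `β²`, `γ²` real and greater than `-1/4` for which the formula for
the parameter is not of the form `0/0`: `βγ(β² - γ²) ≠ 0`. -/
def generic₄ : Set (ℂ × ℂ) :=
  {p | (∃ b : ℝ, -(1 / 4) < b ∧ p.1 ^ 2 = b) ∧ (∃ c : ℝ, -(1 / 4) < c ∧ p.2 ^ 2 = c) ∧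
    p.1 ≠ 0 ∧ p.2 ≠ 0 ∧ p.1 ^ 2 ≠ p.2 ^ 2}

end KleinianA

end

noncomputable section

namespace KleinianA

/-! ### Structure of `Alg P`; twisted traces as functionals on ℂ[z] -/

section
variable {P : ℂ[X]}

/-! Algebra. A twisted trace vanishes on nonzero `ad z`-weights, so it is a functional τ on ℂ[z],
and the trace property becomes τ(P(x-1/2) r(x)) = (-1)^n τ(P(x+1/2) r(x+1)). Conversely each such τ
extends (`isTwistedTrace_comp_constPart`). For n = 3 and n = 4 alike these relations contain a
polynomial of every degree ≥ 3, so τ is determined by its values on 1, x, x². Invariance under σ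
kills τ(x), so a normalized invariant trace is determined by τ(x²), that is, by its parameter.

Analysis. Let c_j be the roots of P and w = ∏ 1/cos π(x - c_j). A shift by 1/2 turns cosines into
sines, and the zeros of P cancel the poles of ∏ 1/sin π(s - c_j) in the strip |Re s| ≤ 1/2. Moving
both lines Re s = ±1/2 to the imaginary axis shows that integration against w is a trace functional.
The same holds for p·w with p = p₀e^{2πix} + p₁ + p₂e^{-2πix}
(`isTraceFunctional_weightFunctional`). This family is 3-dimensional, hence contains all traces
(`exists_weightFunctional_eq`).

Positivity. Distinct weights are orthogonal for T(aρ(a)), and the trace property reduces weight k+2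
to k and weight -k to k, so only weights 0 and 1 need testing (`isUnitaryTrace_of_form_pos`). They
amount to the pairing of |R|² on iℝ with p·w and with p(x+1/2)·∏ (x - c_j)/sin π(x - c_j); apart
from the trigonometric factors, both weights are positive. Nonnegativity against squares forces the
outer coefficients of the trigonometric factor to have nonnegative real part, because e^{μy} is a
limit of squares and the integrals blow up as μ nears the decay rate
(`coeff_nonneg_of_integral_sq_nonneg`). The shift by 1/2 reverses the signs of p₀ and p₂, so both
vanish and only multiples of w survive (`isUnitaryTrace_iff`).

Parameter. For distinct roots and entire f of small exponential type vanishing at all c_j, the same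
shift gives ∫ (f(x+1/2) - (-1)^n f(x-1/2)) w = 0 (`integral_symm_mul_cosWeight`). Taking f to be a
polynomial plus a trigonometric term that cancels in this combination yields a linear relation
between T(z²) and T(1). For coinciding roots the moments are continuous in β, γ by dominated
convergence, which gives the limiting values. -/

theorem Alg.induction {p : Alg P → Prop} (halg : ∀ r : ℂ, p (algebraMap ℂ (Alg P) r))
    (hu : p (u P)) (hv : p (v P)) (hz : p (z P)) (hmul : ∀ a b, p a → p b → p (a * b))
    (hadd : ∀ a b, p a → p b → p (a + b)) (a : Alg P) : p a := by
  obtain ⟨x, rfl⟩ := RingQuot.mkAlgHom_surjective ℂ (Rel P) a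
  change p (mk P x)
  induction x using FreeAlgebra.induction with
  | grade0 r => rw [AlgHom.commutes]; exact halg r
  | grade1 g => cases g <;> assumption
  | mul a b ha hb => rw [map_mul]; exact hmul _ _ ha hb
  | add a b ha hb => rw [map_add]; exact hadd _ _ ha hb

/-! ### Commutation with polynomials in `z` -/

theorem v_mul_z : v P * z P = (z P - 1) * v P := by
  have h : v P * z P = z P * v P - (z P * v P - v P * z P) := by abel
  rw [h, zv_eq, sub_mul, one_mul]

theorem u_mul_z : u P * z P = (z P + 1) * u P := by
  have h : u P * z P = z P * u P - (z P * u P - u P * z P) := by abel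
  rw [h, zu_eq, add_mul, one_mul, sub_neg_eq_add]

theorem aeval_mul_of_mul_eq {B : Type*} [Ring B] [Algebra ℂ B] {x y y' : B}
    (h : x * y = y' * x) (R : ℂ[X]) : x * aeval y R = aeval y' R * x := by
  have hp : ∀ n : ℕ, x * y ^ n = y' ^ n * x := by
    intro n
    induction n with
    | zero => simp
    | succ n ih => rw [pow_succ, ← mul_assoc, ih, mul_assoc, h, ← mul_assoc, pow_succ]
  induction R using Polynomial.induction_on' with
  | add p q hp hq => simp only [map_add, mul_add, add_mul, hp, hq]
  | monomial n c =>
    simp only [aeval_monomial]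
    rw [← mul_assoc, ← Algebra.commutes, mul_assoc, hp, mul_assoc]

theorem v_mul_aeval (R : ℂ[X]) :
    v P * aeval (z P) R = aeval (z P) (R.comp (X - 1)) * v P := by
  rw [aeval_mul_of_mul_eq v_mul_z, aeval_comp]
  simp

theorem u_mul_aeval (R : ℂ[X]) :
    u P * aeval (z P) R = aeval (z P) (R.comp (X + 1)) * u P := by
  rw [aeval_mul_of_mul_eq u_mul_z, aeval_comp]
  simp

theorem vu_eq_aeval : v P * u P = aeval (z P) (P.comp (X - C (1 / 2))) := by
  rw [vu_eq, aeval_comp]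
  simp only [map_sub, aeval_X, aeval_C]

theorem uv_eq_aeval : u P * v P = aeval (z P) (P.comp (X + C (1 / 2))) := by
  rw [uv_eq, aeval_comp]
  simp only [map_add, aeval_X, aeval_C]

/-! ### The spanning set `R(z) vᵏ`, `R(z) uᵏ` -/

variable (P) in
/-- `vᵏ` for `k ≥ 0`, `u⁻ᵏ` for `k < 0`. -/
def zpw : ℤ → Alg P
  | .ofNat k => v P ^ k
  | .negSucc k => u P ^ (k + 1)

theorem v_mul_zpw (k : ℤ) : ∃ Q : ℂ[X], v P * zpw P k = aeval (z P) Q * zpw P (k + 1) := by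
  rcases k with k | k
  · exact ⟨1, by
      rw [map_one, one_mul]
      exact (pow_succ' _ _).symm⟩
  · refine ⟨P.comp (X - C (1 / 2)), ?_⟩
    rw [zpw, pow_succ', ← mul_assoc, vu_eq_aeval]
    cases k with
    | zero =>
      rw [show Int.negSucc 0 + 1 = Int.ofNat 0 from rfl, zpw, pow_zero, pow_zero]
    | succ k => rfl

theorem u_mul_zpw (k : ℤ) : ∃ Q : ℂ[X], u P * zpw P k = aeval (z P) Q * zpw P (k - 1) := by
  rcases k with k | k
  · cases k with
    | zero =>
      refine ⟨1, ?_⟩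
      rw [show Int.ofNat 0 - 1 = Int.negSucc 0 from rfl, zpw, zpw, pow_zero, map_one, one_mul,
        mul_one, zero_add, pow_one]
    | succ k =>
      refine ⟨P.comp (X + C (1 / 2)), ?_⟩
      have : Int.ofNat (k + 1) - 1 = Int.ofNat k := by simp
      rw [this, zpw, pow_succ', ← mul_assoc, uv_eq_aeval]
      rfl
  · exact ⟨1, by
      rw [map_one, one_mul]
      exact (pow_succ' _ _).symm⟩

variable (P) in
/-- The linear map `∑ Rₖ eₖ ↦ ∑ Rₖ(z) zpw k`. -/
def ofCoeffs : (ℤ →₀ ℂ[X]) →ₗ[ℂ] Alg P :=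
  Finsupp.lsum ℂ fun k => (LinearMap.mulRight ℂ (zpw P k)).comp (aeval (z P)).toLinearMap

theorem ofCoeffs_single (k : ℤ) (R : ℂ[X]) :
    ofCoeffs P (Finsupp.single k R) = aeval (z P) R * zpw P k := by
  simp [ofCoeffs]

theorem ofCoeffs_apply (f : ℤ →₀ ℂ[X]) :
    ofCoeffs P f = ∑ k ∈ f.support, aeval (z P) (f k) * zpw P k := by
  simp [ofCoeffs, Finsupp.sum]

/-- The range contains 1 and is stable under left multiplication by the generators, since moving
them past R(z) only shifts the argument and vu, uv are polynomials in z. -/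
theorem ofCoeffs_surjective (a : Alg P) : ∃ f, ofCoeffs P f = a := by
  suffices h : ∀ b ∈ LinearMap.range (ofCoeffs P), a * b ∈ LinearMap.range (ofCoeffs P) by
    simpa using h 1 ⟨Finsupp.single 0 1, by
      rw [ofCoeffs_single, map_one, one_mul]; exact pow_zero _⟩
  have key : ∀ x : Alg P,
      (∀ (R : ℂ[X]) k, x * (aeval (z P) R * zpw P k) ∈ LinearMap.range (ofCoeffs P)) →
      ∀ b ∈ LinearMap.range (ofCoeffs P), x * b ∈ LinearMap.range (ofCoeffs P) := by
    rintro x hx _ ⟨f, rfl⟩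
    rw [ofCoeffs_apply, Finset.mul_sum]
    exact Submodule.sum_mem _ fun k _ => hx _ _
  induction a using Alg.induction with
  | halg r =>
    intro b hb
    rw [← Algebra.smul_def]
    exact Submodule.smul_mem _ _ hb
  | hu =>
    refine key _ fun R k => ?_
    obtain ⟨Q, hQ⟩ := u_mul_zpw (P := P) k
    rw [← mul_assoc, u_mul_aeval, mul_assoc, hQ, ← mul_assoc, ← map_mul, ← ofCoeffs_single]
    exact ⟨_, rfl⟩
  | hv =>
    refine key _ fun R k => ?_
    obtain ⟨Q, hQ⟩ := v_mul_zpw (P := P) k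
    rw [← mul_assoc, v_mul_aeval, mul_assoc, hQ, ← mul_assoc, ← map_mul, ← ofCoeffs_single]
    exact ⟨_, rfl⟩
  | hz =>
    refine key _ fun R k => ?_
    refine ⟨Finsupp.single k (X * R), ?_⟩
    rw [ofCoeffs_single, map_mul, aeval_X, mul_assoc]
  | hmul x y hx hy =>
    intro b hb
    rw [mul_assoc]
    exact hx _ (hy _ hb)
  | hadd x y hx hy =>
    intro b hb
    rw [add_mul]
    exact Submodule.add_mem _ (hx _ hb) (hy _ hb)

/-! ### Weights -/

/-- `a` is an eigenvector of `ad z` with eigenvalue `k`. -/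
def HasAdWeight (a : Alg P) (k : ℤ) : Prop := z P * a - a * z P = k • a

theorem HasAdWeight.mul {a b : Alg P} {k m : ℤ} (ha : HasAdWeight a k) (hb : HasAdWeight b m) :
    HasAdWeight (a * b) (k + m) := by
  have : z P * (a * b) - a * b * z P = (z P * a - a * z P) * b + a * (z P * b - b * z P) := by
    noncomm_ring
  rw [HasAdWeight, this, ha, hb, add_smul, smul_mul_assoc, mul_smul_comm]

theorem HasAdWeight.pow {a : Alg P} {k : ℤ} (ha : HasAdWeight a k) (n : ℕ) :
    HasAdWeight (a ^ n) (n * k) := by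
  induction n with
  | zero => simp [HasAdWeight]
  | succ n ih =>
    rw [pow_succ, show ((n + 1 : ℕ) : ℤ) * k = n * k + k by push_cast; ring]
    exact ih.mul ha

theorem hasAdWeight_aeval (R : ℂ[X]) : HasAdWeight (aeval (z P) R) 0 := by
  have := aeval_mul_of_mul_eq (x := z P) (y := z P) rfl R
  rw [HasAdWeight, this, sub_self, zero_smul]

theorem hasAdWeight_zpw (k : ℤ) : HasAdWeight (zpw P k) k := by
  rcases k with k | k
  · have h : HasAdWeight (v P) 1 := by rw [HasAdWeight, zv_eq, one_smul]
    have := h.pow k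
    rwa [mul_one] at this
  · have h : HasAdWeight (u P) (-1) := by rw [HasAdWeight, zu_eq, neg_smul, one_smul]
    have := h.pow (k + 1)
    rwa [show ((k + 1 : ℕ) : ℤ) * (-1) = Int.negSucc k by omega] at this

theorem hasAdWeight_aeval_mul_zpw (R : ℂ[X]) (k : ℤ) :
    HasAdWeight (aeval (z P) R * zpw P k) k := by
  simpa using (hasAdWeight_aeval R).mul (hasAdWeight_zpw k)

theorem HasAdWeight.conjugation {l l' : ℂ}
    {hP : (P.map (starRingEnd ℂ)).comp (-X) = C (l * l') * P} {a : Alg P} {k : ℤ}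
    (ha : HasAdWeight a k) : HasAdWeight (conjugation P l l' hP a) (-k) := by
  have h := congrArg (KleinianA.conjugation P l l' hP) ha
  rw [map_sub, map_mul, map_mul, conjugation_z, map_zsmul] at h
  rw [HasAdWeight, neg_smul, ← h]
  noncomm_ring

theorem HasAdWeight.sigma {n : ℕ} {hP : P.comp (-X) = C ((-1) ^ n) * P} {a : Alg P} {k : ℤ}
    (ha : HasAdWeight a k) : HasAdWeight (sigma P n hP a).unop k := by
  have h := congrArg (fun x => (KleinianA.sigma P n hP x).unop) ha
  simp only [map_sub, map_mul, sigma_z, map_zsmul, MulOpposite.unop_sub, MulOpposite.unop_mul,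
    MulOpposite.unop_op, MulOpposite.unop_smul] at h
  rw [HasAdWeight, ← h]
  noncomm_ring

/-- The automorphism fixes z, so T kills the commutator [z, a] = k a. -/
theorem IsTwistedTrace.eq_zero_of_hasAdWeight {t : ℂˣ} {T : Alg P →ₗ[ℂ] ℂ}
    (hT : IsTwistedTrace (gt P t) T) {a : Alg P} {k : ℤ} (ha : HasAdWeight a k) (hk : k ≠ 0) :
    T a = 0 := by
  have h := hT (z P) a
  rw [gt_z, ← sub_eq_zero, ← map_sub, ha, map_zsmul, zsmul_eq_mul] at h
  simpa [hk] using h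

/-- Two linear functionals vanishing in nonzero weights agree if they agree on `ℂ[z]`. -/
theorem linearMap_ext_of_aeval {E : Type*} [AddCommMonoid E] {T T' : Alg P →+ E}
    (hT : ∀ (R : ℂ[X]) (k : ℤ), k ≠ 0 →
      T (aeval (z P) R * zpw P k) = T' (aeval (z P) R * zpw P k))
    (h : ∀ R : ℂ[X], T (aeval (z P) R) = T' (aeval (z P) R)) (a : Alg P) : T a = T' a := by
  obtain ⟨f, rfl⟩ := ofCoeffs_surjective a
  rw [ofCoeffs_apply, map_sum, map_sum]
  refine Finset.sum_congr rfl fun k _ => ?_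
  rcases eq_or_ne k 0 with rfl | hk
  · have : zpw P 0 = 1 := pow_zero _
    rw [this, mul_one, h]
  · exact hT _ _ hk

theorem IsTwistedTrace.ext {t : ℂˣ} {T T' : Alg P →ₗ[ℂ] ℂ} (hT : IsTwistedTrace (gt P t) T)
    (hT' : IsTwistedTrace (gt P t) T') (h : ∀ R : ℂ[X], T (aeval (z P) R) = T' (aeval (z P) R)) :
    T = T' := by
  ext a
  refine linearMap_ext_of_aeval (T := T.toAddMonoidHom) (T' := T'.toAddMonoidHom)
    (fun R k hk => ?_) h a
  have hw := hasAdWeight_aeval_mul_zpw (P := P) R k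
  exact (hT.eq_zero_of_hasAdWeight hw hk).trans (hT'.eq_zero_of_hasAdWeight hw hk).symm

/-- The condition on the restriction of a `g_t`-twisted trace to `ℂ[z]`. -/
def IsTraceFunctional (P : ℂ[X]) (t : ℂ) (τ : ℂ[X] →ₗ[ℂ] ℂ) : Prop :=
  ∀ r : ℂ[X], τ (P.comp (X - C (1 / 2)) * r) = t * τ (P.comp (X + C (1 / 2)) * r.comp (X + 1))

theorem IsTwistedTrace.isTraceFunctional {t : ℂˣ} {T : Alg P →ₗ[ℂ] ℂ}
    (hT : IsTwistedTrace (gt P t) T) :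
    IsTraceFunctional P t (T.comp (aeval (z P)).toLinearMap) := by
  intro r
  -- The argument is shifted in advance so that moving v past it leaves r itself.
  have h := hT (v P) (aeval (z P) (r.comp (X + 1)) * u P)
  rw [gt_v, ← mul_assoc, v_mul_aeval, mul_assoc, vu_eq_aeval, mul_smul_comm, map_smul,
    mul_assoc, uv_eq_aeval, ← map_mul, ← map_mul, comp_assoc] at h
  simp only [add_comp, X_comp, one_comp, sub_add_cancel, comp_X, smul_eq_mul] at h
  rw [mul_comm r, mul_comm (r.comp _)] at h
  exact h

/-! ### A representation, and the construction of traces -/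

/-- The action of `z`. -/
def repZ : Module.End ℂ[X] (ℤ → ℂ[X]) where
  toFun m k := (X + C (k : ℂ)) * m k
  map_add' m m' := by ext1 k; simp [mul_add]
  map_smul' r m := by ext1 k; simp [mul_left_comm]

/-- The action of `v`. -/
def repV : Module.End ℂ[X] (ℤ → ℂ[X]) where
  toFun m k := m (k - 1)
  map_add' _ _ := rfl
  map_smul' _ _ := rfl

/-- The action of `u`. -/
def repU (P : ℂ[X]) : Module.End ℂ[X] (ℤ → ℂ[X]) where
  toFun m k := P.comp (X + C ((k : ℂ) + 1 / 2)) * m (k + 1)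
  map_add' m m' := by ext1 k; simp [mul_add]
  map_smul' r m := by ext1 k; simp [mul_left_comm]

theorem aeval_repZ (r : ℂ) (Q : ℂ[X]) (m : ℤ → ℂ[X]) (k : ℤ) :
    aeval (repZ + algebraMap ℂ _ r) Q m k = Q.comp (X + C ((k : ℂ) + r)) * m k := by
  have h1 : ∀ m k, (repZ + algebraMap ℂ (Module.End ℂ[X] (ℤ → ℂ[X])) r) m k
      = (X + C ((k : ℂ) + r)) * m k := by
    intro m k
    simp only [repZ, LinearMap.add_apply, Pi.add_apply, LinearMap.coe_mk, AddHom.coe_mk,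
      Module.algebraMap_end_apply, Pi.smul_apply, C_add, smul_eq_C_mul]
    ring
  have h2 : ∀ (n : ℕ) m k, ((repZ + algebraMap ℂ (Module.End ℂ[X] (ℤ → ℂ[X])) r) ^ n) m k
      = (X + C ((k : ℂ) + r)) ^ n * m k := by
    intro n
    induction n with
    | zero => simp
    | succ n ih => intro m k; rw [pow_succ, Module.End.mul_apply, ih, h1, pow_succ, mul_assoc]
  induction Q using Polynomial.induction_on' with
  | add p q hp hq => simp [hp, hq, add_mul]
  | monomial n c =>
    simp only [aeval_monomial, Module.End.mul_apply, Module.algebraMap_end_apply, Pi.smul_apply,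
      h2, monomial_comp, smul_eq_C_mul, mul_assoc]

/-- Images of the generators. -/
def repGen (P : ℂ[X]) : Gen → Module.End ℂ[X] (ℤ → ℂ[X])
  | .u => repU P
  | .v => repV
  | .z => repZ

/-- The representation of `𝒜_P` on `⊕ ℂ[x] eₖ` with `z eₖ = (x + k) eₖ`, `v eₖ = eₖ₊₁`. -/
def rep (P : ℂ[X]) : Alg P →ₐ[ℂ] Module.End ℂ[X] (ℤ → ℂ[X]) :=
  RingQuot.liftAlgHom ℂ ⟨FreeAlgebra.lift ℂ (repGen P), by
    intro a b h
    cases h with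
    | zu =>
      simp only [map_sub, map_mul, map_neg, FreeAlgebra.lift_ι_apply, repGen]
      refine LinearMap.ext fun m => funext fun k => ?_
      simp [repZ, repU]
      ring
    | zv =>
      simp only [map_sub, map_mul, FreeAlgebra.lift_ι_apply, repGen]
      refine LinearMap.ext fun m => funext fun k => ?_
      simp [repZ, repV]
      ring
    | vu =>
      rw [map_mk_aeval, map_mul, map_sub, AlgHom.commutes]
      simp only [FreeAlgebra.lift_ι_apply, repGen]
      refine LinearMap.ext fun m => funext fun k => ?_
      rw [sub_eq_add_neg, ← map_neg, aeval_repZ]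
      simp only [repV, repU, Module.End.mul_apply, LinearMap.coe_mk, AddHom.coe_mk,
        sub_add_cancel]
      congr 4
      push_cast
      ring
    | uv =>
      rw [map_mk_aeval, map_mul, map_add, AlgHom.commutes]
      simp only [FreeAlgebra.lift_ι_apply, repGen]
      refine LinearMap.ext fun m => funext fun k => ?_
      rw [aeval_repZ]
      simp only [repV, repU, Module.End.mul_apply, LinearMap.coe_mk, AddHom.coe_mk,
        add_sub_cancel_right]⟩

theorem rep_u : rep P (u P) = repU P :=
  (RingQuot.liftAlgHom_mkAlgHom_apply ℂ _ _ _).trans (FreeAlgebra.lift_ι_apply _ _)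

theorem rep_v : rep P (v P) = repV :=
  (RingQuot.liftAlgHom_mkAlgHom_apply ℂ _ _ _).trans (FreeAlgebra.lift_ι_apply _ _)

theorem rep_z : rep P (z P) = repZ :=
  (RingQuot.liftAlgHom_mkAlgHom_apply ℂ _ _ _).trans (FreeAlgebra.lift_ι_apply _ _)

theorem rep_aeval (R : ℂ[X]) (m : ℤ → ℂ[X]) (k : ℤ) :
    rep P (aeval (z P) R) m k = R.comp (X + C (k : ℂ)) * m k := by
  rw [← aeval_algHom_apply, rep_z]
  simpa using aeval_repZ 0 R m k

/-- These vectors form a submodule: v only raises the index, and u enters the negative indices from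
0 to -1 with the factor P(x - 1 + 1/2). -/
theorem rep_dvd (a : Alg P) (m : ℤ → ℂ[X]) (hm : ∀ k < 0, P.comp (X - C (1 / 2)) ∣ m k) :
    ∀ k < 0, P.comp (X - C (1 / 2)) ∣ rep P a m k := by
  induction a using Alg.induction generalizing m with
  | halg r =>
    intro k hk
    rw [AlgHom.commutes, Module.algebraMap_end_apply, Pi.smul_apply, smul_eq_C_mul]
    exact (hm k hk).mul_left _
  | hu =>
    intro k hk
    rw [rep_u]
    rcases eq_or_ne k (-1) with rfl | h
    · refine Dvd.intro (m (-1 + 1)) ?_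
      simp only [repU, LinearMap.coe_mk, AddHom.coe_mk]
      congr 2
      rw [sub_eq_add_neg, ← C_neg]
      congr 2
      norm_num
    · exact (hm _ (by omega)).mul_left _
  | hv => intro k hk; rw [rep_v]; exact hm _ (by omega)
  | hz => intro k hk; rw [rep_z]; exact (hm _ hk).mul_left _
  | hmul a b ha hb =>
    intro k hk
    rw [map_mul, Module.End.mul_apply]
    exact ha _ (hb _ hm) k hk
  | hadd a b ha hb =>
    intro k hk
    rw [map_add]
    exact dvd_add (ha _ hm k hk) (hb _ hm k hk)

/-- The translation symmetry of the representation. -/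
def translate (m : ℤ → ℂ[X]) : ℤ → ℂ[X] := fun k => (m (k - 1)).comp (X + 1)

/-- Raising the index by one while replacing x by x + 1 preserves x + k, and all generators act
through x + k and index shifts. -/
theorem rep_translate (a : Alg P) (m : ℤ → ℂ[X]) :
    rep P a (translate m) = translate (rep P a m) := by
  induction a using Alg.induction generalizing m with
  | halg r =>
    rw [AlgHom.commutes]
    ext1 k
    simp [translate]
  | hu =>
    rw [rep_u]
    ext1 k
    simp only [repU, translate, LinearMap.coe_mk, AddHom.coe_mk, mul_comp, comp_assoc, add_comp,
      X_comp, C_comp, add_sub_cancel_right, sub_add_cancel]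
    congr 2
    push_cast
    simp only [C_add, C_sub, C_1]
    ring
  | hv => rw [rep_v]; rfl
  | hz =>
    rw [rep_z]
    ext1 k
    simp only [repZ, translate, LinearMap.coe_mk, AddHom.coe_mk, mul_comp, add_comp,
      X_comp, C_comp]
    push_cast
    simp only [C_sub, C_1]
    ring
  | hmul a b ha hb => rw [map_mul, Module.End.mul_apply, hb, ha]; rfl
  | hadd a b ha hb =>
    rw [map_add, LinearMap.add_apply, ha, hb]
    ext1 k
    simp [translate]

theorem translate_single (k : ℤ) : translate (Pi.single k 1) = Pi.single (k + 1) 1 := by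
  ext1 j
  simp only [translate, Pi.single_apply, sub_eq_iff_eq_add]
  split_ifs <;> simp

variable (P) in
/-- The projection of `𝒜_P` to its part `ℂ[z]` of weight zero. -/
def constPart : Alg P →ₗ[ℂ] ℂ[X] where
  toFun a := rep P a (Pi.single 0 1) 0
  map_add' a b := by simp
  map_smul' r a := by simp

theorem constPart_aeval (R : ℂ[X]) : constPart P (aeval (z P) R) = R := by
  simp [constPart, rep_aeval]

theorem aeval_z_ne_zero {R : ℂ[X]} (hR : R ≠ 0) : aeval (z P) R ≠ 0 := fun h =>
  hR (by rw [← constPart_aeval (P := P) R, h, map_zero])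

theorem aeval_z_mul_v_ne_zero {R : ℂ[X]} (hR : R ≠ 0) : aeval (z P) R * v P ≠ 0 := by
  intro h
  have h2 := congrArg (fun a => rep P a (Pi.single (-1) 1) 0) h
  simp only [map_mul, Module.End.mul_apply, rep_aeval, rep_v, map_zero] at h2
  simp [repV] at h2
  exact hR h2

/-- The identity T(ab) = T(b g(a)), for all b, is stable under sums and products in a, so only
generators matter. For u and v, translation relates the coefficients of ab and ba, and the two sides
become exactly the two sides of the condition on τ. -/
theorem isTwistedTrace_comp_constPart {t : ℂˣ} {τ : ℂ[X] →ₗ[ℂ] ℂ}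
    (hτ : IsTraceFunctional P t τ) : IsTwistedTrace (gt P t) (τ.comp (constPart P)) := by
  intro a
  induction a using Alg.induction with
  | halg r => intro b; rw [AlgHom.commutes, Algebra.commutes]
  | hu =>
    intro b
    rw [gt_u, mul_smul_comm, map_smul, smul_eq_mul]
    have h1 : constPart P (u P * b)
        = P.comp (X + C (1 / 2)) * (rep P b (Pi.single (-1) 1) 0).comp (X + 1) := by
      have := rep_translate b (Pi.single (-1) 1)
      rw [translate_single] at this
      simp only [constPart, LinearMap.coe_mk, AddHom.coe_mk, map_mul, Module.End.mul_apply, rep_u]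
      change _ * rep P b (Pi.single (-1 + 1) 1) 1 = _
      rw [this]
      simp [translate]
    have h2 : constPart P (b * u P)
        = P.comp (X - C (1 / 2)) * rep P b (Pi.single (-1) 1) 0 := by
      have : repU P (Pi.single 0 1) = P.comp (X - C (1 / 2)) • Pi.single (-1) 1 := by
        ext1 k
        simp only [repU, LinearMap.coe_mk, AddHom.coe_mk, Pi.smul_apply, Pi.single_apply,
          smul_eq_mul]
        by_cases h : k = -1
        · subst h
          rw [if_pos (by norm_num), if_pos rfl, sub_eq_add_neg, ← C_neg]
          congr 4
          norm_num
        · rw [if_neg (by omega), if_neg h]; simp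
      simp only [constPart, LinearMap.coe_mk, AddHom.coe_mk, map_mul, Module.End.mul_apply, rep_u,
        this, map_smul, Pi.smul_apply, smul_eq_mul]
    rw [LinearMap.comp_apply, LinearMap.comp_apply, h1, h2, hτ, ← mul_assoc, Units.inv_mul,
      one_mul]
  | hv =>
    intro b
    -- To descend from e₀ to index -1, b must use some u, which leaves the factor P(x - 1/2); the
    -- quotient is the r for which the condition on τ is used.
    obtain ⟨r, hr⟩ := rep_dvd b (Pi.single 0 1)
      (fun k hk => by rw [Pi.single_eq_of_ne hk.ne]; exact dvd_zero _) (-1) (by norm_num)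
    rw [gt_v, mul_smul_comm, map_smul, smul_eq_mul]
    have h1 : constPart P (v P * b) = P.comp (X - C (1 / 2)) * r := by
      rw [← hr]
      simp [constPart, rep_v, repV]
    have h2 : constPart P (b * v P) = P.comp (X + C (1 / 2)) * r.comp (X + 1) := by
      have h3 : repV (Pi.single 0 1) = translate (Pi.single 0 1) := by
        rw [translate_single]
        ext1 k
        simp [repV, Pi.single_apply, sub_eq_iff_eq_add]
      simp only [constPart, LinearMap.coe_mk, AddHom.coe_mk, map_mul, Module.End.mul_apply, rep_v]
      rw [h3, rep_translate]
      change (rep P b (Pi.single 0 1) (0 - 1)).comp (X + 1) = _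
      rw [zero_sub, hr, mul_comp, comp_assoc]
      simp only [sub_comp, X_comp, C_comp]
      congr 2
      rw [← C_1, add_sub_assoc, ← C_sub]
      norm_num
    rw [LinearMap.comp_apply, LinearMap.comp_apply, h1, h2, hτ]
  | hz =>
    intro b
    rw [gt_z]
    have h3 : repZ (Pi.single 0 1) = (X : ℂ[X]) • Pi.single 0 1 := by
      ext1 k
      simp only [repZ, LinearMap.coe_mk, AddHom.coe_mk, Pi.smul_apply, Pi.single_apply,
        smul_eq_mul]
      split_ifs with h <;> simp [h]
    simp only [LinearMap.comp_apply, constPart, LinearMap.coe_mk, AddHom.coe_mk, map_mul,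
      Module.End.mul_apply, rep_z, h3, map_smul]
    simp [repZ]
  | hmul x y hx hy => intro b; rw [mul_assoc, hx, mul_assoc, hy, mul_assoc, map_mul (gt P t)]
  | hadd x y hx hy => intro b; rw [add_mul, map_add, hx, hy, map_add, mul_add, map_add]

end

section
variable {P : ℂ[X]}

/-! ### Unitarity and invariance in terms of the functional on `ℂ[z]` -/

/-- The polynomial `R̄(-x)`. -/
def sharp (R : ℂ[X]) : ℂ[X] := (R.map (starRingEnd ℂ)).comp (-X)

theorem sharp_sharp (R : ℂ[X]) : sharp (sharp R) = R := by
  simp [sharp, Polynomial.map_comp, Polynomial.map_map, comp_assoc]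

theorem sharp_mul (R S : ℂ[X]) : sharp (R * S) = sharp R * sharp S := by
  simp [sharp]

theorem sharp_C (c : ℂ) : sharp (C c) = C (starRingEnd ℂ c) := by
  simp [sharp]

theorem sharp_ne_zero {R : ℂ[X]} (hR : R ≠ 0) : sharp R ≠ 0 := fun h =>
  hR (by rw [← sharp_sharp R, h]; simp [sharp])

theorem eval_sharp (R : ℂ[X]) (x : ℂ) :
    (sharp R).eval x = starRingEnd ℂ (R.eval (-starRingEnd ℂ x)) := by
  rw [sharp, eval_comp, eval_neg, eval_X, Polynomial.eval_map, ← Polynomial.eval₂_hom]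
  simp

theorem conjugation_aeval {l l' : ℂ} {hP : (P.map (starRingEnd ℂ)).comp (-X) = C (l * l') * P}
    (R : ℂ[X]) : conjugation P l l' hP (aeval (z P) R) = aeval (z P) (sharp R) := by
  have h : aeval (z P) R = mk P (aeval (gen .z) R) := (map_mk_aeval _ _ _).symm
  rw [h, conjugation_mk, conjLift_aeval, conjLift_gen, sharp, aeval_comp]
  simp [conjGen]

theorem sigma_aeval {n : ℕ} {hP : P.comp (-X) = C ((-1) ^ n) * P} (R : ℂ[X]) :
    (sigma P n hP (aeval (z P) R)).unop = aeval (z P) (R.comp (-X)) := by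
  rw [← aeval_algHom_apply, sigma_z, aeval_op, MulOpposite.unop_op, aeval_comp]
  simp

theorem isSigmaInvariant_of_aeval {n : ℕ} {hP : P.comp (-X) = C ((-1) ^ n) * P} {t : ℂˣ}
    {T : Alg P →ₗ[ℂ] ℂ} (hT : IsTwistedTrace (gt P t) T)
    (h : ∀ R : ℂ[X], T (aeval (z P) (R.comp (-X))) = T (aeval (z P) R)) :
    IsSigmaInvariant (sigma P n hP) T := by
  let S : Alg P →+ ℂ := T.toAddMonoidHom.comp
    ((MulOpposite.opAddEquiv.symm.toAddMonoidHom).comp (sigma P n hP : Alg P →+ (Alg P)ᵐᵒᵖ))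
  refine fun a => linearMap_ext_of_aeval (T := S) (T' := T.toAddMonoidHom)
    (fun R k hk => ?_) (fun R => ?_) a
  · have hw := hasAdWeight_aeval_mul_zpw (P := P) R k
    exact (hT.eq_zero_of_hasAdWeight hw.sigma hk).trans (hT.eq_zero_of_hasAdWeight hw hk).symm
  · exact (congrArg T (sigma_aeval R)).trans (h R)

open ComplexOrder

section Unitary

variable {l : ℂ} {t : ℂˣ} {hP : (P.map (starRingEnd ℂ)).comp (-X) = C (l * 1) * P}
  {T : Alg P →ₗ[ℂ] ℂ}

/-- The trace carries the leading v around to meet the last u coming from ρ(v). The product uv is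
fixed by `gt P t`, so it can be carried back to the front. Two factors v are thereby traded for the
polynomial uv in z. -/
theorem form_v_mul_mul_v (hl : l * l = 1) (ht : (t : ℂ) = l) (hT : IsTwistedTrace (gt P t) T)
    (b : Alg P) :
    T (v P * b * v P * conjugation P l 1 hP (v P * b * v P)) =
      T (u P * v P * b * conjugation P l 1 hP (u P * v P * b)) := by
  set B := conjugation P l 1 hP b with hB
  have e1 : v P * b * v P * conjugation P l 1 hP (v P * b * v P)
      = v P * (b * (v P * u P) * B * u P) := by
    simp only [map_mul, conjugation_v, ← hB, smul_mul_assoc, mul_smul_comm, smul_smul, hl,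
      one_smul, mul_assoc]
  have e2 : u P * v P * b * conjugation P l 1 hP (u P * v P * b)
      = l • (u P * v P * (b * (v P * u P) * B)) := by
    simp only [map_mul, conjugation_v, conjugation_u, ← hB, smul_mul_assoc, mul_smul_comm,
      one_smul, mul_assoc]
  have e3 : gt P t (u P * v P) = u P * v P := by
    rw [map_mul, gt_u, gt_v, smul_mul_smul_comm, Units.inv_mul, one_smul]
  rw [e1, e2, hT, gt_v, mul_smul_comm, ht, map_smul, map_smul, hT (u P * v P), e3]
  simp only [mul_assoc]

theorem form_v_pow_pos
    (h0 : ∀ R : ℂ[X], R ≠ 0 →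
      0 < T (aeval (z P) R * conjugation P l 1 hP (aeval (z P) R)))
    (h1 : ∀ R : ℂ[X], R ≠ 0 →
      0 < T (aeval (z P) R * v P * conjugation P l 1 hP (aeval (z P) R * v P)))
    (hP0 : P ≠ 0) (hl : l * l = 1) (ht : (t : ℂ) = l)
    (hT : IsTwistedTrace (gt P t) T) (k : ℕ) :
    ∀ R : ℂ[X], R ≠ 0 →
      0 < T (aeval (z P) R * v P ^ k * conjugation P l 1 hP (aeval (z P) R * v P ^ k)) := by
  induction k using Nat.twoStepInduction with
  | zero => simpa only [pow_zero, mul_one] using h0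
  | one => simpa only [pow_one] using h1
  | more k ih _ =>
    intro R hR
    have e1 : aeval (z P) R * v P ^ (k + 2)
        = v P * (aeval (z P) (R.comp (X + 1)) * v P ^ k) * v P := by
      rw [← mul_assoc, v_mul_aeval, comp_assoc]
      simp only [add_comp, X_comp, one_comp, sub_add_cancel, comp_X, mul_assoc, ← pow_succ,
        ← pow_succ']
    have e2 : u P * v P * (aeval (z P) (R.comp (X + 1)) * v P ^ k)
        = aeval (z P) (P.comp (X + C (1 / 2)) * R.comp (X + 1)) * v P ^ k := by
      rw [uv_eq_aeval, map_mul, mul_assoc]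
    rw [e1, form_v_mul_mul_v hl ht hT, e2]
    -- Weight k + 2 with R has become weight k with P(x+1/2) R(x+1), which is nonzero.
    refine ih _ (mul_ne_zero ?_ ?_)
    · rwa [Ne, comp_X_add_C_eq_zero_iff]
    · rwa [Ne, ← C_1, comp_X_add_C_eq_zero_iff]

/-- A negative-weight element R(z)uᵐ is ρ(b) with b of weight m, and ρ(ρ(b)) = g(b). Hence T(ρ(b)
g(b)) = T(b ρ(b)) by the trace property, which is the case already settled. -/
theorem form_zpw_pos
    (h0 : ∀ R : ℂ[X], R ≠ 0 →
      0 < T (aeval (z P) R * conjugation P l 1 hP (aeval (z P) R)))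
    (h1 : ∀ R : ℂ[X], R ≠ 0 →
      0 < T (aeval (z P) R * v P * conjugation P l 1 hP (aeval (z P) R * v P)))
    (hP0 : P ≠ 0) (hl : l * l = 1) (hlc : starRingEnd ℂ l = l)
    (ht : (t : ℂ) = l) (hT : IsTwistedTrace (gt P t) T) (k : ℤ) {R : ℂ[X]} (hR : R ≠ 0) :
    0 < T (aeval (z P) R * zpw P k * conjugation P l 1 hP (aeval (z P) R * zpw P k)) := by
  have hv := form_v_pow_pos h0 h1 hP0 hl ht hT
  rcases k with k | k
  · exact hv k R hR
  · have hlk : ∀ m : ℕ, l ^ m * l ^ m = 1 := fun m => by rw [← mul_pow, hl, one_pow]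
    have hl0 : l ≠ 0 := left_ne_zero_of_mul_eq_one hl
    set m := k + 1
    -- The scalar lᵐ cancels the one produced by ρ(vᵐ) = lᵐuᵐ.
    set b := aeval (z P) (C (l ^ m) * sharp R) * v P ^ m with hb
    have e1 : conjugation P l 1 hP b = aeval (z P) R * u P ^ m := by
      rw [hb, map_mul, conjugation_aeval, map_pow (conjugation P l 1 hP), conjugation_v,
        sharp_mul, sharp_sharp, sharp_C, map_pow, hlc, _root_.smul_pow, map_mul, aeval_C, ← Algebra.smul_def,
        smul_mul_smul_comm, hlk, one_smul]
    have e2 : conjugation P l 1 hP (aeval (z P) R * u P ^ m) = gt P t b := by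
      rw [hb, map_mul (gt P t), ← aeval_algHom_apply, gt_z, map_pow (gt P t), gt_v, map_mul,
        conjugation_aeval, map_pow, conjugation_u, one_smul, ht, _root_.smul_pow, map_mul, aeval_C,
        ← Algebra.smul_def, smul_mul_smul_comm, hlk, one_smul]
    have := hv m (C (l ^ m) * sharp R)
      (mul_ne_zero (C_ne_zero.mpr (pow_ne_zero _ hl0)) (sharp_ne_zero hR))
    rwa [zpw, e2, ← hT, ← e1]

/-- For a_k, a_j of weights k and j the product a_k ρ(a_j) has weight k - j, so the form is diagonal
with respect to weights and positivity may be checked on homogeneous elements. -/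
theorem isUnitaryTrace_of_form_pos
    (h0 : ∀ R : ℂ[X], R ≠ 0 →
      0 < T (aeval (z P) R * conjugation P l 1 hP (aeval (z P) R)))
    (h1 : ∀ R : ℂ[X], R ≠ 0 →
      0 < T (aeval (z P) R * v P * conjugation P l 1 hP (aeval (z P) R * v P)))
    (hP0 : P ≠ 0) (hl : l * l = 1) (hlc : starRingEnd ℂ l = l)
    (ht : (t : ℂ) = l) (hT : IsTwistedTrace (gt P t) T)
    (hreal : ∀ R : ℂ[X], T (aeval (z P) (sharp R)) = starRingEnd ℂ (T (aeval (z P) R))) :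
    IsUnitaryTrace (gt P t) (conjugation P l 1 hP) T where
  trace := hT
  equivariant a := by
    let S : Alg P →+ ℂ := T.toAddMonoidHom.comp (conjugation P l 1 hP : Alg P →+ Alg P)
    let S' : Alg P →+ ℂ := (starRingEnd ℂ : ℂ →+ ℂ).comp T.toAddMonoidHom
    refine linearMap_ext_of_aeval (T := S) (T' := S') (fun R k hk => ?_) (fun R => ?_) a
    · have hw := hasAdWeight_aeval_mul_zpw (P := P) R k
      have h2 : T (aeval (z P) R * zpw P k) = 0 := hT.eq_zero_of_hasAdWeight hw hk
      exact (hT.eq_zero_of_hasAdWeight hw.conjugation (neg_ne_zero.mpr hk)).trans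
        ((congrArg (starRingEnd ℂ) h2).trans (map_zero _)).symm
    · exact (congrArg T (conjugation_aeval R)).trans (hreal R)
  pos a ha := by
    obtain ⟨f, rfl⟩ := ofCoeffs_surjective a
    have hf : f.support.Nonempty := by
      rw [Finsupp.support_nonempty_iff]
      rintro rfl
      exact ha (map_zero _)
    suffices h : 0 < T (ofCoeffs P f * conjugation P l 1 hP (ofCoeffs P f)) by
      rw [Complex.pos_iff] at h
      exact ⟨h.1, h.2.symm⟩
    rw [ofCoeffs_apply, map_sum (conjugation P l 1 hP), Finset.sum_mul, map_sum]
    refine Finset.sum_pos (fun k hk => ?_) hf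
    rw [Finset.mul_sum, map_sum, Finset.sum_eq_single_of_mem k hk]
    · exact form_zpw_pos h0 h1 hP0 hl hlc ht hT k (Finsupp.mem_support_iff.mp hk)
    · intro j _ hj
      refine hT.eq_zero_of_hasAdWeight ((hasAdWeight_aeval_mul_zpw _ k).mul
        (hasAdWeight_aeval_mul_zpw _ j).conjugation) ?_
      rwa [← sub_eq_add_neg, sub_ne_zero, ne_comm]

/-- The form on `R(z) v` in terms of the functional on `ℂ[z]`. -/
theorem form_aeval_mul_v (R : ℂ[X]) :
    T (aeval (z P) R * v P * conjugation P l 1 hP (aeval (z P) R * v P)) =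
      l * T (aeval (z P) ((P * (R.comp (X + C (1 / 2)) *
        sharp (R.comp (X + C (1 / 2))))).comp (X - C (1 / 2)))) := by
  have e : sharp (R.comp (X + C (1 / 2))) = (sharp R).comp (X - C (1 / 2)) := by
    simp only [sharp, Polynomial.map_comp, comp_assoc, Polynomial.map_add, map_X, map_C,
      add_comp, X_comp, C_comp, neg_comp, map_div₀, map_one, Complex.conj_ofNat]
    congr 1
    ring
  have e2 : (1 : ℂ[X]) = C (1 / 2) + C (1 / 2) := by rw [← C_add, ← C_1]; norm_num
  rw [e, map_mul (conjugation P l 1 hP), conjugation_aeval, conjugation_v, mul_smul_comm,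
    mul_smul_comm, map_smul, smul_eq_mul, mul_assoc, ← mul_assoc (v P), v_mul_aeval,
    mul_assoc _ (v P), vu_eq_aeval, ← map_mul, ← map_mul]
  simp only [mul_comp, comp_assoc, add_comp, sub_comp, X_comp, C_comp, sub_add_cancel, comp_X]
  rw [e2, sub_sub, mul_left_comm, mul_comm _ (P.comp _), mul_left_comm, mul_comm R]

end Unitary

end

/-! ### Analysis: contour shifts, cosine and sine weights, growth -/

section
/-! ### Contour shift in the strip `|Re s| ≤ 1/2` -/

theorem integrable_of_continuous_of_exp_decay {f : ℝ → ℂ} (hf : Continuous f) {K δ M : ℝ}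
    (hδ : 0 < δ) (hb : ∀ y, M ≤ |y| → ‖f y‖ ≤ K * Real.exp (-δ * |y|)) : Integrable f := by
  have hg : Integrable (fun y : ℝ => Real.exp (-δ * |y|)) := by
    rw [← integrableOn_univ, ← Set.Iic_union_Ioi (a := (0 : ℝ)), integrableOn_union]
    constructor
    · refine (integrableOn_exp_mul_Iic hδ 0).congr_fun (fun y hy => ?_) measurableSet_Iic
      simp only [abs_of_nonpos (Set.mem_Iic.mp hy), mul_neg, neg_mul, neg_neg]
    · refine (integrableOn_exp_mul_Ioi (neg_lt_zero.mpr hδ) 0).congr_fun (fun y hy => ?_)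
        measurableSet_Ioi
      simp only [abs_of_pos (Set.mem_Ioi.mp hy)]
  refine hf.locallyIntegrable.integrable_of_isBigO_cocompact
    (g := fun y : ℝ => Real.exp (-δ * |y|)) ?_ (hg.integrableAtFilter _)
  refine Asymptotics.IsBigO.of_bound K ?_
  have : ∀ᶠ y : ℝ in cocompact ℝ, M ≤ ‖y‖ := tendsto_norm_cocompact_atTop.eventually_ge_atTop M
  filter_upwards [this] with y hy
  rw [Real.norm_of_nonneg (Real.exp_pos _).le]
  exact hb y hy

/-- Cauchy's theorem on the rectangle with corners -iT and a + iT; the horizontal sides tend to zero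
by the exponential bound. -/
theorem integrable_and_integral_eq_of_strip {G : ℂ → ℂ} {K δ M : ℝ} (hδ : 0 < δ)
    (hG : ∀ s : ℂ, |s.re| ≤ 1 / 2 → DifferentiableAt ℂ G s)
    (hb : ∀ s : ℂ, |s.re| ≤ 1 / 2 → M ≤ |s.im| → ‖G s‖ ≤ K * Real.exp (-δ * |s.im|))
    {a : ℝ} (ha : |a| ≤ 1 / 2) :
    Integrable (fun y : ℝ => G (a + y * Complex.I)) ∧
      ∫ y : ℝ, G (a + y * Complex.I) = ∫ y : ℝ, G (y * Complex.I) := by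
  have hint : ∀ a : ℝ, |a| ≤ 1 / 2 → Integrable (fun y : ℝ => G (a + y * Complex.I)) := by
    intro a ha
    refine integrable_of_continuous_of_exp_decay (M := M) (K := K) ?_ hδ ?_
    · refine continuous_iff_continuousAt.mpr fun y => ?_
      refine ContinuousAt.comp (g := G) (hG _ (by simpa using ha)).continuousAt ?_
      fun_prop
    · intro y hy
      simpa using hb (a + y * Complex.I) (by simpa using ha) (by simpa using hy)
  refine ⟨hint a ha, ?_⟩
  have h0 : Integrable (fun y : ℝ => G (y * Complex.I)) := by
    simpa using hint 0 (by norm_num)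
  have hsub : ∀ x ∈ Set.uIcc 0 a, |x| ≤ 1 / 2 := by
    intro x hx
    have h := Set.abs_sub_left_of_mem_uIcc hx
    rw [sub_zero, sub_zero] at h
    exact h.trans ha
  have rect : ∀ T : ℝ, (∫ x in (0 : ℝ)..a, G (x + (-T : ℝ) * Complex.I)) -
      (∫ x in (0 : ℝ)..a, G (x + T * Complex.I)) +
      Complex.I • (∫ y in -T..T, G (a + y * Complex.I)) -
      Complex.I • (∫ y in -T..T, G (y * Complex.I)) = 0 := by
    intro T
    have := Complex.integral_boundary_rect_eq_zero_of_differentiableOn G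
      (-T * Complex.I) (a + T * Complex.I) (by
        intro s hs
        refine (hG s (hsub _ ?_)).differentiableWithinAt
        simpa using hs.1)
    simpa using this
  have hT : Tendsto (fun T : ℝ => K * Real.exp (-δ * T) * |a - 0|) atTop (𝓝 0) := by
    have : Tendsto (fun T : ℝ => Real.exp (-δ * T)) atTop (𝓝 0) :=
      Real.tendsto_exp_atBot.comp
        (tendsto_id.const_mul_atTop_of_neg (neg_lt_zero.mpr hδ))
    simpa using (this.const_mul K).mul_const |a - 0|
  have hhor : ∀ ε : ℝ, |ε| = 1 →
      Tendsto (fun T : ℝ => ∫ x in (0 : ℝ)..a, G (x + (ε * T : ℝ) * Complex.I)) atTop (𝓝 0) := by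
    intro ε hε
    refine squeeze_zero_norm' ?_ hT
    filter_upwards [eventually_ge_atTop M, eventually_ge_atTop 0] with T hTM hT0
    refine intervalIntegral.norm_integral_le_of_norm_le_const fun x hx => ?_
    have him : |((x : ℂ) + (ε * T : ℝ) * Complex.I).im| = T := by
      simp [abs_mul, hε, abs_of_nonneg hT0]
    have := hb (x + (ε * T : ℝ) * Complex.I)
      (by simpa using hsub x (Set.uIoc_subset_uIcc hx)) (by rw [him]; exact hTM)
    rwa [him] at this
  have l1 := intervalIntegral_tendsto_integral (hint a ha) tendsto_neg_atTop_atBot tendsto_id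
  have l2 := intervalIntegral_tendsto_integral h0 tendsto_neg_atTop_atBot tendsto_id
  have l3 := hhor (-1) (by simp)
  have l4 := hhor 1 (by simp)
  have lim := (((l3.sub l4).add (l1.const_smul Complex.I)).sub (l2.const_smul Complex.I))
  have hz := tendsto_nhds_unique lim (tendsto_const_nhds.congr fun T => by
    simpa using (rect T).symm)
  rw [sub_zero, zero_add, ← smul_sub, smul_eq_zero] at hz
  exact sub_eq_zero.mp (hz.resolve_left Complex.I_ne_zero)

/-! ### Bounds for trigonometric functions -/

theorem norm_exp_I_mul (s : ℂ) : ‖Complex.exp (s * Complex.I)‖ = Real.exp (-s.im) := by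
  rw [Complex.norm_exp]; simp

theorem norm_cos_le (s : ℂ) : ‖Complex.cos s‖ ≤ Real.exp |s.im| := by
  rw [Complex.cos, norm_div, Complex.norm_ofNat, div_le_iff₀ two_pos]
  refine (norm_add_le _ _).trans ?_
  rw [norm_exp_I_mul, norm_exp_I_mul, Complex.neg_im, neg_neg]
  linarith [Real.exp_le_exp.mpr (neg_le_abs s.im), Real.exp_le_exp.mpr (le_abs_self s.im)]

theorem norm_sin_le (s : ℂ) : ‖Complex.sin s‖ ≤ Real.exp |s.im| := by
  rw [← Complex.cos_pi_div_two_sub]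
  simpa using norm_cos_le (Real.pi / 2 - s)

theorem le_norm_sin (s : ℂ) (hs : 1 ≤ |s.im|) : Real.exp |s.im| / 4 ≤ ‖Complex.sin s‖ := by
  have key : ∀ t : ℝ, 1 ≤ t → Real.exp (-t) ≤ Real.exp t / 2 := by
    intro t ht
    have h1 : 2 ≤ Real.exp t := by linarith [Real.add_one_le_exp t]
    have h2 : Real.exp (-t) ≤ 1 := Real.exp_le_one_iff.mpr (by linarith)
    linarith
  rw [Complex.sin, norm_div, norm_mul, Complex.norm_I, mul_one, Complex.norm_ofNat]
  rcases abs_cases s.im with ⟨h, _⟩ | ⟨h, _⟩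
  · have := norm_sub_norm_le (Complex.exp (-s * Complex.I)) (Complex.exp (s * Complex.I))
    rw [norm_exp_I_mul, norm_exp_I_mul, Complex.neg_im, neg_neg] at this
    have := key _ hs
    rw [h] at this ⊢
    linarith
  · have := norm_sub_norm_le (Complex.exp (s * Complex.I)) (Complex.exp (-s * Complex.I))
    rw [norm_exp_I_mul, norm_exp_I_mul, Complex.neg_im, neg_neg, norm_sub_rev] at this
    have := key _ hs
    rw [h, neg_neg] at this
    rw [h]
    linarith

/-! ### The function `s / sin πs` -/

/-- The analytic continuation of `s / sin πs` to the strip `|Re s| < 1`. -/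
def sdivSin (s : ℂ) : ℂ := Complex.Gamma (1 + s) * Complex.Gamma (1 - s) / Real.pi

theorem sin_pi_mul_ne_zero {s : ℂ} (hs : |s.re| < 1) (h0 : s ≠ 0) :
    Complex.sin (Real.pi * s) ≠ 0 := by
  intro h
  obtain ⟨k, hk⟩ := Complex.sin_eq_zero_iff.mp h
  have hpi : (Real.pi : ℂ) ≠ 0 := by exact_mod_cast Real.pi_ne_zero
  have hsk : s = k := mul_left_cancel₀ hpi (by rw [hk, mul_comm])
  rw [hsk, Complex.intCast_re] at hs
  have : |k| < 1 := by exact_mod_cast hs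
  rw [Int.abs_lt_one_iff] at this
  exact h0 (by rw [hsk, this, Int.cast_zero])

/-- Euler's reflection formula. In the Gamma form, holomorphy at 0 and absence of zeros in the strip
are evident. -/
theorem sdivSin_mul_sin {s : ℂ} (hs : |s.re| < 1) :
    sdivSin s * Complex.sin (Real.pi * s) = s := by
  rcases eq_or_ne s 0 with rfl | h0
  · simp
  have hpi : (Real.pi : ℂ) ≠ 0 := by exact_mod_cast Real.pi_ne_zero
  have hsin := sin_pi_mul_ne_zero hs h0
  rw [sdivSin, add_comm, Complex.Gamma_add_one s h0, mul_assoc, Complex.Gamma_mul_Gamma_one_sub,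
    mul_div_assoc, div_div_cancel_left' hpi, mul_assoc, inv_mul_cancel₀ hsin, mul_one]

theorem sdivSin_ne_zero {s : ℂ} (hs : |s.re| < 1) : sdivSin s ≠ 0 := by
  have hpi : (Real.pi : ℂ) ≠ 0 := by exact_mod_cast Real.pi_ne_zero
  rw [abs_lt] at hs
  refine div_ne_zero (mul_ne_zero ?_ ?_) hpi <;>
    refine Complex.Gamma_ne_zero_of_re_pos ?_ <;> simp <;> linarith

theorem differentiableAt_sdivSin {s : ℂ} (hs : |s.re| < 1) : DifferentiableAt ℂ sdivSin s := by
  have key : ∀ w : ℂ, 0 < w.re → DifferentiableAt ℂ Complex.Gamma w := by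
    intro w hw
    refine Complex.differentiableAt_Gamma w fun m h => ?_
    rw [h] at hw
    simp at hw
    linarith [(Nat.cast_nonneg m : (0 : ℝ) ≤ m)]
  rw [abs_lt] at hs
  unfold sdivSin
  refine (DifferentiableAt.mul ?_ ?_).div_const _
  · exact (key (1 + s) (by simp; linarith)).comp (f := fun s : ℂ => 1 + s) s (by fun_prop)
  · exact (key (1 - s) (by simp; linarith)).comp (f := fun s : ℂ => 1 - s) s (by fun_prop)

theorem sdivSin_neg (s : ℂ) : sdivSin (-s) = sdivSin s := by
  rw [sdivSin, sdivSin, sub_neg_eq_add, ← sub_eq_add_neg, mul_comm (Complex.Gamma _)]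

theorem sdivSin_conj (s : ℂ) : sdivSin (starRingEnd ℂ s) = starRingEnd ℂ (sdivSin s) := by
  simp only [sdivSin, map_div₀, map_mul, ← Complex.Gamma_conj, map_add, map_sub, map_one,
    Complex.conj_ofReal]

theorem le_norm_sdivSin {s : ℂ} (hs : |s.re| < 1) :
    ‖s‖ * Real.exp (-(Real.pi * |s.im|)) ≤ ‖sdivSin s‖ := by
  have h := congrArg norm (sdivSin_mul_sin hs)
  rw [norm_mul] at h
  have h2 := norm_sin_le (Real.pi * s)
  rw [Complex.im_ofReal_mul, abs_mul, abs_of_pos Real.pi_pos] at h2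
  rw [Real.exp_neg, ← div_eq_mul_inv, div_le_iff₀ (Real.exp_pos _), ← h]
  exact mul_le_mul_of_nonneg_left h2 (norm_nonneg _)

end

section
/-! ### Functions of exponential type in the strip -/

/-- `|f(s)| ≤ K exp(r |Im s|)` for `|Re s| ≤ 1/2`. -/
def ExpBdd (r : ℝ) (f : ℂ → ℂ) : Prop :=
  ∃ K : ℝ, ∀ s : ℂ, |s.re| ≤ 1 / 2 → ‖f s‖ ≤ K * Real.exp (r * |s.im|)

theorem expBdd_const (a : ℂ) : ExpBdd 0 fun _ => a :=
  ⟨‖a‖, fun s _ => by simp⟩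

theorem ExpBdd.mono {r r' : ℝ} {f : ℂ → ℂ} (hf : ExpBdd r f) (h : r ≤ r') : ExpBdd r' f := by
  obtain ⟨K, hK⟩ := hf
  have hK0 : 0 ≤ K := by simpa using (norm_nonneg _).trans (hK 0 (by simp))
  refine ⟨K, fun s hs => (hK s hs).trans ?_⟩
  gcongr

theorem ExpBdd.add {r : ℝ} {f g : ℂ → ℂ} (hf : ExpBdd r f) (hg : ExpBdd r g) :
    ExpBdd r fun s => f s + g s := by
  obtain ⟨K, hK⟩ := hf
  obtain ⟨K', hK'⟩ := hg
  refine ⟨K + K', fun s hs => (norm_add_le _ _).trans ?_⟩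
  rw [add_mul]
  exact add_le_add (hK s hs) (hK' s hs)

theorem ExpBdd.mul {r r' : ℝ} {f g : ℂ → ℂ} (hf : ExpBdd r f) (hg : ExpBdd r' g) :
    ExpBdd (r + r') fun s => f s * g s := by
  obtain ⟨K, hK⟩ := hf
  obtain ⟨K', hK'⟩ := hg
  refine ⟨K * K', fun s hs => ?_⟩
  rw [norm_mul, add_mul, Real.exp_add, mul_mul_mul_comm]
  exact mul_le_mul (hK s hs) (hK' s hs) (norm_nonneg _) ((norm_nonneg _).trans (hK s hs))

theorem expBdd_id {r : ℝ} (hr : 0 < r) : ExpBdd r fun s => s := by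
  refine ⟨1 / 2 + 1 / r, fun s hs => (Complex.norm_le_abs_re_add_abs_im s).trans ?_⟩
  have h1 : r * |s.im| + 1 ≤ Real.exp (r * |s.im|) := Real.add_one_le_exp _
  have h0 : 0 ≤ r * |s.im| := by positivity
  have h2 : |s.im| = 1 / r * (r * |s.im|) := by field_simp
  have h3 : 1 / r * (r * |s.im|) ≤ 1 / r * Real.exp (r * |s.im|) :=
    mul_le_mul_of_nonneg_left (by linarith) (by positivity)
  rw [add_mul]
  linarith

theorem expBdd_eval (R : ℂ[X]) {r : ℝ} (hr : 0 < r) : ExpBdd r fun s => R.eval s := by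
  induction R using Polynomial.induction_on generalizing r with
  | C a => simpa using (expBdd_const a).mono hr.le
  | add p q hp hq => simpa using (hp hr).add (hq hr)
  | monomial n a ih =>
    -- The rate r is arbitrary in the induction: half of it pays for the extra factor s.
    have := (ih (half_pos hr)).mul (expBdd_id (half_pos hr))
    rw [add_halves] at this
    simpa [pow_succ, mul_assoc] using this

theorem expBdd_exp (a : ℝ) : ExpBdd |a| fun s => Complex.exp (a * s * Complex.I) := by
  refine ⟨1, fun s _ => ?_⟩
  rw [norm_exp_I_mul, Complex.im_ofReal_mul, one_mul, ← abs_mul]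
  exact Real.exp_le_exp.mpr (neg_le_abs _)

/-! ### Weights and contour shift -/

variable {n : ℕ}

/-- The weight `∏ 1 / cos π(x - cⱼ)`. -/
def cosWeight (c : Fin n → ℂ) (x : ℂ) : ℂ := ∏ j, (Complex.cos (Real.pi * (x - c j)))⁻¹

/-- The function `∏ (s - cⱼ) / sin π(s - cⱼ)`. -/
def sinWeight (c : Fin n → ℂ) (s : ℂ) : ℂ := ∏ j, sdivSin (s - c j)

theorem abs_re_sub_lt_one {c : Fin n → ℂ} (hc : ∀ j, |(c j).re| < 1 / 2)
    {s : ℂ} (hs : |s.re| ≤ 1 / 2) (j : Fin n) : |(s - c j).re| < 1 := by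
  rw [Complex.sub_re]
  linarith [abs_sub (s.re) (c j).re, hc j]

theorem sinWeight_mul_prod_sin {c : Fin n → ℂ} (hc : ∀ j, |(c j).re| < 1 / 2)
    {s : ℂ} (hs : |s.re| ≤ 1 / 2) :
    sinWeight c s * ∏ j, Complex.sin (Real.pi * (s - c j)) = ∏ j, (s - c j) := by
  rw [sinWeight, ← Finset.prod_mul_distrib]
  exact Finset.prod_congr rfl fun j _ => sdivSin_mul_sin (abs_re_sub_lt_one hc hs j)

theorem differentiableAt_sinWeight {c : Fin n → ℂ} (hc : ∀ j, |(c j).re| < 1 / 2)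
    {s : ℂ} (hs : |s.re| ≤ 1 / 2) :
    DifferentiableAt ℂ (sinWeight c) s := by
  unfold sinWeight
  refine DifferentiableAt.fun_finsetProd fun j _ => ?_
  exact (differentiableAt_sdivSin (abs_re_sub_lt_one hc hs j)).comp
    (f := fun s : ℂ => s - c j) s (by fun_prop)

theorem prod_norm_sin_ge (c : Fin n → ℂ) : ∃ K M : ℝ, 0 < K ∧ ∀ s : ℂ, M ≤ |s.im| →
    K * Real.exp (n * Real.pi * |s.im|) ≤ ‖∏ j, Complex.sin (Real.pi * (s - c j))‖ := by
  -- Beyond this height every s - c_j has imaginary part of modulus at least 1, so `le_norm_sin`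
  -- applies to each factor.
  refine ⟨∏ j, Real.exp (-(Real.pi * |(c j).im|)) / 4, 1 + ∑ j, |(c j).im|,
    Finset.prod_pos fun j _ => by positivity, fun s hs => ?_⟩
  have : (n : ℝ) * Real.pi * |s.im| = ∑ _j : Fin n, Real.pi * |s.im| := by
    simp [mul_assoc]
  rw [this, Real.exp_sum, ← Finset.prod_mul_distrib, norm_prod]
  refine Finset.prod_le_prod (fun j _ => by positivity) fun j _ => ?_
  have hj : |(c j).im| ≤ ∑ j, |(c j).im| :=
    Finset.single_le_sum (f := fun j => |(c j).im|) (fun _ _ => abs_nonneg _) (Finset.mem_univ j)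
  have h1 : |s.im| - |(c j).im| ≤ |(s - c j).im| := by
    rw [Complex.sub_im]; exact abs_sub_abs_le_abs_sub _ _
  have him : |(Real.pi * (s - c j) : ℂ).im| = Real.pi * |(s - c j).im| := by
    rw [Complex.im_ofReal_mul, abs_mul, abs_of_pos Real.pi_pos]
  refine le_trans ?_ (le_norm_sin _ ?_)
  · rw [him, div_mul_eq_mul_div, ← Real.exp_add]
    gcongr
    nlinarith [Real.pi_pos]
  · rw [him]
    nlinarith [Real.pi_gt_three]

theorem cos_pi_mul_ne_zero {s : ℂ} (hs : |s.re| < 1 / 2) : Complex.cos (Real.pi * s) ≠ 0 := by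
  rw [abs_lt] at hs
  have h := sin_pi_mul_ne_zero (s := s + 1 / 2) (by
    rw [abs_lt]; simp; constructor <;> linarith) (by
    intro h
    have := congrArg Complex.re h
    simp at this
    linarith)
  rwa [mul_add, mul_one_div, Complex.sin_add_pi_div_two] at h

theorem prod_cos_mul_cosWeight {c : Fin n → ℂ} (hc : ∀ j, |(c j).re| < 1 / 2) (y : ℝ) :
    (∏ j, Complex.cos (Real.pi * (Complex.I * y - c j))) * cosWeight c (Complex.I * y) = 1 := by
  rw [cosWeight, ← Finset.prod_mul_distrib]
  refine Finset.prod_eq_one fun j _ => mul_inv_cancel₀ (cos_pi_mul_ne_zero ?_)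
  simpa using hc j

theorem sinWeight_add_half {c : Fin n → ℂ} (hc : ∀ j, |(c j).re| < 1 / 2) (y : ℝ) :
    sinWeight c (Complex.I * y + 1 / 2) =
      (∏ j, (Complex.I * y + 1 / 2 - c j)) * cosWeight c (Complex.I * y) := by
  rw [← sinWeight_mul_prod_sin hc (by simp), mul_assoc]
  have : ∀ j, Complex.sin (Real.pi * (Complex.I * y + 1 / 2 - c j)) =
      Complex.cos (Real.pi * (Complex.I * y - c j)) := by
    intro j
    rw [← Complex.sin_add_pi_div_two]
    ring_nf
  simp only [this, prod_cos_mul_cosWeight hc, mul_one]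

/-- Each sine shifted by -1/2 is minus a cosine; this is the source of the twist (-1)^n. -/
theorem sinWeight_sub_half {c : Fin n → ℂ} (hc : ∀ j, |(c j).re| < 1 / 2) (y : ℝ) :
    sinWeight c (Complex.I * y - 1 / 2) =
      (-1) ^ n * ((∏ j, (Complex.I * y - 1 / 2 - c j)) * cosWeight c (Complex.I * y)) := by
  rw [← sinWeight_mul_prod_sin hc (by simp)]
  have : ∀ j, Complex.sin (Real.pi * (Complex.I * y - 1 / 2 - c j)) =
      -1 * Complex.cos (Real.pi * (Complex.I * y - c j)) := by
    intro j
    rw [neg_one_mul, ← Complex.sin_sub_pi_div_two]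
    ring_nf
  have h1 : ((-1 : ℂ) ^ n) * (-1) ^ n = 1 := by rw [← mul_pow]; norm_num
  simp only [this, Finset.prod_mul_distrib, Finset.prod_const, Finset.card_univ, Fintype.card_fin]
  linear_combination (-(sinWeight c (Complex.I * y - 1 / 2)) * ((-1) ^ n * (-1) ^ n)) *
    prod_cos_mul_cosWeight hc y - sinWeight c (Complex.I * y - 1 / 2) * h1

/-- The product of `sinWeight c` with n sines is ∏ (s - c_j). So if g∏(s - c_j) grows at a rate
below nπ, then g times `sinWeight c` decays exponentially in the strip. -/
theorem shift_sinWeight {c : Fin n → ℂ} (hc : ∀ j, |(c j).re| < 1 / 2) {g : ℂ → ℂ}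
    (hg : Differentiable ℂ g) {r : ℝ} (hr : r < n * Real.pi)
    (hb : ExpBdd r fun s => g s * ∏ j, (s - c j)) {a : ℝ} (ha : |a| ≤ 1 / 2) :
    Integrable (fun y : ℝ => g (Complex.I * y + a) * sinWeight c (Complex.I * y + a)) ∧
      ∫ y : ℝ, g (Complex.I * y + a) * sinWeight c (Complex.I * y + a) =
        ∫ y : ℝ, g (Complex.I * y) * sinWeight c (Complex.I * y) := by
  obtain ⟨K, hK⟩ := hb
  obtain ⟨K', M, hK', hM⟩ := prod_norm_sin_ge c
  have := integrable_and_integral_eq_of_strip (G := fun s => g s * sinWeight c s)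
    (K := K / K') (M := M) (sub_pos.mpr hr)
    (fun s hs => (hg s).mul (differentiableAt_sinWeight hc hs)) (fun s hs hsM => ?_) ha
  · simp only [mul_comm Complex.I, add_comm _ (a : ℂ)]
    exact this
  · have h1 : ‖g s * ∏ j, (s - c j)‖ ≤ K * Real.exp (r * |s.im|) := hK s hs
    rw [← sinWeight_mul_prod_sin hc hs, ← mul_assoc, norm_mul] at h1
    have h2 := (mul_le_mul_of_nonneg_left (hM s hsM) (norm_nonneg (g s * sinWeight c s))).trans h1
    have h3 : Real.exp (-(n * Real.pi - r) * |s.im|)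
        = Real.exp (r * |s.im|) / Real.exp (n * Real.pi * |s.im|) := by
      rw [← Real.exp_sub]; ring_nf
    rw [h3, div_mul_div_comm, le_div_iff₀ (by positivity)]
    exact h2

theorem integrable_mul_sinWeight {c : Fin n → ℂ} (hc : ∀ j, |(c j).re| < 1 / 2) {g : ℂ → ℂ}
    (hg : Differentiable ℂ g) {r : ℝ} (hr : r < n * Real.pi)
    (hb : ExpBdd r fun s => g s * ∏ j, (s - c j)) :
    Integrable (fun y : ℝ => g (Complex.I * y) * sinWeight c (Complex.I * y)) := by
  simpa using (shift_sinWeight hc hg hr hb (a := 0) (by norm_num)).1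

theorem integral_add_half_mul_cosWeight {c : Fin n → ℂ} (hc : ∀ j, |(c j).re| < 1 / 2)
    {g : ℂ → ℂ} (hg : Differentiable ℂ g) {r : ℝ} (hr : r < n * Real.pi)
    (hb : ExpBdd r fun s => g s * ∏ j, (s - c j)) :
    ∫ y : ℝ, g (Complex.I * y + 1 / 2) * (∏ j, (Complex.I * y + 1 / 2 - c j)) *
      cosWeight c (Complex.I * y) = ∫ y : ℝ, g (Complex.I * y) * sinWeight c (Complex.I * y) := by
  rw [← (shift_sinWeight hc hg hr hb (a := 1 / 2) (by norm_num [abs_div])).2]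
  push_cast
  simp only [sinWeight_add_half hc, mul_assoc]

theorem integral_sub_half_mul_cosWeight {c : Fin n → ℂ} (hc : ∀ j, |(c j).re| < 1 / 2)
    {g : ℂ → ℂ} (hg : Differentiable ℂ g) {r : ℝ} (hr : r < n * Real.pi)
    (hb : ExpBdd r fun s => g s * ∏ j, (s - c j)) :
    ∫ y : ℝ, g (Complex.I * y - 1 / 2) * (∏ j, (Complex.I * y - 1 / 2 - c j)) *
      cosWeight c (Complex.I * y) =
      (-1) ^ n * ∫ y : ℝ, g (Complex.I * y) * sinWeight c (Complex.I * y) := by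
  rw [← (shift_sinWeight hc hg hr hb (a := -(1 / 2)) (by norm_num [abs_div])).2,
    ← integral_const_mul]
  have h1 : ((-1 : ℂ) ^ n) * (-1) ^ n = 1 := by rw [← mul_pow]; norm_num
  push_cast
  simp only [← sub_eq_add_neg, sinWeight_sub_half hc]
  congr 1
  ext1 y
  linear_combination (-(g (Complex.I * y - 1 / 2) * (∏ j, (Complex.I * y - 1 / 2 - c j)) *
      cosWeight c (Complex.I * y))) * h1

theorem integrable_mul_cosWeight {c : Fin n → ℂ} (hc : ∀ j, |(c j).re| < 1 / 2) {f : ℂ → ℂ}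
    (hf : Continuous f) {r : ℝ} (hr : r < n * Real.pi) (hb : ExpBdd r f) :
    Integrable (fun y : ℝ => f (Complex.I * y) * cosWeight c (Complex.I * y)) := by
  obtain ⟨K, hK⟩ := hb
  -- Moving the roots by 1/2 turns the lower bound for sines into one for cosines.
  obtain ⟨K', M, hK', hM⟩ := prod_norm_sin_ge (fun j => c j - 1 / 2)
  have hsin : ∀ y : ℝ, ∏ j, Complex.sin (Real.pi * (Complex.I * y - (c j - 1 / 2))) =
      ∏ j, Complex.cos (Real.pi * (Complex.I * y - c j)) := by
    intro y
    refine Finset.prod_congr rfl fun j _ => ?_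
    rw [← Complex.sin_add_pi_div_two]
    ring_nf
  refine integrable_of_continuous_of_exp_decay (K := K / K') (M := M) ?_ (sub_pos.mpr hr)
    fun y hy => ?_
  · refine (by fun_prop : Continuous fun y : ℝ => f (Complex.I * y)).mul ?_
    unfold cosWeight
    refine continuous_finsetProd _ fun j _ => Continuous.inv₀ (by fun_prop) fun y => ?_
    exact cos_pi_mul_ne_zero (by simpa using hc j)
  · have h1 := hK (Complex.I * y) (by simp)
    have h2 := hM (Complex.I * y) (by simpa using hy)
    rw [hsin] at h2
    have h4 := congrArg norm (prod_cos_mul_cosWeight hc y)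
    rw [norm_mul, norm_one] at h4
    have him : |(Complex.I * y : ℂ).im| = |y| := by simp
    rw [him] at h1 h2
    have h3 : Real.exp (-(n * Real.pi - r) * |y|)
        = Real.exp (r * |y|) / Real.exp (n * Real.pi * |y|) := by
      rw [← Real.exp_sub]; ring_nf
    rw [h3, div_mul_div_comm, le_div_iff₀ (by positivity), norm_mul]
    calc _ ≤ ‖f (Complex.I * y)‖ * ‖cosWeight c (Complex.I * y)‖ *
          ‖∏ j, Complex.cos (Real.pi * (Complex.I * y - c j))‖ := by gcongr
      _ = ‖f (Complex.I * y)‖ := by rw [mul_assoc, mul_comm ‖cosWeight _ _‖, h4, mul_one]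
      _ ≤ _ := h1

/-! ### Lower bounds on the imaginary axis -/

theorem le_norm_cosWeight (c : Fin n → ℂ) (hc : ∀ j, |(c j).re| < 1 / 2) :
    ∃ K > 0, ∀ y : ℝ,
      K * Real.exp (-(n * Real.pi) * |y|) ≤ ‖cosWeight c (Complex.I * y)‖ := by
  refine ⟨∏ j, Real.exp (-(Real.pi * |(c j).im|)), Finset.prod_pos fun j _ => Real.exp_pos _,
    fun y => ?_⟩
  have : -((n : ℝ) * Real.pi) * |y| = ∑ _j : Fin n, -(Real.pi * |y|) := by
    simp [mul_assoc]
  rw [this, Real.exp_sum, ← Finset.prod_mul_distrib, cosWeight, norm_prod]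
  refine Finset.prod_le_prod (fun j _ => by positivity) fun j _ => ?_
  rw [norm_inv, ← Real.exp_add, ← neg_add, Real.exp_neg]
  refine inv_anti₀ (norm_pos_iff.mpr (cos_pi_mul_ne_zero (by simpa using hc j))) ?_
  refine (norm_cos_le _).trans (Real.exp_le_exp.mpr ?_)
  rw [Complex.im_ofReal_mul, abs_mul, abs_of_pos Real.pi_pos, ← mul_add]
  gcongr
  have := abs_sub y (c j).im
  simpa [add_comm] using this

theorem le_norm_sinWeight (c : Fin n → ℂ) (hc : ∀ j, |(c j).re| < 1 / 2) :
    ∃ K > 0, ∃ Y : ℝ, ∀ y : ℝ, Y ≤ |y| →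
      K * Real.exp (-(n * Real.pi) * |y|) ≤ ‖sinWeight c (Complex.I * y)‖ := by
  refine ⟨∏ j, Real.exp (-(Real.pi * |(c j).im|)), Finset.prod_pos fun j _ => Real.exp_pos _,
    1 + ∑ j, |(c j).im|, fun y hy => ?_⟩
  have : -((n : ℝ) * Real.pi) * |y| = ∑ _j : Fin n, -(Real.pi * |y|) := by
    simp [mul_assoc]
  rw [this, Real.exp_sum, ← Finset.prod_mul_distrib, sinWeight, norm_prod]
  refine Finset.prod_le_prod (fun j _ => by positivity) fun j _ => ?_
  refine le_trans ?_ (le_norm_sdivSin (abs_re_sub_lt_one hc (by simp) j))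
  have hj : |(c j).im| ≤ ∑ j, |(c j).im| :=
    Finset.single_le_sum (f := fun j => |(c j).im|) (fun _ _ => abs_nonneg _) (Finset.mem_univ j)
  have him : (Complex.I * y - c j).im = y - (c j).im := by simp
  have h1 : 1 ≤ ‖Complex.I * y - c j‖ := by
    refine le_trans ?_ (Complex.abs_im_le_norm _)
    rw [him]
    linarith [abs_sub_abs_le_abs_sub y (c j).im]
  rw [← Real.exp_add, him]
  refine le_trans (Real.exp_le_exp.mpr ?_) (le_mul_of_one_le_left (Real.exp_pos _).le h1)
  rw [← neg_add, ← mul_add]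
  have := abs_sub y (c j).im
  gcongr
  linarith

/-! ### A growth argument -/

/-- e^{μy} is the limit of the squares of the Taylor polynomials of e^{μy/2}, and these squares are
dominated by e^{|μ||y|}. -/
theorem integral_exp_mul_nonneg_of_sq {W : ℝ → ℝ} {μ : ℝ}
    (hW : Integrable fun y => Real.exp (|μ| * |y|) * W y)
    (h : ∀ q : ℝ[X], 0 ≤ ∫ y, q.eval y ^ 2 * W y) :
    0 ≤ ∫ y, Real.exp (μ * y) * W y := by
  let q : ℕ → ℝ[X] := fun N => ∑ k ∈ Finset.range N, C ((μ / 2) ^ k / k.factorial) * X ^ k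
  have hq : ∀ N y, (q N).eval y = ∑ k ∈ Finset.range N, (μ / 2 * y) ^ k / k.factorial := by
    intro N y
    simp only [q, eval_finsetSum, eval_mul, eval_C, eval_pow, eval_X, mul_pow]
    exact Finset.sum_congr rfl fun k _ => by ring
  have hWm : AEStronglyMeasurable W := by
    have h1 : AEStronglyMeasurable (fun y => Real.exp (-(|μ| * |y|))) := by
      apply Continuous.aestronglyMeasurable; fun_prop
    refine (h1.mul hW.1).congr (Eventually.of_forall fun y => ?_)
    simp [← mul_assoc, ← Real.exp_add]
  refine ge_of_tendsto' (tendsto_integral_of_dominated_convergence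
    (F := fun N y => (q N).eval y ^ 2 * W y) (fun y => ‖Real.exp (|μ| * |y|) * W y‖) (fun N => ?_)
    hW.norm (fun N => Eventually.of_forall fun y => ?_) (Eventually.of_forall fun y => ?_))
    fun N => h (q N)
  · refine AEStronglyMeasurable.mul ?_ hWm
    apply Continuous.aestronglyMeasurable
    fun_prop
  · rw [norm_mul, norm_mul]
    refine mul_le_mul_of_nonneg_right ?_ (norm_nonneg _)
    have h2 : |(q N).eval y| ≤ Real.exp (|μ| / 2 * |y|) := by
      rw [hq]
      refine (Finset.abs_sum_le_sum_abs _ _).trans ?_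
      refine le_trans (Finset.sum_le_sum fun k _ => ?_)
        (Real.sum_le_exp_of_nonneg (by positivity : 0 ≤ |μ| / 2 * |y|) N)
      rw [abs_div, abs_pow, abs_mul, abs_div, abs_two, Nat.abs_cast]
    rw [norm_pow, Real.norm_eq_abs, Real.norm_of_nonneg (Real.exp_pos _).le]
    refine (pow_le_pow_left₀ (abs_nonneg _) h2 2).trans_eq ?_
    rw [← Real.exp_nat_mul]
    ring_nf
  · refine Tendsto.mul_const _ ?_
    have h3 : Tendsto (fun N => (q N).eval y) atTop (𝓝 (Real.exp (μ / 2 * y))) := by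
      simp only [hq]
      rw [Real.exp_eq_exp_ℝ]
      exact (NormedSpace.expSeries_div_hasSum_exp (μ / 2 * y)).tendsto_sum_nat
    have := h3.pow 2
    rwa [← Real.exp_nat_mul, show ((2 : ℕ) : ℝ) * (μ / 2 * y) = μ * y by push_cast; ring] at this

/-- Test against e^{μy} with μ = Λ - κ - ε. The c-term is then the moment of V at exponent Λ - ε,
which is at least of order 1/ε because V decays no faster than e^{-Λy}. The other two moments stay
bounded, so c cannot be negative. -/
theorem coeff_nonneg_of_integral_sq_nonneg {V : ℝ → ℝ} {Λ κ K Y a b c : ℝ} (hκ : 0 < κ)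
    (hκΛ : κ < Λ) (hK : 0 < K) (hV : ∀ y, 0 ≤ V y)
    (hint : ∀ μ, |μ| < Λ → Integrable fun y => Real.exp (μ * y) * V y)
    (hlow : ∀ y, Y ≤ y → K * Real.exp (-Λ * y) ≤ V y)
    (h : ∀ q : ℝ[X], 0 ≤ ∫ y, q.eval y ^ 2 *
      ((a * Real.exp (-κ * y) + b + c * Real.exp (κ * y)) * V y)) : 0 ≤ c := by
  by_contra! hc
  let J : ℝ → ℝ := fun μ => ∫ y, Real.exp (μ * y) * V y
  have step1 : ∀ μ, 0 ≤ μ → μ < Λ - κ → 0 ≤ a * J (μ - κ) + b * J μ + c * J (μ + κ) := by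
    intro μ h0 h1
    have e : ∀ ν y : ℝ, Real.exp (ν * y) *
        ((a * Real.exp (-κ * y) + b + c * Real.exp (κ * y)) * V y)
        = a * (Real.exp ((ν - κ) * y) * V y) + b * (Real.exp (ν * y) * V y)
          + c * (Real.exp ((ν + κ) * y) * V y) := by
      intro ν y
      rw [show (ν - κ) * y = ν * y + -κ * y by ring, show (ν + κ) * y = ν * y + κ * y by ring,
        Real.exp_add, Real.exp_add]
      ring
    have hi : ∀ ν, |ν| ≤ μ → Integrable fun y => Real.exp (ν * y) *
        ((a * Real.exp (-κ * y) + b + c * Real.exp (κ * y)) * V y) := by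
      intro ν hν
      simp only [e]
      rw [abs_le] at hν
      refine (((hint _ ?_).const_mul a).add ((hint _ ?_).const_mul b)).add
        ((hint _ ?_).const_mul c) <;> rw [abs_lt] <;> constructor <;> linarith
    have h2 := integral_exp_mul_nonneg_of_sq (μ := μ) ?_ h
    · simp only [e] at h2
      rw [integral_add, integral_add, integral_const_mul, integral_const_mul,
        integral_const_mul] at h2
      · exact h2
      · exact (hint _ (by rw [abs_lt]; constructor <;> linarith)).const_mul a
      · exact (hint _ (by rw [abs_lt]; constructor <;> linarith)).const_mul b
      · exact ((hint _ (by rw [abs_lt]; constructor <;> linarith)).const_mul a).add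
          ((hint _ (by rw [abs_lt]; constructor <;> linarith)).const_mul b)
      · exact (hint _ (by rw [abs_lt]; constructor <;> linarith)).const_mul c
    · rw [abs_of_nonneg h0]
      -- e^{μ|y|} equals e^{μy} or e^{-μy}, so integrability at both exponents suffices.
      have hp := hi μ (abs_of_nonneg h0).le
      have hm := hi (-μ) (by rw [abs_neg, abs_of_nonneg h0])
      refine (hp.norm.add hm.norm).mono' ?_ (Eventually.of_forall fun y => ?_)
      · have h1 : AEStronglyMeasurable (fun y => Real.exp (μ * |y| - μ * y)) := by
          apply Continuous.aestronglyMeasurable; fun_prop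
        refine (h1.mul hp.1).congr (Eventually.of_forall fun y => ?_)
        simp [← mul_assoc, ← Real.exp_add]
      · simp only [Pi.add_apply]
        rcases abs_cases y with ⟨hy, _⟩ | ⟨hy, _⟩
        · rw [hy]; exact le_add_of_nonneg_right (norm_nonneg _)
        · rw [hy, mul_neg, ← neg_mul]; exact le_add_of_nonneg_left (norm_nonneg _)
  -- Bounds the moments uniformly between two fixed exponents, from e^{μy} ≤ e^{μ₀y} + e^{μ₁y}.
  have Jle : ∀ μ μ₀ μ₁, |μ₀| < Λ → |μ₁| < Λ → μ₀ ≤ μ → μ ≤ μ₁ → J μ ≤ J μ₀ + J μ₁ := by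
    intro μ μ₀ μ₁ h0 h1 h2 h3
    have hμ : |μ| < Λ := by
      rw [abs_lt] at *
      constructor <;> linarith [h0.1, h1.2]
    simp only [J]
    rw [← integral_add (hint _ h0) (hint _ h1)]
    refine integral_mono (hint _ hμ) ((hint _ h0).add (hint _ h1)) fun y => ?_
    simp only [← add_mul]
    refine mul_le_mul_of_nonneg_right ?_ (hV y)
    rcases le_total 0 y with hy | hy
    · exact (Real.exp_le_exp.mpr (mul_le_mul_of_nonneg_right h3 hy)).trans
        (le_add_of_nonneg_left (Real.exp_pos _).le)
    · exact (Real.exp_le_exp.mpr (mul_le_mul_of_nonpos_right h2 hy)).trans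
        (le_add_of_nonneg_right (Real.exp_pos _).le)
  have Jnn : ∀ μ, 0 ≤ J μ := fun μ =>
    integral_nonneg fun y => mul_nonneg (Real.exp_pos _).le (hV y)
  set B := |a| * (J (-κ) + J (Λ - 2 * κ)) + |b| * (J 0 + J (Λ - κ)) with hB
  have step2 : ∀ ε, 0 < ε → ε ≤ Λ - κ → -c * (K * Real.exp (-ε * Y)) ≤ B * ε := by
    intro ε h0 h1
    have hl : K * (Real.exp (-ε * Y) / ε) ≤ J (Λ - ε) := by
      have hi := hint (Λ - ε) (by rw [abs_lt]; constructor <;> linarith)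
      have e : K * (Real.exp (-ε * Y) / ε) = ∫ y in Set.Ioi Y, K * Real.exp (-ε * y) := by
        rw [integral_const_mul, integral_exp_mul_Ioi (neg_lt_zero.mpr h0), neg_div_neg_eq]
      rw [e]
      refine (setIntegral_mono_on ((integrableOn_exp_mul_Ioi (neg_lt_zero.mpr h0) Y).const_mul K)
        hi.integrableOn measurableSet_Ioi fun y hy => ?_).trans
        (setIntegral_le_integral hi (Eventually.of_forall fun y =>
          mul_nonneg (Real.exp_pos _).le (hV y)))
      have := mul_le_mul_of_nonneg_left (hlow y (Set.mem_Ioi.mp hy).le)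
        (Real.exp_pos ((Λ - ε) * y)).le
      refine le_trans (le_of_eq ?_) this
      rw [mul_left_comm, ← Real.exp_add]
      ring_nf
    have hs := step1 (Λ - κ - ε) (by linarith) (by linarith)
    rw [show Λ - κ - ε + κ = Λ - ε by ring] at hs
    have ha : a * J (Λ - κ - ε - κ) ≤ |a| * (J (-κ) + J (Λ - 2 * κ)) :=
      (mul_le_mul_of_nonneg_right (le_abs_self a) (Jnn _)).trans
        (mul_le_mul_of_nonneg_left (Jle _ _ _ (by rw [abs_neg, abs_of_pos hκ]; exact hκΛ)
          (by rw [abs_lt]; constructor <;> linarith) (by linarith) (by linarith)) (abs_nonneg _))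
    have hb : b * J (Λ - κ - ε) ≤ |b| * (J 0 + J (Λ - κ)) :=
      (mul_le_mul_of_nonneg_right (le_abs_self b) (Jnn _)).trans
        (mul_le_mul_of_nonneg_left (Jle _ _ _ (by rw [abs_zero]; linarith)
          (by rw [abs_lt]; constructor <;> linarith) (by linarith) (by linarith)) (abs_nonneg _))
    have h5 : -c * (K * (Real.exp (-ε * Y) / ε)) ≤ B := by
      have := mul_le_mul_of_nonneg_left hl (neg_pos.mpr hc).le
      linarith
    calc -c * (K * Real.exp (-ε * Y)) = -c * (K * (Real.exp (-ε * Y) / ε)) * ε := by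
          field_simp
      _ ≤ B * ε := mul_le_mul_of_nonneg_right h5 h0.le
  have l1 : Tendsto (fun ε : ℝ => -c * (K * Real.exp (-ε * Y))) (𝓝[>] 0)
      (𝓝 (-c * (K * Real.exp (-0 * Y)))) :=
    (Continuous.tendsto (by fun_prop) 0).mono_left nhdsWithin_le_nhds
  have l2 : Tendsto (fun ε : ℝ => B * ε) (𝓝[>] 0) (𝓝 (B * 0)) :=
    (Continuous.tendsto (by fun_prop) 0).mono_left nhdsWithin_le_nhds
  have := le_of_tendsto_of_tendsto l1 l2 (by
    filter_upwards [Ioc_mem_nhdsGT (sub_pos.mpr hκΛ)] with ε hε using step2 ε hε.1 hε.2)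
  simp at this
  nlinarith

end

/-! ### The three-parameter family of traces with weight p·w -/

section
variable {n : ℕ}

/-! ### Traces given by quasi-periodic weights -/

/-- The trigonometric polynomial `p₀ e^{2πix} + p₁ + p₂ e^{-2πix}`. -/
def trig (p : Fin 3 → ℂ) (x : ℂ) : ℂ :=
  p 0 * Complex.exp ((2 * Real.pi : ℝ) * x * Complex.I) + p 1 +
    p 2 * Complex.exp ((-(2 * Real.pi) : ℝ) * x * Complex.I)

theorem differentiable_trig (p : Fin 3 → ℂ) : Differentiable ℂ (trig p) := by
  unfold trig; fun_prop

theorem expBdd_trig (p : Fin 3 → ℂ) : ExpBdd (2 * Real.pi) (trig p) := by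
  have hpi := Real.pi_pos
  have h0 : |2 * Real.pi| = 2 * Real.pi := abs_of_pos (by positivity)
  have h1 := expBdd_exp (2 * Real.pi)
  have h2 := expBdd_exp (-(2 * Real.pi))
  rw [abs_neg] at h2
  rw [h0] at h1 h2
  have h3 := (expBdd_const (p 0)).mul h1
  have h4 := (expBdd_const (p 2)).mul h2
  rw [zero_add] at h3 h4
  exact (h3.add ((expBdd_const (p 1)).mono (by positivity))).add h4

/-- This sign reversal of the outer coefficients is what singles out p constant in the unitary case.
-/
theorem trig_add_half (p : Fin 3 → ℂ) (x : ℂ) :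
    trig p (x + 1 / 2) = trig ![-p 0, p 1, -p 2] x := by
  have e1 : Complex.exp ((2 * Real.pi : ℝ) * (x + 1 / 2) * Complex.I) =
      -Complex.exp ((2 * Real.pi : ℝ) * x * Complex.I) := by
    rw [← Complex.exp_add_pi_mul_I]
    push_cast
    ring_nf
  have e2 : Complex.exp ((-(2 * Real.pi) : ℝ) * (x + 1 / 2) * Complex.I) =
      -Complex.exp ((-(2 * Real.pi) : ℝ) * x * Complex.I) := by
    rw [← Complex.exp_sub_pi_mul_I]
    push_cast
    ring_nf
  rw [trig, e1, e2, trig]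
  simp only [Matrix.cons_val_zero, Matrix.cons_val_one, Matrix.cons_val]
  ring

theorem trig_add_one (p : Fin 3 → ℂ) (x : ℂ) : trig p (x + 1) = trig p x := by
  rw [show x + 1 = x + 1 / 2 + 1 / 2 by ring, trig_add_half, trig_add_half]
  simp [trig]

theorem trig_I_mul (p : Fin 3 → ℂ) (y : ℝ) : trig p (Complex.I * y) =
    p 0 * Real.exp (-(2 * Real.pi) * y) + p 1 + p 2 * Real.exp (2 * Real.pi * y) := by
  have e : ∀ a : ℝ, (a : ℂ) * (Complex.I * y) * Complex.I = ((-a * y : ℝ) : ℂ) := by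
    intro a
    push_cast
    linear_combination (a * y : ℂ) * Complex.I_mul_I
  rw [trig, e, e, neg_neg, Complex.ofReal_exp, Complex.ofReal_exp]

/-- The rate is 2π for the exponentials plus π/2 for the polynomial, which stays below nπ for n ≥ 3.
-/
theorem expBdd_eval_mul_trig (R : ℂ[X]) (p : Fin 3 → ℂ) :
    ExpBdd (5 / 2 * Real.pi) fun s => R.eval s * trig p s := by
  have := (expBdd_eval R (half_pos Real.pi_pos)).mul (expBdd_trig p)
  rwa [show Real.pi / 2 + 2 * Real.pi = 5 / 2 * Real.pi by ring] at this

theorem mul_pi_lt_of_three_le (hn : 3 ≤ n) : 5 / 2 * Real.pi < n * Real.pi := by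
  have : (3 : ℝ) ≤ n := by exact_mod_cast hn
  nlinarith [Real.pi_pos]

theorem integrable_eval_mul_trig_mul_cosWeight {c : Fin n → ℂ} (hc : ∀ j, |(c j).re| < 1 / 2)
    (hn : 3 ≤ n) (R : ℂ[X]) (p : Fin 3 → ℂ) :
    Integrable fun y : ℝ => R.eval (Complex.I * y) * trig p (Complex.I * y) *
      cosWeight c (Complex.I * y) :=
  integrable_mul_cosWeight hc (f := fun s => R.eval s * trig p s)
    (R.continuous.mul (differentiable_trig p).continuous) (mul_pi_lt_of_three_le hn)
    (expBdd_eval_mul_trig R p)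

/-- The functional `R ↦ ∫ R(x) p(x) w(x) |dx|` over the imaginary axis, for a trigonometric
polynomial `p`, as a function of `p` and `R`. -/
def weightFunctional (c : Fin n → ℂ) (hc : ∀ j, |(c j).re| < 1 / 2) (hn : 3 ≤ n) :
    (Fin 3 → ℂ) →ₗ[ℂ] ℂ[X] →ₗ[ℂ] ℂ :=
  LinearMap.mk₂ ℂ (fun p R => ∫ y : ℝ, R.eval (Complex.I * y) * trig p (Complex.I * y) *
      cosWeight c (Complex.I * y))
    (fun p p' R => by
      rw [← integral_add (integrable_eval_mul_trig_mul_cosWeight hc hn R p)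
        (integrable_eval_mul_trig_mul_cosWeight hc hn R p')]
      congr 1; ext1 y; simp only [trig, Pi.add_apply]; ring)
    (fun a p R => by
      rw [smul_eq_mul, ← integral_const_mul]
      congr 1; ext1 y; simp only [trig, Pi.smul_apply, smul_eq_mul]; ring)
    (fun p R R' => by
      rw [← integral_add (integrable_eval_mul_trig_mul_cosWeight hc hn R p)
        (integrable_eval_mul_trig_mul_cosWeight hc hn R' p)]
      congr 1; ext1 y; rw [eval_add]; ring)
    (fun a p R => by
      rw [smul_eq_mul, ← integral_const_mul]
      congr 1; ext1 y; rw [eval_smul, smul_eq_mul]; ring)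

section Functional

variable {c : Fin n → ℂ} {hc : ∀ j, |(c j).re| < 1 / 2} {hn : 3 ≤ n} {P : ℂ[X]}

theorem weightFunctional_apply (p : Fin 3 → ℂ) (R : ℂ[X]) : weightFunctional c hc hn p R =
    ∫ y : ℝ, R.eval (Complex.I * y) * trig p (Complex.I * y) * cosWeight c (Complex.I * y) :=
  rfl

theorem eval_prod_X_sub_C (hP : P = ∏ j, (X - C (c j))) (s : ℂ) :
    P.eval s = ∏ j, (s - c j) := by
  rw [hP, eval_prod]
  simp

theorem expBdd_mul_prod (hP : P = ∏ j, (X - C (c j))) (Q : ℂ[X]) (p : Fin 3 → ℂ) :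
    ExpBdd (5 / 2 * Real.pi) fun s => Q.eval s * trig p s * ∏ j, (s - c j) := by
  have := expBdd_eval_mul_trig (Q * P) p
  simp only [eval_mul, eval_prod_X_sub_C hP] at this
  convert this using 2
  ring

theorem integrable_mul_trig_mul_sinWeight (hc : ∀ j, |(c j).re| < 1 / 2) (hn : 3 ≤ n)
    (hP : P = ∏ j, (X - C (c j))) (Q : ℂ[X]) (p : Fin 3 → ℂ) :
    Integrable fun y : ℝ => Q.eval (Complex.I * y) * trig p (Complex.I * y) *
      sinWeight c (Complex.I * y) :=
  integrable_mul_sinWeight hc (g := fun s => Q.eval s * trig p s)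
    (Q.differentiable.mul (differentiable_trig p)) (mul_pi_lt_of_three_le hn)
    (expBdd_mul_prod hP Q p)

/-- With s = x - 1/2 the trigonometric factor is p(s + 1/2), and the line Re s = -1/2 is moved back
to the imaginary axis. -/
theorem weightFunctional_comp_sub_half (hP : P = ∏ j, (X - C (c j))) (p : Fin 3 → ℂ)
    (Q : ℂ[X]) : weightFunctional c hc hn p ((P * Q).comp (X - C (1 / 2))) =
      (-1) ^ n * ∫ y : ℝ, Q.eval (Complex.I * y) * trig ![-p 0, p 1, -p 2] (Complex.I * y) *
        sinWeight c (Complex.I * y) := by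
  rw [weightFunctional_apply, ← integral_sub_half_mul_cosWeight hc
    (g := fun s => Q.eval s * trig ![-p 0, p 1, -p 2] s)
    (Q.differentiable.mul (differentiable_trig _)) (mul_pi_lt_of_three_le hn)
    (expBdd_mul_prod hP Q _)]
  congr 1
  ext1 y
  simp only [eval_comp, eval_mul, eval_sub, eval_X, eval_C, eval_prod_X_sub_C hP,
    ← trig_add_half, sub_add_cancel]
  ring

theorem weightFunctional_comp_add_half (hP : P = ∏ j, (X - C (c j))) (p : Fin 3 → ℂ)
    (Q : ℂ[X]) : weightFunctional c hc hn p ((P * Q).comp (X + C (1 / 2))) =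
      ∫ y : ℝ, Q.eval (Complex.I * y) * trig ![-p 0, p 1, -p 2] (Complex.I * y) *
        sinWeight c (Complex.I * y) := by
  rw [weightFunctional_apply, ← integral_add_half_mul_cosWeight hc
    (g := fun s => Q.eval s * trig ![-p 0, p 1, -p 2] s)
    (Q.differentiable.mul (differentiable_trig _)) (mul_pi_lt_of_three_le hn)
    (expBdd_mul_prod hP Q _)]
  congr 1
  ext1 y
  simp only [eval_comp, eval_mul, eval_add, eval_X, eval_C, eval_prod_X_sub_C hP,
    ← trig_add_half, add_assoc, add_halves, trig_add_one]
  ring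

/-- With Q = r(x + 1/2) the arguments are (PQ)(x - 1/2) and (PQ)(x + 1/2). The contour shift sends
both to the same integral over iℝ, up to the sign (-1)^n. -/
theorem isTraceFunctional_weightFunctional (hP : P = ∏ j, (X - C (c j))) (p : Fin 3 → ℂ) :
    IsTraceFunctional P ((-1) ^ n) (weightFunctional c hc hn p) := by
  intro r
  have h1 := weightFunctional_comp_sub_half (hc := hc) (hn := hn) hP p (r.comp (X + C (1 / 2)))
  have h2 := weightFunctional_comp_add_half (hc := hc) (hn := hn) hP p (r.comp (X + C (1 / 2)))
  simp only [mul_comp, comp_assoc, add_comp, X_comp, C_comp, sub_add_cancel, comp_X, add_assoc,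
    ← C_add, add_halves, C_1] at h1 h2
  rw [h1, h2]

/-! ### Positivity -/

theorem eval_mul_sharp (R : ℂ[X]) (y : ℝ) : (R * sharp R).eval (Complex.I * y) =
    ((‖R.eval (Complex.I * y)‖ ^ 2 : ℝ) : ℂ) := by
  have : -starRingEnd ℂ (Complex.I * y) = Complex.I * y := by simp
  rw [eval_mul, eval_sharp, this, Complex.mul_conj, Complex.normSq_eq_norm_sq]

theorem exists_eval_I_mul_ne_zero {R : ℂ[X]} (hR : R ≠ 0) :
    ∃ y : ℝ, R.eval (Complex.I * y) ≠ 0 := by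
  by_contra! h
  refine hR (eq_zero_of_infinite_isRoot R (Set.Infinite.mono
    (s := Set.range fun y : ℝ => Complex.I * y) ?_ (Set.infinite_range_of_injective ?_)))
  · rintro _ ⟨y, rfl⟩
    exact h y
  · intro y y' hy
    simpa using hy

open ComplexOrder

theorem integral_normSq_mul_pos {W : ℂ → ℂ} (hW : ∀ y : ℝ, 0 < W (Complex.I * y))
    (hcont : Continuous fun y : ℝ => W (Complex.I * y)) {R : ℂ[X]} (hR : R ≠ 0)
    (hint : Integrable fun y : ℝ => (R * sharp R).eval (Complex.I * y) * W (Complex.I * y)) :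
    0 < ∫ y : ℝ, (R * sharp R).eval (Complex.I * y) * W (Complex.I * y) := by
  have e : ∀ y : ℝ, (R * sharp R).eval (Complex.I * y) * W (Complex.I * y) =
      ((‖R.eval (Complex.I * y)‖ ^ 2 * (W (Complex.I * y)).re : ℝ) : ℂ) := by
    intro y
    rw [eval_mul_sharp, Complex.ofReal_mul]
    congr 1
    exact Complex.ext rfl (Complex.pos_iff.mp (hW y)).2.symm
  simp only [e] at hint ⊢
  rw [integral_complex_ofReal, Complex.zero_lt_real]
  obtain ⟨y₀, hy₀⟩ := exists_eval_I_mul_ne_zero hR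
  have hpos := fun y => (Complex.pos_iff.mp (hW y)).1
  refine integral_pos_of_integrable_nonneg_nonzero ?_ ?_ (fun y => ?_)
    (mul_pos (pow_pos (norm_pos_iff.mpr hy₀) 2) (hpos y₀)).ne'
  · exact ((R.continuous.comp (by fun_prop : Continuous fun y : ℝ => Complex.I * y)).norm.pow 2).mul
      (Complex.continuous_re.comp hcont)
  · exact hint.re
  · exact mul_nonneg (by positivity) (hpos y).le

theorem continuous_cosWeight (hc : ∀ j, |(c j).re| < 1 / 2) :
    Continuous fun y : ℝ => cosWeight c (Complex.I * y) := by
  unfold cosWeight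
  refine continuous_finsetProd _ fun j _ => Continuous.inv₀ (by fun_prop) fun y => ?_
  exact cos_pi_mul_ne_zero (by simpa using hc j)

theorem continuous_sinWeight (hc : ∀ j, |(c j).re| < 1 / 2) :
    Continuous fun y : ℝ => sinWeight c (Complex.I * y) :=
  continuous_iff_continuousAt.mpr fun y =>
    ContinuousAt.comp (g := sinWeight c) (differentiableAt_sinWeight hc (by simp)).continuousAt
      (by fun_prop)

/-- The extreme coefficients of a trigonometric polynomial whose product with a positive weight
of critical decay gives a nonnegative functional. -/
theorem re_coeff_nonneg {W : ℂ → ℂ} {Λ K Y : ℝ} (hΛ : 2 * Real.pi < Λ) (hK : 0 < K)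
    (hW : ∀ y : ℝ, 0 < W (Complex.I * y))
    (hint : ∀ μ : ℝ, |μ| < Λ → Integrable fun y : ℝ => Real.exp (μ * y) * W (Complex.I * y))
    (hlow : ∀ y : ℝ, Y ≤ |y| → K * Real.exp (-Λ * |y|) ≤ ‖W (Complex.I * y)‖) {p : Fin 3 → ℂ}
    (h : ∀ R : ℂ[X], 0 ≤ (∫ y : ℝ, (R * sharp R).eval (Complex.I * y) * trig p (Complex.I * y) *
      W (Complex.I * y)).re)
    (hi : ∀ R : ℂ[X], Integrable fun y : ℝ => R.eval (Complex.I * y) * trig p (Complex.I * y) *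
      W (Complex.I * y)) :
    0 ≤ (p 0).re ∧ 0 ≤ (p 2).re := by
  have hWre : ∀ y : ℝ, W (Complex.I * y) = ((W (Complex.I * y)).re : ℂ) := fun y =>
    Complex.ext rfl (Complex.pos_iff.mp (hW y)).2.symm
  have hpos := fun y => (Complex.pos_iff.mp (hW y)).1
  have hlow' : ∀ y : ℝ, Y ≤ |y| → K * Real.exp (-Λ * |y|) ≤ (W (Complex.I * y)).re := by
    intro y hy
    have := hlow y hy
    rwa [hWre, Complex.norm_real, Real.norm_of_nonneg (hpos y).le] at this
  have hint' : ∀ μ : ℝ, |μ| < Λ →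
      Integrable fun y : ℝ => Real.exp (μ * y) * (W (Complex.I * y)).re := by
    intro μ hμ
    have := (hint μ hμ).re
    simpa [-Complex.ofReal_exp, Complex.re_ofReal_mul] using this
  have hq : ∀ q : ℝ[X], 0 ≤ ∫ y : ℝ, q.eval y ^ 2 * (((p 0).re * Real.exp (-(2 * Real.pi) * y) +
      (p 1).re + (p 2).re * Real.exp (2 * Real.pi * y)) * (W (Complex.I * y)).re) := by
    intro q
    -- Chosen so that R(iy) = q(y) is real, whence R·R♯ becomes q(y)².
    set R : ℂ[X] := (q.map Complex.ofRealHom).comp (C (-Complex.I) * X) with hR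
    have hRe : ∀ y : ℝ, R.eval (Complex.I * y) = ((q.eval y : ℝ) : ℂ) := by
      intro y
      have : (-Complex.I) * (Complex.I * y) = Complex.ofRealHom y := by
        rw [← mul_assoc, neg_mul, Complex.I_mul_I, neg_neg, one_mul]; rfl
      rw [hR, eval_comp, eval_mul, eval_C, eval_X, this, Polynomial.eval_map,
        Polynomial.eval₂_hom]
      rfl
    have h1 := h R
    rw [← RCLike.re_eq_complex_re, ← integral_re (hi (R * sharp R))] at h1
    refine h1.trans_eq (integral_congr_ae (Eventually.of_forall fun y => ?_))
    simp only [eval_mul_sharp, hRe, trig_I_mul, Complex.norm_real, Real.norm_eq_abs, sq_abs]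
    rw [hWre, mul_assoc, RCLike.re_eq_complex_re, Complex.re_ofReal_mul, Complex.re_mul_ofReal]
    simp only [Complex.add_re, Complex.re_mul_ofReal, Complex.ofReal_re]
  have hpi := Real.pi_pos
  constructor
  -- The reflection y ↦ -y exchanges the two outer coefficients.
  · refine coeff_nonneg_of_integral_sq_nonneg (V := fun y => (W (Complex.I * (-y : ℝ))).re)
      (a := (p 2).re) (b := (p 1).re) (κ := 2 * Real.pi) (Y := max Y 0) (by positivity) hΛ hK
      (fun y => (hpos (-y)).le)
      (fun μ hμ => ?_) (fun y hy => ?_) fun q => ?_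
    · have := (hint' (-μ) (by rwa [abs_neg])).comp_neg
      simpa using this
    · have h0 : 0 ≤ y := (le_max_right _ _).trans hy
      have := hlow' (-y) (by rw [abs_neg, abs_of_nonneg h0]; exact (le_max_left _ _).trans hy)
      rwa [abs_neg, abs_of_nonneg h0] at this
    · refine (hq (q.comp (-X))).trans_eq ?_
      rw [← integral_neg_eq_self]
      refine integral_congr_ae (Eventually.of_forall fun y => ?_)
      simp only [eval_comp, eval_neg, eval_X, neg_neg, mul_neg, neg_mul]
      ring
  · refine coeff_nonneg_of_integral_sq_nonneg (V := fun y => (W (Complex.I * y)).re)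
      (a := (p 0).re) (b := (p 1).re) (κ := 2 * Real.pi) (Y := max Y 0) (by positivity) hΛ hK
      (fun y => (hpos y).le) hint' (fun y hy => ?_) hq
    have h0 : 0 ≤ y := (le_max_right _ _).trans hy
    have := hlow' y (by rw [abs_of_nonneg h0]; exact (le_max_left _ _).trans hy)
    rwa [abs_of_nonneg h0] at this

theorem cexp_mul_I_mul (μ y : ℝ) :
    Complex.exp ((-μ : ℝ) * (Complex.I * y) * Complex.I) = Real.exp (μ * y) := by
  rw [Complex.ofReal_exp]
  congr 1
  push_cast
  linear_combination (-(μ * y) : ℂ) * Complex.I_mul_I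

theorem re_coeff_nonneg_cosWeight (hc : ∀ j, |(c j).re| < 1 / 2) (hn : 3 ≤ n)
    (hw : ∀ y : ℝ, 0 < cosWeight c (Complex.I * y)) {p : Fin 3 → ℂ}
    (h : ∀ R : ℂ[X], 0 ≤ (weightFunctional c hc hn p (R * sharp R)).re) :
    0 ≤ (p 0).re ∧ 0 ≤ (p 2).re := by
  obtain ⟨K, hK, hlow⟩ := le_norm_cosWeight c hc
  refine re_coeff_nonneg (Λ := n * Real.pi) (Y := 0)
    (lt_trans (by linarith [Real.pi_pos]) (mul_pi_lt_of_three_le hn)) hK hw (fun μ hμ => ?_)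
    (fun y _ => hlow y) h fun R => integrable_eval_mul_trig_mul_cosWeight hc hn R p
  have := integrable_mul_cosWeight hc
    (f := fun s => Complex.exp ((-μ : ℝ) * s * Complex.I)) (by fun_prop)
    (by rwa [← abs_neg] at hμ) (expBdd_exp (-μ))
  simpa only [cexp_mul_I_mul] using this

theorem re_coeff_nonneg_sinWeight (hc : ∀ j, |(c j).re| < 1 / 2) (hn : 3 ≤ n)
    (hP : P = ∏ j, (X - C (c j))) (hw : ∀ y : ℝ, 0 < sinWeight c (Complex.I * y))
    {p : Fin 3 → ℂ}
    (h : ∀ R : ℂ[X], 0 ≤ (∫ y : ℝ, (R * sharp R).eval (Complex.I * y) *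
      trig p (Complex.I * y) * sinWeight c (Complex.I * y)).re) :
    0 ≤ (p 0).re ∧ 0 ≤ (p 2).re := by
  obtain ⟨K, hK, Y, hlow⟩ := le_norm_sinWeight c hc
  refine re_coeff_nonneg (Λ := n * Real.pi) (Y := Y)
    (lt_trans (by linarith [Real.pi_pos]) (mul_pi_lt_of_three_le hn)) hK hw (fun μ hμ => ?_)
    hlow h fun R => integrable_mul_trig_mul_sinWeight hc hn hP R p
  -- The midpoint between |μ| and nπ leaves room for the polynomial factor ∏ (s - c_j).
  have := integrable_mul_sinWeight hc (r := (|μ| + n * Real.pi) / 2)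
    (g := fun s => Complex.exp ((-μ : ℝ) * s * Complex.I)) (by fun_prop)
    (by linarith) (by
      have h1 := (expBdd_exp (-μ)).mul
        (expBdd_eval P (r := (n * Real.pi - |μ|) / 2) (by linarith))
      rw [abs_neg] at h1
      simp only [eval_prod_X_sub_C hP] at h1
      convert h1 using 1
      ring)
  simpa only [cexp_mul_I_mul] using this

/-- The growth argument applies to p, -p, ip and -ip and kills the outer coefficients; the middle
one vanishes because ∫ w > 0. -/
theorem weightFunctional_eq_zero_iff (hw : ∀ y : ℝ, 0 < cosWeight c (Complex.I * y))
    {p : Fin 3 → ℂ} (h : weightFunctional c hc hn p = 0) : p = 0 := by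
  have key : ∀ a : ℂ, 0 ≤ (a * p 0).re ∧ 0 ≤ (a * p 2).re := fun a =>
    re_coeff_nonneg_cosWeight hc hn hw (p := a • p) fun R => by simp [h]
  have h1 := key 1
  have h2 := key (-1)
  have h3 := key Complex.I
  have h4 := key (-Complex.I)
  simp at h1 h2 h3 h4
  have p0 : p 0 = 0 := Complex.ext (le_antisymm h2.1 h1.1) (le_antisymm h3.1 h4.1)
  have p2 : p 2 = 0 := Complex.ext (le_antisymm h2.2 h1.2) (le_antisymm h3.2 h4.2)
  have p1 : p 1 = 0 := by
    have hpos := integral_normSq_mul_pos hw (continuous_cosWeight hc) (R := 1) one_ne_zero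
      (by simpa [sharp, trig] using
        integrable_eval_mul_trig_mul_cosWeight hc hn (1 * sharp 1) ![0, 1, 0])
    have := LinearMap.congr_fun h (1 * sharp 1)
    rw [weightFunctional_apply] at this
    simp only [trig, p0, p2, zero_mul, zero_add, add_zero, LinearMap.zero_apply,
      mul_right_comm _ (p 1)] at this
    rw [integral_mul_const] at this
    exact (mul_eq_zero.mp this).resolve_left hpos.ne'
  ext i
  fin_cases i <;> assumption

end Functional

end

/-! ### Classification of the unitary traces -/

section
variable {n : ℕ}

section Main

variable {c : Fin n → ℂ} {P : ℂ[X]}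

open ComplexOrder

/-- The trace with weight `∏ 1 / cos π(x - cⱼ)`. -/
def weightTrace (P : ℂ[X]) (c : Fin n → ℂ) (hc : ∀ j, |(c j).re| < 1 / 2) (hn : 3 ≤ n) :
    Alg P →ₗ[ℂ] ℂ :=
  (weightFunctional c hc hn ![0, 1, 0]).comp (constPart P)

theorem weightTrace_aeval (hc : ∀ j, |(c j).re| < 1 / 2) (hn : 3 ≤ n) (R : ℂ[X]) :
    weightTrace P c hc hn (aeval (z P) R) = weightFunctional c hc hn ![0, 1, 0] R := by
  rw [weightTrace, LinearMap.comp_apply, constPart_aeval]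

theorem trig_zero_one_zero : trig ![0, 1, 0] = 1 := by
  ext x
  simp [trig]

theorem hasWeight_weightTrace (hc : ∀ j, |(c j).re| < 1 / 2) (hn : 3 ≤ n) :
    HasWeight (weightTrace P c hc hn) (cosWeight c) := by
  intro R
  have h := integrable_eval_mul_trig_mul_cosWeight hc hn R ![0, 1, 0]
  rw [weightTrace_aeval, weightFunctional_apply]
  simpa only [trig_zero_one_zero, Pi.one_apply, mul_one, and_true] using h

theorem isTwistedTrace_weightTrace (hc : ∀ j, |(c j).re| < 1 / 2) (hn : 3 ≤ n)
    (hP : P = ∏ j, (X - C (c j))) :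
    IsTwistedTrace (gt P ((-1) ^ n)) (weightTrace P c hc hn) := by
  refine isTwistedTrace_comp_constPart ?_
  simpa using isTraceFunctional_weightFunctional hP ![0, 1, 0]

theorem isSigmaInvariant_weightTrace (hc : ∀ j, |(c j).re| < 1 / 2) (hn : 3 ≤ n)
    (hP : P = ∏ j, (X - C (c j))) (heven : ∀ x, cosWeight c (-x) = cosWeight c x)
    (hPe : P.comp (-X) = C ((-1) ^ n) * P) :
    IsSigmaInvariant (sigma P n hPe) (weightTrace P c hc hn) := by
  refine isSigmaInvariant_of_aeval (isTwistedTrace_weightTrace hc hn hP) fun R => ?_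
  rw [((hasWeight_weightTrace hc hn) _).2, ((hasWeight_weightTrace hc hn) _).2,
    ← integral_neg_eq_self]
  refine integral_congr_ae (Eventually.of_forall fun y => ?_)
  simp [eval_comp, heven]

theorem weightTrace_one_pos (hc : ∀ j, |(c j).re| < 1 / 2) (hn : 3 ≤ n)
    (hw : ∀ y : ℝ, 0 < cosWeight c (Complex.I * y)) : 0 < weightTrace P c hc hn 1 := by
  have h := hasWeight_weightTrace (P := P) hc hn (1 * sharp 1)
  have := integral_normSq_mul_pos hw (continuous_cosWeight hc) (R := 1) one_ne_zero h.1
  rw [← h.2] at this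
  simpa [sharp] using this

theorem isUnitaryTrace_weightTrace (hc : ∀ j, |(c j).re| < 1 / 2) (hn : 3 ≤ n)
    (hP : P = ∏ j, (X - C (c j))) (hw : ∀ y : ℝ, 0 < cosWeight c (Complex.I * y))
    (hs : ∀ y : ℝ, 0 < sinWeight c (Complex.I * y)) {l : ℂ} (hl : l = (-1) ^ n)
    (hPc : (P.map (starRingEnd ℂ)).comp (-X) = C (l * 1) * P) :
    IsUnitaryTrace (gt P ((-1) ^ n)) (conjugation P l 1 hPc) (weightTrace P c hc hn) := by
  have hll : l * l = 1 := by rw [hl, ← mul_pow]; norm_num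
  refine isUnitaryTrace_of_form_pos (fun R hR => ?_) (fun R hR => ?_) ?_ hll ?_ ?_
    (isTwistedTrace_weightTrace hc hn hP) fun R => ?_
  · rw [conjugation_aeval, ← map_mul, (hasWeight_weightTrace hc hn _).2]
    exact integral_normSq_mul_pos hw (continuous_cosWeight hc) hR
      (hasWeight_weightTrace (P := P) hc hn _).1
  · rw [form_aeval_mul_v, weightTrace_aeval, weightFunctional_comp_sub_half hP, ← mul_assoc, ← hl,
      hll, one_mul]
    have e : trig ![-![(0 : ℂ), 1, 0] 0, ![(0 : ℂ), 1, 0] 1, -![(0 : ℂ), 1, 0] 2] = 1 := by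
      ext x; simp [trig]
    have hi := integrable_mul_trig_mul_sinWeight hc hn hP
      (R.comp (X + C (1 / 2)) * sharp (R.comp (X + C (1 / 2)))) ![0, 1, 0]
    simp only [e, trig_zero_one_zero, Pi.one_apply, mul_one] at hi ⊢
    exact integral_normSq_mul_pos hs (continuous_sinWeight hc)
      (by rwa [Ne, comp_X_add_C_eq_zero_iff]) hi
  · rw [hP]; exact Finset.prod_ne_zero_iff.mpr fun j _ => X_sub_C_ne_zero _
  · rw [hl]; simp
  · rw [hl]; simp
  · rw [(hasWeight_weightTrace hc hn _).2, (hasWeight_weightTrace hc hn _).2, ← integral_conj]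
    refine integral_congr_ae (Eventually.of_forall fun y => ?_)
    have : starRingEnd ℂ (cosWeight c (Complex.I * y)) = cosWeight c (Complex.I * y) :=
      Complex.conj_eq_iff_im.mpr (Complex.pos_iff.mp (hw y)).2.symm
    simp [eval_sharp, this]

/-- Dimension count: sending p to the values of its functional on 1, x, x² is an injective
endomorphism of ℂ³, hence surjective, and these three values determine a trace functional. -/
theorem exists_weightFunctional_eq (hc : ∀ j, |(c j).re| < 1 / 2) (hn : 3 ≤ n)
    (hP : P = ∏ j, (X - C (c j))) (hw : ∀ y : ℝ, 0 < cosWeight c (Complex.I * y))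
    (hdet : ∀ τ : ℂ[X] →ₗ[ℂ] ℂ, IsTraceFunctional P ((-1) ^ n) τ →
      (∀ i : Fin 3, τ (X ^ (i : ℕ)) = 0) → τ = 0) {τ : ℂ[X] →ₗ[ℂ] ℂ}
    (hτ : IsTraceFunctional P ((-1) ^ n) τ) : ∃ p, τ = weightFunctional c hc hn p := by
  let ev : (ℂ[X] →ₗ[ℂ] ℂ) →ₗ[ℂ] (Fin 3 → ℂ) :=
    LinearMap.pi fun i => LinearMap.applyₗ (X ^ (i : ℕ))
  have hinj : Function.Injective (ev ∘ₗ weightFunctional c hc hn) := by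
    rw [← LinearMap.ker_eq_bot, LinearMap.ker_eq_bot']
    intro p hp
    exact weightFunctional_eq_zero_iff (hc := hc) (hn := hn) hw
      (hdet _ (isTraceFunctional_weightFunctional hP p) fun i => congrFun hp i)
  obtain ⟨p, hp⟩ := LinearMap.injective_iff_surjective.mp hinj (ev τ)
  refine ⟨p, sub_eq_zero.mp (hdet _ (fun r => ?_) fun i => ?_)⟩
  · rw [LinearMap.sub_apply, LinearMap.sub_apply, hτ,
      isTraceFunctional_weightFunctional hP p, mul_sub]
  · rw [LinearMap.sub_apply, sub_eq_zero]
    exact (congrFun hp i).symm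

/-- Positivity in weight 0 gives Re p₀, Re p₂ ≥ 0 and positivity in weight 1 gives the opposite
inequalities, since there p enters through p(x + 1/2). -/
theorem isUnitaryTrace_iff (hc : ∀ j, |(c j).re| < 1 / 2) (hn : 3 ≤ n)
    (hP : P = ∏ j, (X - C (c j))) (hw : ∀ y : ℝ, 0 < cosWeight c (Complex.I * y))
    (hs : ∀ y : ℝ, 0 < sinWeight c (Complex.I * y)) {l : ℂ} (hl : l = (-1) ^ n)
    (hPc : (P.map (starRingEnd ℂ)).comp (-X) = C (l * 1) * P)
    (hdet : ∀ τ : ℂ[X] →ₗ[ℂ] ℂ, IsTraceFunctional P ((-1) ^ n) τ →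
      (∀ i : Fin 3, τ (X ^ (i : ℕ)) = 0) → τ = 0) (T : Alg P →ₗ[ℂ] ℂ) :
    IsUnitaryTrace (gt P ((-1) ^ n)) (conjugation P l 1 hPc) T ↔
      ∃ r : ℝ, 0 < r ∧ T = (r : ℂ) • weightTrace P c hc hn := by
  have hll : l * l = 1 := by rw [hl, ← mul_pow]; norm_num
  have hT₀ := isUnitaryTrace_weightTrace hc hn hP hw hs hl hPc
  constructor
  · intro hT
    have hτ := hT.trace.isTraceFunctional
    have hpos : ∀ a, a ≠ 0 → 0 < T (a * conjugation P l 1 hPc a) := fun a ha =>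
      Complex.pos_iff.mpr ⟨(hT.pos a ha).1, (hT.pos a ha).2.symm⟩
    obtain ⟨p, hp⟩ := exists_weightFunctional_eq hc hn hP hw hdet (by simpa using hτ)
    have hTp : ∀ R : ℂ[X], T (aeval (z P) R) = weightFunctional c hc hn p R := fun R =>
      LinearMap.congr_fun hp R
    have h0 : ∀ R : ℂ[X], 0 ≤ weightFunctional c hc hn p (R * sharp R) := by
      intro R
      rcases eq_or_ne R 0 with rfl | hR
      · simp
      · rw [← hTp, map_mul, ← conjugation_aeval (hP := hPc)]
        exact (hpos _ (aeval_z_ne_zero hR)).le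
    have h1 : ∀ R : ℂ[X], 0 ≤ ∫ y : ℝ, (R * sharp R).eval (Complex.I * y) *
        trig ![-p 0, p 1, -p 2] (Complex.I * y) * sinWeight c (Complex.I * y) := by
      intro R
      rcases eq_or_ne R 0 with rfl | hR
      · simp
      have hR' : R.comp (X - C (1 / 2)) ≠ 0 := by
        rwa [sub_eq_add_neg, ← C_neg, Ne, comp_X_add_C_eq_zero_iff]
      have := hpos _ (aeval_z_mul_v_ne_zero hR')
      rw [form_aeval_mul_v, hTp, weightFunctional_comp_sub_half hP, ← mul_assoc, ← hl, hll,
        one_mul, comp_assoc] at this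
      simp only [sub_comp, X_comp, C_comp, add_sub_cancel_right, comp_X] at this
      exact this.le
    -- The functional is real on R·R♯, so an imaginary multiple has real part zero there. The
    -- choices a = ±i thus show that the outer coefficients are real.
    have k0 : ∀ a : ℂ, a.re = 0 ∨ a = 1 → 0 ≤ (a * p 0).re ∧ 0 ≤ (a * p 2).re := by
      intro a ha
      refine re_coeff_nonneg_cosWeight hc hn hw (p := a • p) fun R => ?_
      have h2 := Complex.nonneg_iff.mp (h0 R)
      rw [map_smul, LinearMap.smul_apply, smul_eq_mul, Complex.mul_re, ← h2.2, mul_zero, sub_zero]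
      rcases ha with ha | rfl
      · rw [ha, zero_mul]
      · simpa using h2.1
    have k1 := re_coeff_nonneg_sinWeight hc hn hP hs fun R => (Complex.nonneg_iff.mp (h1 R)).1
    have k2 := k0 1 (Or.inr rfl)
    have k3 := k0 Complex.I (Or.inl (by simp))
    have k4 := k0 (-Complex.I) (Or.inl (by simp))
    simp at k1 k2 k3 k4
    have p0 : p 0 = 0 := Complex.ext (le_antisymm k1.1 k2.1) (le_antisymm k3.1 k4.1)
    have p2 : p 2 = 0 := Complex.ext (le_antisymm k1.2 k2.2) (le_antisymm k3.2 k4.2)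
    have hp1 : p = p 1 • ![0, 1, 0] := by
      ext i
      fin_cases i <;> simp [p0, p2]
    have hTT : T = p 1 • weightTrace P c hc hn := by
      refine hT.trace.ext (fun a b => ?_) fun R => ?_
      · rw [LinearMap.smul_apply, LinearMap.smul_apply, isTwistedTrace_weightTrace hc hn hP]
      · rw [hTp, hp1, map_smul, LinearMap.smul_apply, LinearMap.smul_apply, weightTrace_aeval]
        simp
    -- Both T(1) and ∫ w are positive, so their ratio p₁ is a positive real number.
    have hT1 := hpos _ (aeval_z_ne_zero (P := P) (one_ne_zero (α := ℂ[X])))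
    rw [map_one, map_one, mul_one, hTT, LinearMap.smul_apply, smul_eq_mul] at hT1
    obtain ⟨hre', him'⟩ := Complex.pos_iff.mp (weightTrace_one_pos (P := P) hc hn hw)
    obtain ⟨hre, him⟩ := Complex.pos_iff.mp hT1
    rw [Complex.mul_re, ← him', mul_zero, sub_zero] at hre
    rw [Complex.mul_im, ← him', mul_zero, zero_add] at him
    replace hre := pos_of_mul_pos_left hre hre'.le
    replace him : 0 = (p 1).im := (mul_eq_zero.mp him.symm).resolve_right hre'.ne' |>.symm
    refine ⟨(p 1).re, hre, ?_⟩
    rwa [← show p 1 = ((p 1).re : ℂ) from Complex.ext rfl him.symm]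
  · rintro ⟨r, hr, rfl⟩
    refine ⟨fun a b => ?_, fun a => ?_, fun a ha => ?_⟩
    · rw [LinearMap.smul_apply, LinearMap.smul_apply, hT₀.trace]
    · rw [LinearMap.smul_apply, LinearMap.smul_apply, hT₀.equivariant, smul_eq_mul, smul_eq_mul,
        map_mul, Complex.conj_ofReal]
    · rw [LinearMap.smul_apply, smul_eq_mul, Complex.re_ofReal_mul, Complex.im_ofReal_mul,
        (hT₀.pos a ha).2, mul_zero]
      exact ⟨mul_pos hr (hT₀.pos a ha).1, rfl⟩

end Main

/-! ### Reduction of trace functionals to low degree -/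

theorem linearMap_eq_zero_of_degree_lt {E : Type*} [AddCommGroup E] [Module ℂ E]
    {τ : ℂ[X] →ₗ[ℂ] E} (h : ∀ i : Fin 3, τ (X ^ (i : ℕ)) = 0)
    (hred : ∀ m : ℕ, ∃ Q : ℂ[X], τ Q = 0 ∧ Q.natDegree = m + 3) : τ = 0 := by
  suffices H : ∀ m : ℕ, ∀ R : ℂ[X], R.natDegree < m → τ R = 0 by
    ext m
    simpa using H _ _ (Nat.lt_succ_self (natDegree (monomial m (1 : ℂ))))
  intro m
  induction m with
  | zero => intro R hR; omega
  | succ m ih =>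
    intro R hR
    by_cases hm : m < 3
    · rw [R.as_sum_range' 3 (by omega), map_sum]
      refine Finset.sum_eq_zero fun i hi => ?_
      rw [← C_mul_X_pow_eq_monomial, ← smul_eq_C_mul, map_smul,
        h ⟨i, Finset.mem_range.mp hi⟩, smul_zero]
    · obtain ⟨Q, hQ, hdeg⟩ := hred (m - 3)
      rw [Nat.sub_add_cancel (not_lt.mp hm)] at hdeg
      have hQ0 : Q.leadingCoeff ≠ 0 := by
        rw [Ne, leadingCoeff_eq_zero]
        rintro rfl
        rw [natDegree_zero] at hdeg
        omega
      set a := R.coeff m / Q.leadingCoeff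
      have h1 : τ (R - a • Q) = 0 := by
        refine ih _ (lt_of_le_of_lt ?_ (by omega : m - 1 < m))
        rw [natDegree_le_iff_coeff_eq_zero]
        intro N hN
        rw [coeff_sub, coeff_smul, smul_eq_mul]
        rcases eq_or_ne N m with rfl | hNm
        · rw [← hdeg, coeff_natDegree, hdeg, div_mul_cancel₀ _ hQ0, sub_self]
        · rw [coeff_eq_zero_of_natDegree_lt (by omega), coeff_eq_zero_of_natDegree_lt (by omega),
            mul_zero, sub_zero]
      rw [map_sub, map_smul, hQ, smul_zero, sub_zero] at h1
      exact h1

theorem coeff_comp_X_add_C {f : ℂ[X]} {d : ℕ} (hf : f.natDegree ≤ d + 1) (a : ℂ) :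
    (f.comp (X + C a)).coeff d = f.coeff d + (d + 1) * a * f.coeff (d + 1) := by
  rw [← taylor_apply, taylor_coeff, hasseDeriv_apply,
    sum_over_range' _ (by simp) (d + 2) (by omega), Finset.sum_range_succ, Finset.sum_range_succ,
    Finset.sum_eq_zero]
  · simp
    ring
  · intro i hi
    rw [Nat.choose_eq_zero_of_lt (Finset.mem_range.mp hi)]
    simp

/-- For odd n the trace condition annihilates a sum of two monic polynomials of degree m + 3, whose
leading coefficient is 2. -/
theorem IsTraceFunctional.eq_zero_of_natDegree_eq_three {P : ℂ[X]} (hP : P.Monic)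
    (hd : P.natDegree = 3) {τ : ℂ[X] →ₗ[ℂ] ℂ} (hτ : IsTraceFunctional P ((-1) ^ 3) τ)
    (h : ∀ i : Fin 3, τ (X ^ (i : ℕ)) = 0) : τ = 0 := by
  refine linearMap_eq_zero_of_degree_lt h fun m =>
    ⟨(P * X ^ m).comp (X - C (1 / 2)) + (P * X ^ m).comp (X + C (1 / 2)), ?_, ?_⟩
  · have := hτ ((X ^ m : ℂ[X]).comp (X - C (1 / 2)))
    rw [comp_assoc] at this
    simp only [sub_comp, X_comp, C_comp] at this
    have e : X + 1 - C (1 / 2 : ℂ) = X + C (1 / 2) := by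
      rw [← C_1, add_sub_assoc, ← C_sub]; norm_num
    rw [map_add, mul_comp, mul_comp, this, e]
    ring
  · have hm : (P * X ^ m).Monic := hP.mul (monic_X_pow m)
    have hdm : (P * X ^ m).natDegree = m + 3 := by
      rw [hP.natDegree_mul (monic_X_pow m), hd, natDegree_X_pow, add_comm]
    have key : ∀ a : ℂ, ((P * X ^ m).comp (X + C a)).natDegree = m + 3 ∧
        ((P * X ^ m).comp (X + C a)).coeff (m + 3) = 1 := by
      intro a
      have h1 : ((P * X ^ m).comp (X + C a)).natDegree = m + 3 := by
        rw [natDegree_comp, natDegree_X_add_C, mul_one, hdm]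
      refine ⟨h1, ?_⟩
      rw [← h1, coeff_natDegree]
      exact hm.comp_X_add_C a
    rw [sub_eq_add_neg, ← C_neg]
    refine natDegree_eq_of_le_of_coeff_ne_zero
      (natDegree_add_le_of_degree_le (key _).1.le (key _).1.le) ?_
    rw [coeff_add, (key _).2, (key _).2]
    norm_num

/-- For even n the annihilated combination is a difference: the terms of degree m + 4 cancel and the
coefficient m + 4 remains in degree m + 3. Hence degree 4 also leaves just three free values. -/
theorem IsTraceFunctional.eq_zero_of_natDegree_eq_four {P : ℂ[X]} (hP : P.Monic)
    (hd : P.natDegree = 4) {τ : ℂ[X] →ₗ[ℂ] ℂ} (hτ : IsTraceFunctional P ((-1) ^ 4) τ)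
    (h : ∀ i : Fin 3, τ (X ^ (i : ℕ)) = 0) : τ = 0 := by
  refine linearMap_eq_zero_of_degree_lt h fun m =>
    ⟨(P * X ^ m).comp (X + C (1 / 2)) - (P * X ^ m).comp (X - C (1 / 2)), ?_, ?_⟩
  · have := hτ ((X ^ m : ℂ[X]).comp (X - C (1 / 2)))
    rw [comp_assoc] at this
    simp only [sub_comp, X_comp, C_comp] at this
    have e : X + 1 - C (1 / 2 : ℂ) = X + C (1 / 2) := by
      rw [← C_1, add_sub_assoc, ← C_sub]; norm_num
    rw [map_sub, mul_comp, mul_comp, this, e]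
    ring
  · have hm : (P * X ^ m).Monic := hP.mul (monic_X_pow m)
    have hdm : (P * X ^ m).natDegree = m + 3 + 1 := by
      rw [hP.natDegree_mul (monic_X_pow m), hd, natDegree_X_pow]; omega
    have h4 : (P * X ^ m).coeff (m + 3 + 1) = 1 := by
      rw [← hdm, coeff_natDegree]; exact hm
    have key : ∀ a : ℂ, ((P * X ^ m).comp (X + C a)).natDegree = m + 3 + 1 := by
      intro a
      rw [natDegree_comp, natDegree_X_add_C, mul_one, hdm]
    have top : ∀ a : ℂ, ((P * X ^ m).comp (X + C a)).coeff (m + 3 + 1) = 1 := by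
      intro a
      rw [← key a, coeff_natDegree]
      exact hm.comp_X_add_C a
    rw [sub_eq_add_neg X, ← C_neg]
    refine natDegree_eq_of_le_of_coeff_ne_zero ?_ ?_
    · rw [natDegree_le_iff_coeff_eq_zero]
      intro N hN
      rw [coeff_sub]
      rcases eq_or_ne N (m + 3 + 1) with rfl | hNm
      · rw [top, top, sub_self]
      · rw [coeff_eq_zero_of_natDegree_lt, coeff_eq_zero_of_natDegree_lt, sub_zero] <;>
          rw [key] <;> omega
    · rw [coeff_sub, coeff_comp_X_add_C hdm.le, coeff_comp_X_add_C hdm.le, h4]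
      have : ((m + 3 : ℕ) : ℂ) + 1 ≠ 0 := Nat.cast_add_one_ne_zero _
      intro h0
      apply this
      linear_combination h0

end

/-! ### The roots of `P₃` and `P₄`: positivity of the weights -/

section
/-! ### Positivity of pairs of factors -/

section Pair

open ComplexOrder

theorem re_eq_zero_or_im_eq_zero_of_sq {β : ℂ} {b : ℝ} (hβ : β ^ 2 = b) :
    (β.re = 0 ∧ -b = β.im ^ 2) ∨ (β.im = 0 ∧ b = β.re ^ 2) := by
  have h1 := congrArg Complex.im hβ
  have h2 := congrArg Complex.re hβ
  rw [pow_two] at h1 h2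
  simp only [Complex.mul_im, Complex.mul_re, Complex.ofReal_im, Complex.ofReal_re] at h1 h2
  have h3 : β.re * β.im = 0 := by linarith
  rcases mul_eq_zero.mp h3 with h | h
  · left; refine ⟨h, ?_⟩; rw [h] at h2; linarith
  · right; refine ⟨h, ?_⟩; rw [h] at h2; linarith

theorem abs_re_I_mul_lt {β : ℂ} {b : ℝ} (hβ : β ^ 2 = b) (hb : -(1 / 4) < b) :
    |(Complex.I * β).re| < 1 / 2 := by
  have : (Complex.I * β).re = -β.im := by simp
  rw [this, abs_neg]
  rcases re_eq_zero_or_im_eq_zero_of_sq hβ with ⟨_, h⟩ | ⟨h, _⟩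
  · rw [abs_lt]; constructor <;> nlinarith
  · rw [h]; norm_num

/-- As β² is real, β is real or imaginary. If real, both arguments lie on iℝ, where g > 0; if
imaginary, they are exchanged by s ↦ -conj s and the product is |g|². -/
theorem pair_pos {g : ℂ → ℂ} (heven : ∀ s, g (-s) = g s)
    (hconj : ∀ s, g (starRingEnd ℂ s) = starRingEnd ℂ (g s))
    (hpos : ∀ t : ℝ, 0 < g (Complex.I * t)) (hne : ∀ s : ℂ, |s.re| < 1 / 2 → g s ≠ 0)
    {β : ℂ} {b : ℝ} (hβ : β ^ 2 = b) (hb : -(1 / 4) < b) (y : ℝ) :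
    0 < g (Complex.I * y - Complex.I * β) * g (Complex.I * y + Complex.I * β) := by
  have hlt := abs_re_I_mul_lt hβ hb
  rcases re_eq_zero_or_im_eq_zero_of_sq hβ with ⟨h, _⟩ | ⟨h, _⟩
  · have e : Complex.I * y - Complex.I * β
        = -starRingEnd ℂ (Complex.I * y + Complex.I * β) := by
      apply Complex.ext <;> simp [h]
    have hs : g (Complex.I * y + Complex.I * β) ≠ 0 := hne _ (by simpa using hlt)
    rw [e, heven, hconj, ← Complex.normSq_eq_conj_mul_self, Complex.zero_lt_real]
    exact Complex.normSq_pos.mpr hs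
  · have e : β = (β.re : ℂ) := Complex.ext rfl h
    rw [e, ← mul_sub, ← mul_add, ← Complex.ofReal_sub, ← Complex.ofReal_add]
    exact mul_pos (hpos _) (hpos _)

theorem inv_cos_I_mul_pos (t : ℝ) : 0 < (Complex.cos (Real.pi * (Complex.I * t)))⁻¹ := by
  have : Complex.cos (Real.pi * (Complex.I * t)) = (Real.cosh (Real.pi * t) : ℝ) := by
    rw [Complex.ofReal_cosh, ← Complex.cos_mul_I]
    push_cast
    ring_nf
  rw [this, ← Complex.ofReal_inv, Complex.zero_lt_real]
  exact inv_pos.mpr (Real.cosh_pos _)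

theorem sdivSin_I_mul_pos (t : ℝ) : 0 < sdivSin (Complex.I * t) := by
  have e : 1 - Complex.I * t = starRingEnd ℂ (1 + Complex.I * t) := by
    apply Complex.ext <;> simp
  have h : Complex.Gamma (1 + Complex.I * t) ≠ 0 :=
    Complex.Gamma_ne_zero_of_re_pos (by simp)
  rw [sdivSin, e, Complex.Gamma_conj, Complex.mul_conj, ← Complex.ofReal_div,
    Complex.zero_lt_real]
  exact div_pos (Complex.normSq_pos.mpr h) Real.pi_pos

theorem inv_cos_pair_pos {β : ℂ} {b : ℝ} (hβ : β ^ 2 = b) (hb : -(1 / 4) < b) (y : ℝ) :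
    0 < (Complex.cos (Real.pi * (Complex.I * y - Complex.I * β)))⁻¹ *
      (Complex.cos (Real.pi * (Complex.I * y + Complex.I * β)))⁻¹ := by
  refine pair_pos (g := fun s => (Complex.cos (Real.pi * s))⁻¹) (fun s => ?_) (fun s => ?_)
    inv_cos_I_mul_pos (fun s hs => inv_ne_zero (cos_pi_mul_ne_zero hs)) hβ hb y
  · rw [mul_neg, Complex.cos_neg]
  · rw [map_inv₀, ← Complex.cos_conj, map_mul, Complex.conj_ofReal]

theorem sdivSin_pair_pos {β : ℂ} {b : ℝ} (hβ : β ^ 2 = b) (hb : -(1 / 4) < b) (y : ℝ) :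
    0 < sdivSin (Complex.I * y - Complex.I * β) * sdivSin (Complex.I * y + Complex.I * β) :=
  pair_pos sdivSin_neg sdivSin_conj sdivSin_I_mul_pos
    (fun _ hs => sdivSin_ne_zero (hs.trans (by norm_num))) hβ hb y

end Pair

/-! ### The roots for `n = 3` and `n = 4` -/

/-- The roots of `P₃`. -/
def roots₃ (β : ℂ) : Fin 3 → ℂ := ![0, Complex.I * β, -(Complex.I * β)]

/-- The roots of `P₄`. -/
def roots₄ (β γ : ℂ) : Fin 4 → ℂ :=
  ![Complex.I * β, -(Complex.I * β), Complex.I * γ, -(Complex.I * γ)]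

theorem abs_re_roots₃_lt {β : ℂ} {b : ℝ} (hβ : β ^ 2 = b) (hb : -(1 / 4) < b) (j : Fin 3) :
    |(roots₃ β j).re| < 1 / 2 := by
  have h := abs_re_I_mul_lt hβ hb
  have h' : |(-(Complex.I * β)).re| < 1 / 2 := by rwa [Complex.neg_re, abs_neg]
  fin_cases j
  · simp [roots₃]
  · exact h
  · exact h'

theorem abs_re_roots₄_lt {β γ : ℂ} {b c : ℝ} (hβ : β ^ 2 = b) (hγ : γ ^ 2 = c)
    (hb : -(1 / 4) < b) (hc : -(1 / 4) < c) (j : Fin 4) : |(roots₄ β γ j).re| < 1 / 2 := by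
  have h := abs_re_I_mul_lt hβ hb
  have h' : |(-(Complex.I * β)).re| < 1 / 2 := by rwa [Complex.neg_re, abs_neg]
  have k := abs_re_I_mul_lt hγ hc
  have k' : |(-(Complex.I * γ)).re| < 1 / 2 := by rwa [Complex.neg_re, abs_neg]
  fin_cases j
  · exact h
  · exact h'
  · exact k
  · exact k'

theorem X_sub_mul_X_add {β : ℂ} {b : ℝ} (hβ : β ^ 2 = b) :
    (X - C (Complex.I * β)) * (X - C (-(Complex.I * β))) = X ^ 2 + C (b : ℂ) := by
  have : (b : ℂ) = -(Complex.I * β * (Complex.I * β)) := by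
    rw [← hβ]; linear_combination β ^ 2 * Complex.I_mul_I
  rw [this, C_neg, C_neg, C_mul (a := Complex.I * β)]
  ring

theorem P₃_eq_prod {β : ℂ} {b : ℝ} (hβ : β ^ 2 = b) : P₃ b = ∏ j, (X - C (roots₃ β j)) := by
  have := X_sub_mul_X_add hβ
  rw [Fin.prod_univ_three]
  simp only [roots₃, Matrix.cons_val_zero, Matrix.cons_val_one, Matrix.cons_val]
  rw [mul_assoc, this, P₃, C_0]
  ring

theorem P₄_eq_prod {β γ : ℂ} {b c : ℝ} (hβ : β ^ 2 = b) (hγ : γ ^ 2 = c) :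
    P₄ b c = ∏ j, (X - C (roots₄ β γ j)) := by
  rw [Fin.prod_univ_four]
  simp only [roots₄, Matrix.cons_val_zero, Matrix.cons_val_one, Matrix.cons_val]
  rw [mul_assoc, X_sub_mul_X_add hβ, X_sub_mul_X_add hγ, P₄]

theorem w₃_eq (β : ℂ) : w₃ β = cosWeight (roots₃ β) := by
  ext x
  rw [cosWeight, Fin.prod_univ_three, w₃]
  simp only [roots₃, Matrix.cons_val_zero, Matrix.cons_val_one, Matrix.cons_val, sub_zero,
    sub_neg_eq_add, one_div, mul_inv]

theorem w₄_eq (β γ : ℂ) : w₄ β γ = cosWeight (roots₄ β γ) := by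
  ext x
  rw [cosWeight, Fin.prod_univ_four, w₄]
  simp only [roots₄, Matrix.cons_val_zero, Matrix.cons_val_one, Matrix.cons_val,
    sub_neg_eq_add, one_div, mul_inv]

theorem cos_pair_neg (β x : ℂ) : Complex.cos (Real.pi * (-x - Complex.I * β)) *
    Complex.cos (Real.pi * (-x + Complex.I * β)) =
    Complex.cos (Real.pi * (x - Complex.I * β)) *
      Complex.cos (Real.pi * (x + Complex.I * β)) := by
  rw [← Complex.cos_neg (Real.pi * (-x - Complex.I * β)),
    ← Complex.cos_neg (Real.pi * (-x + Complex.I * β)), mul_comm]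
  ring_nf

theorem w₃_neg (β x : ℂ) : w₃ β (-x) = w₃ β x := by
  rw [w₃, w₃, mul_assoc, mul_assoc, cos_pair_neg, mul_neg, Complex.cos_neg]

theorem w₄_neg (β γ x : ℂ) : w₄ β γ (-x) = w₄ β γ x := by
  rw [w₄, w₄, mul_assoc (_ * _), cos_pair_neg, cos_pair_neg, ← mul_assoc]

open ComplexOrder in
theorem cosWeight_roots₃_pos {β : ℂ} {b : ℝ} (hβ : β ^ 2 = b) (hb : -(1 / 4) < b) (y : ℝ) :
    0 < cosWeight (roots₃ β) (Complex.I * y) := by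
  rw [← w₃_eq, w₃, one_div, mul_inv, mul_inv, mul_assoc]
  exact mul_pos (inv_cos_I_mul_pos y) (inv_cos_pair_pos hβ hb y)

open ComplexOrder in
theorem cosWeight_roots₄_pos {β γ : ℂ} {b c : ℝ} (hβ : β ^ 2 = b) (hγ : γ ^ 2 = c)
    (hb : -(1 / 4) < b) (hc : -(1 / 4) < c) (y : ℝ) :
    0 < cosWeight (roots₄ β γ) (Complex.I * y) := by
  rw [← w₄_eq, w₄, one_div, mul_inv, mul_inv, mul_inv, mul_assoc (_ * _)]
  exact mul_pos (inv_cos_pair_pos hβ hb y) (inv_cos_pair_pos hγ hc y)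

open ComplexOrder in
theorem sinWeight_roots₃_pos {β : ℂ} {b : ℝ} (hβ : β ^ 2 = b) (hb : -(1 / 4) < b) (y : ℝ) :
    0 < sinWeight (roots₃ β) (Complex.I * y) := by
  rw [sinWeight, Fin.prod_univ_three, mul_assoc]
  simp only [roots₃, Matrix.cons_val_zero, Matrix.cons_val_one, Matrix.cons_val, sub_zero,
    sub_neg_eq_add]
  exact mul_pos (sdivSin_I_mul_pos y) (sdivSin_pair_pos hβ hb y)

open ComplexOrder in
theorem sinWeight_roots₄_pos {β γ : ℂ} {b c : ℝ} (hβ : β ^ 2 = b) (hγ : γ ^ 2 = c)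
    (hb : -(1 / 4) < b) (hc : -(1 / 4) < c) (y : ℝ) :
    0 < sinWeight (roots₄ β γ) (Complex.I * y) := by
  rw [sinWeight, Fin.prod_univ_four, mul_assoc (_ * _)]
  simp only [roots₄, Matrix.cons_val_zero, Matrix.cons_val_one, Matrix.cons_val,
    sub_neg_eq_add]
  exact mul_pos (sdivSin_pair_pos hβ hb y) (sdivSin_pair_pos hγ hc y)

theorem P₃_monic (b : ℝ) : (P₃ b).Monic := by rw [P₃]; monicity!

theorem P₃_natDegree (b : ℝ) : (P₃ b).natDegree = 3 := by rw [P₃]; compute_degree!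

theorem P₄_monic (b c : ℝ) : (P₄ b c).Monic := by
  rw [P₄]
  exact (monic_X_pow_add_C _ two_ne_zero).mul (monic_X_pow_add_C _ two_ne_zero)

theorem P₄_natDegree (b c : ℝ) : (P₄ b c).natDegree = 4 := by
  rw [P₄, (monic_X_pow_add_C _ two_ne_zero).natDegree_mul (monic_X_pow_add_C _ two_ne_zero),
    natDegree_X_pow_add_C, natDegree_X_pow_add_C]

/-! ### Invariant traces are determined by their parameter -/

theorem eq_of_parameter_eq {n : ℕ} {P : ℂ[X]} {hPe : P.comp (-X) = C ((-1) ^ n) * P}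
    (hdet : ∀ τ : ℂ[X] →ₗ[ℂ] ℂ, IsTraceFunctional P ((-1) ^ n) τ →
      (∀ i : Fin 3, τ (X ^ (i : ℕ)) = 0) → τ = 0) {T T' : Alg P →ₗ[ℂ] ℂ}
    (hT : IsTwistedTrace (gt P ((-1) ^ n)) T) (hT' : IsTwistedTrace (gt P ((-1) ^ n)) T')
    (hσ : IsSigmaInvariant (sigma P n hPe) T) (hσ' : IsSigmaInvariant (sigma P n hPe) T')
    (h1 : T 1 = 1) (h1' : T' 1 = 1) (h : parameter T = parameter T') : T = T' := by
  -- Since σ(z) = -z, of the three free values only those at 1 and z² remain.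
  have hodd : ∀ S : Alg P →ₗ[ℂ] ℂ, IsSigmaInvariant (sigma P n hPe) S → S (z P) = 0 := by
    intro S hS
    have := hS (z P)
    rw [sigma_z, MulOpposite.unop_op, map_neg] at this
    exact self_eq_neg.mp this.symm
  have h2 : T (z P ^ 2) = T' (z P ^ 2) := by
    simpa [parameter, h1, h1'] using h
  refine hT.ext hT' fun R => ?_
  have e1 := hT.isTraceFunctional
  have e2 := hT'.isTraceFunctional
  have := hdet (T.comp (aeval (z P)).toLinearMap - T'.comp (aeval (z P)).toLinearMap)
    (fun r => by
      rw [LinearMap.sub_apply, LinearMap.sub_apply, e1, e2, mul_sub]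
      simp) (fun i => by
      fin_cases i
      · simp [h1, h1']
      · simp [hodd T hσ, hodd T' hσ']
      · simp [h2])
  exact LinearMap.congr_fun (sub_eq_zero.mp this) R

end

/-! ### The parameter for distinct roots -/

section
/-! ### The trace condition for entire functions -/

theorem exists_differentiable_div {f : ℂ → ℂ} (hf : Differentiable ℂ f) (S : Finset ℂ)
    (h0 : ∀ a ∈ S, f a = 0) :
    ∃ g : ℂ → ℂ, Differentiable ℂ g ∧ ∀ s, f s = g s * ∏ a ∈ S, (s - a) := by
  induction S using Finset.induction_on with
  | empty => exact ⟨f, hf, by simp⟩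
  | insert a S ha ih =>
    obtain ⟨g, hg, hfg⟩ := ih fun b hb => h0 b (Finset.mem_insert_of_mem hb)
    have hga : g a = 0 := by
      have := h0 a (Finset.mem_insert_self a S)
      rw [hfg, mul_eq_zero, Finset.prod_eq_zero_iff] at this
      refine this.resolve_right ?_
      rintro ⟨b, hb, hab⟩
      rw [sub_eq_zero.mp hab] at ha
      exact ha hb
    refine ⟨dslope g a, ?_, fun s => ?_⟩
    · rw [← differentiableOn_univ] at hg ⊢
      exact (Complex.differentiableOn_dslope univ_mem).mpr hg
    · have := sub_smul_dslope g a s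
      rw [smul_eq_mul, hga, sub_zero] at this
      rw [hfg, Finset.prod_insert ha, ← this]
      ring

/-- As the roots are distinct, f is an entire function g times ∏ (s - c_j), and the two contour
shifts used for traces apply to g. This extends the trace condition from multiples of P to entire
functions. -/
theorem integral_symm_mul_cosWeight {n : ℕ} {c : Fin n → ℂ} (hc : ∀ j, |(c j).re| < 1 / 2)
    (hinj : Function.Injective c) {f : ℂ → ℂ} (hf : Differentiable ℂ f) (h0 : ∀ j, f (c j) = 0)
    {r : ℝ} (hr : r < n * Real.pi) (hb : ExpBdd r f) :
    ∫ y : ℝ, (f (Complex.I * y + 1 / 2) - (-1) ^ n * f (Complex.I * y - 1 / 2)) *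
      cosWeight c (Complex.I * y) = 0 := by
  obtain ⟨g, hg, hfg⟩ := exists_differentiable_div hf (Finset.univ.image c) (by simpa using h0)
  simp only [Finset.prod_image hinj.injOn] at hfg
  have hb' : ExpBdd r fun s => g s * ∏ j, (s - c j) := by
    rwa [← show f = fun s => g s * ∏ j, (s - c j) from funext hfg]
  have h1 := integral_add_half_mul_cosWeight hc hg hr hb'
  have h2 := integral_sub_half_mul_cosWeight hc hg hr hb'
  have hn : ((-1 : ℂ) ^ n) * (-1) ^ n = 1 := by rw [← mul_pow]; norm_num
  have i1 := (shift_sinWeight hc hg hr hb' (a := 1 / 2) (by norm_num [abs_div])).1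
  have i2 := (shift_sinWeight hc hg hr hb' (a := -(1 / 2)) (by norm_num [abs_div])).1
  push_cast at i1 i2
  simp only [← sub_eq_add_neg, sinWeight_add_half hc, sinWeight_sub_half hc, ← mul_assoc] at i1 i2
  have e : ∀ y : ℝ, (f (Complex.I * y + 1 / 2) - (-1) ^ n * f (Complex.I * y - 1 / 2)) *
      cosWeight c (Complex.I * y) =
      g (Complex.I * y + 1 / 2) * (∏ j, (Complex.I * y + 1 / 2 - c j)) *
        cosWeight c (Complex.I * y) -
      g (Complex.I * y - 1 / 2) * (-1) ^ n * (∏ j, (Complex.I * y - 1 / 2 - c j)) *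
        cosWeight c (Complex.I * y) := by
    intro y
    rw [hfg, hfg]
    ring
  simp only [e]
  rw [integral_sub i1 i2, h1, sub_eq_zero]
  have e2 : ∀ y : ℝ, g (Complex.I * y - 1 / 2) * (-1) ^ n * (∏ j, (Complex.I * y - 1 / 2 - c j)) *
        cosWeight c (Complex.I * y) = (-1) ^ n * (g (Complex.I * y - 1 / 2) *
          (∏ j, (Complex.I * y - 1 / 2 - c j)) * cosWeight c (Complex.I * y)) := fun y => by ring
  simp only [e2]
  rw [integral_const_mul, h2, ← mul_assoc, hn, one_mul]

/-- The ratio `-∫ x² w(x) |dx| / ∫ w(x) |dx|` over the imaginary axis. -/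
def momentRatio (w : ℂ → ℂ) : ℂ :=
  -((∫ y : ℝ, (Complex.I * y) ^ 2 * w (Complex.I * y)) / ∫ y : ℝ, w (Complex.I * y))

theorem parameter_eq_momentRatio {P : ℂ[X]} {T : Alg P →ₗ[ℂ] ℂ} {w : ℂ → ℂ}
    (h : HasWeight T w) : parameter T = momentRatio w := by
  have h1 := (h 1).2
  have h2 := (h (X ^ 2)).2
  simp only [map_one, eval_one, one_mul, map_pow, aeval_X, eval_pow, eval_X] at h1 h2
  rw [parameter, momentRatio, h1, h2]

theorem integral_quadratic_mul {P : ℂ[X]} {T : Alg P →ₗ[ℂ] ℂ} {w : ℂ → ℂ} (h : HasWeight T w)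
    (a d : ℂ) : ∫ y : ℝ, (a * (Complex.I * y) ^ 2 + d) * w (Complex.I * y) =
      a * T (z P ^ 2) + d * T 1 := by
  have h1 := (h (C a * X ^ 2 + C d)).2
  simp only [eval_add, eval_mul, eval_C, eval_pow, eval_X] at h1
  rw [← h1]
  simp [Algebra.algebraMap_eq_smul_one]

theorem parameter_eq_of_mul_add_eq_zero {P : ℂ[X]} {T : Alg P →ₗ[ℂ] ℂ} {a d : ℂ}
    (hT : T 1 ≠ 0) (ha : a ≠ 0) (h : a * T (z P ^ 2) + d * T 1 = 0) : parameter T = d / a := by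
  rw [parameter, ← neg_div, div_eq_div_iff hT ha]
  linear_combination -h

theorem expBdd_trigonometric (a : ℝ) :
    ExpBdd |a| (fun s => Complex.cos (a * s)) ∧ ExpBdd |a| (fun s => Complex.sin (a * s)) := by
  constructor <;> refine ⟨1, fun s _ => ?_⟩ <;> rw [one_mul, ← abs_mul, ← Complex.im_ofReal_mul]
  · exact norm_cos_le _
  · exact norm_sin_le _

theorem cos_pi_I_mul_ne_one {β : ℂ} {b : ℝ} (hβ : β ^ 2 = b) (hb : -(1 / 4) < b) (h0 : β ≠ 0) :
    Complex.cos (Real.pi * (Complex.I * β)) ≠ 1 := by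
  have hlt := abs_re_I_mul_lt hβ hb
  intro h
  obtain ⟨k, hk⟩ := Complex.cos_eq_one_iff.mp h
  have hpi : (Real.pi : ℂ) ≠ 0 := by exact_mod_cast Real.pi_ne_zero
  have h2 : Complex.I * β = 2 * k := mul_left_cancel₀ hpi (by rw [← hk]; ring)
  rw [h2] at hlt
  have h3 : ((2 * k : ℂ)).re = ((2 * k : ℤ) : ℝ) := by simp
  rw [h3, ← Int.cast_abs] at hlt
  have h4 : |2 * k| < 1 := by
    by_contra! h
    have : (1 : ℝ) ≤ (|2 * k| : ℤ) := by exact_mod_cast h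
    linarith
  have h5 : k = 0 := by rw [Int.abs_lt_one_iff] at h4; omega
  rw [h5, Int.cast_zero, mul_zero] at h2
  exact h0 ((mul_eq_zero.mp h2).resolve_left Complex.I_ne_zero)

theorem injective_of_pair {β : ℂ} (h : β ≠ 0) : Complex.I * β ≠ -(Complex.I * β) := fun e =>
  h ((mul_eq_zero.mp (self_eq_neg.mp e)).resolve_left Complex.I_ne_zero)

theorem injective_roots₃ {β : ℂ} (h : β ≠ 0) : Function.Injective (roots₃ β) := by
  have h1 := injective_of_pair h
  have h2 : Complex.I * β ≠ 0 := mul_ne_zero Complex.I_ne_zero h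
  have h3 : -(Complex.I * β) ≠ 0 := neg_ne_zero.mpr h2
  intro i j hij
  fin_cases i <;> fin_cases j <;> simp_all [roots₃]

theorem injective_roots₄ {β γ : ℂ} (hβ : β ≠ 0) (hγ : γ ≠ 0) (h : β ^ 2 ≠ γ ^ 2) :
    Function.Injective (roots₄ β γ) := by
  have h1 := injective_of_pair hβ
  have h2 := injective_of_pair hγ
  have h3 : Complex.I * β ≠ Complex.I * γ := fun e =>
    h (by rw [mul_left_cancel₀ Complex.I_ne_zero e])
  have h4 : Complex.I * β ≠ -(Complex.I * γ) := fun e => by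
    rw [← mul_neg] at e
    exact h (by rw [mul_left_cancel₀ Complex.I_ne_zero e, neg_sq])
  have h5 : -(Complex.I * β) ≠ Complex.I * γ := fun e => h4 (by rw [← e, neg_neg])
  have h6 : -(Complex.I * β) ≠ -(Complex.I * γ) := fun e => h3 (neg_injective e)
  intro i j hij
  fin_cases i <;> fin_cases j <;>
    first
    | rfl
    | exact absurd hij h1
    | exact absurd hij.symm h1
    | exact absurd hij h2
    | exact absurd hij.symm h2
    | exact absurd hij h3
    | exact absurd hij.symm h3
    | exact absurd hij h4
    | exact absurd hij.symm h4
    | exact absurd hij h5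
    | exact absurd hij.symm h5
    | exact absurd hij h6
    | exact absurd hij.symm h6

theorem parameter_three {β : ℂ} {b : ℝ} (hβ : β ^ 2 = b) (hb : -(1 / 4) < b) (h0 : β ≠ 0)
    {P : ℂ[X]} {T : Alg P →ₗ[ℂ] ℂ} (hT : HasWeight T (w₃ β)) (hT1 : T 1 ≠ 0) :
    parameter T = 1 / 4 + β ^ 2 / (1 - Complex.cos (Real.pi * (Complex.I * β))) := by
  have hcos : 1 - Complex.cos (Real.pi * (Complex.I * β)) ≠ 0 :=
    sub_ne_zero.mpr (cos_pi_I_mul_ne_one hβ hb h0).symm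
  set a₀ := β ^ 2 / (1 - Complex.cos (Real.pi * (Complex.I * β))) with ha
  have hII : (Complex.I * β) ^ 2 = -β ^ 2 := by rw [mul_pow, Complex.I_sq]; ring
  have ha' : a₀ * (1 - Complex.cos (Real.pi * (Complex.I * β))) = β ^ 2 := div_mul_cancel₀ _ hcos
  -- f = s² + a₀(1 - cos πs) vanishes at 0, and a₀ is fixed by f(±iβ) = 0. In f(x+1/2) + f(x-1/2)
  -- the cosines cancel, leaving 2x² + 1/2 + 2a₀.
  have key := integral_symm_mul_cosWeight (abs_re_roots₃_lt hβ hb) (injective_roots₃ h0)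
    (f := fun s => (C a₀ + X ^ 2 : ℂ[X]).eval s + -a₀ * Complex.cos (Real.pi * s))
    (by fun_prop)
    (fun j => by
      simp only [eval_add, eval_C, eval_pow, eval_X]
      fin_cases j
      · simp [roots₃]
      · change a₀ + (Complex.I * β) ^ 2 + -a₀ * Complex.cos (Real.pi * (Complex.I * β)) = 0
        rw [hII]
        linear_combination ha'
      · change a₀ + (-(Complex.I * β)) ^ 2 + -a₀ * Complex.cos (Real.pi * -(Complex.I * β)) = 0
        rw [neg_sq, hII, mul_neg, Complex.cos_neg]
        linear_combination ha')
    (r := Real.pi) (by push_cast; linarith [Real.pi_pos]) (by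
      refine (expBdd_eval _ Real.pi_pos).add ?_
      have := (expBdd_const (-a₀)).mul (expBdd_trigonometric Real.pi).1
      rwa [zero_add, abs_of_pos Real.pi_pos] at this)
  rw [← w₃_eq] at key
  have h2 := integral_quadratic_mul hT 2 (2 * a₀ + 1 / 2)
  have e : ∀ y : ℝ, (2 * (Complex.I * y) ^ 2 + (2 * a₀ + 1 / 2)) * w₃ β (Complex.I * y) =
      ((C a₀ + X ^ 2 : ℂ[X]).eval (Complex.I * y + 1 / 2) +
        -a₀ * Complex.cos (Real.pi * (Complex.I * y + 1 / 2)) -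
        (-1) ^ 3 * ((C a₀ + X ^ 2 : ℂ[X]).eval (Complex.I * y - 1 / 2) +
        -a₀ * Complex.cos (Real.pi * (Complex.I * y - 1 / 2)))) * w₃ β (Complex.I * y) := by
    intro y
    have c1 : Complex.cos (Real.pi * (Complex.I * y + 1 / 2)) =
        -Complex.sin (Real.pi * (Complex.I * y)) := by
      rw [mul_add, mul_one_div, Complex.cos_add_pi_div_two]
    have c2 : Complex.cos (Real.pi * (Complex.I * y - 1 / 2)) =
        Complex.sin (Real.pi * (Complex.I * y)) := by
      rw [mul_sub, mul_one_div, Complex.cos_sub_pi_div_two]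
    rw [c1, c2]
    simp only [eval_add, eval_C, eval_pow, eval_X]
    ring
  simp only [e] at h2
  rw [key] at h2
  rw [parameter_eq_of_mul_add_eq_zero hT1 two_ne_zero h2.symm]
  ring

/-- Here f = a₃s³ + a₁s + a₀ sin 2πs, and e₁, e₂ say that it vanishes at ±iβ, ±iγ. The sine has
period 1 and drops out of f(x+1/2) - f(x-1/2) = 3a₃x² + a₃/4 + a₁. -/
theorem integral_symm_four {β γ : ℂ} {b c : ℝ} (hβ : β ^ 2 = b) (hγ : γ ^ 2 = c)
    (hb : -(1 / 4) < b) (hc : -(1 / 4) < c) (h0 : β ≠ 0) (h0' : γ ≠ 0) (h : β ^ 2 ≠ γ ^ 2)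
    {P : ℂ[X]} {T : Alg P →ₗ[ℂ] ℂ} (hT : HasWeight T (w₄ β γ)) {a₃ a₁ a₀ : ℂ}
    (e₁ : -a₃ * β ^ 3 + a₁ * β + a₀ * Complex.sinh (2 * Real.pi * β) = 0)
    (e₂ : -a₃ * γ ^ 3 + a₁ * γ + a₀ * Complex.sinh (2 * Real.pi * γ) = 0) :
    3 * a₃ * T (z P ^ 2) + (a₃ / 4 + a₁) * T 1 = 0 := by
  have hpi := Real.pi_pos
  have hsin : ∀ x : ℂ, Complex.sin ((2 * Real.pi : ℝ) * (Complex.I * x)) =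
      Complex.I * Complex.sinh (2 * Real.pi * x) := by
    intro x
    rw [mul_comm Complex.I (Complex.sinh _), ← Complex.sin_mul_I]
    push_cast
    ring_nf
  have hI3 : ∀ x : ℂ, (Complex.I * x) ^ 3 = -Complex.I * x ^ 3 := by
    intro x
    rw [mul_pow, Complex.I_pow_three]
  have key := integral_symm_mul_cosWeight (abs_re_roots₄_lt hβ hγ hb hc)
    (injective_roots₄ h0 h0' h)
    (f := fun s => (C a₃ * X ^ 3 + C a₁ * X : ℂ[X]).eval s +
      a₀ * Complex.sin ((2 * Real.pi : ℝ) * s)) (by fun_prop)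
    (fun j => by
      simp only [eval_add, eval_C, eval_pow, eval_X, eval_mul]
      fin_cases j
      · change a₃ * (Complex.I * β) ^ 3 + a₁ * (Complex.I * β) +
          a₀ * Complex.sin ((2 * Real.pi : ℝ) * (Complex.I * β)) = 0
        rw [hI3, hsin]
        linear_combination Complex.I * e₁
      · change a₃ * (-(Complex.I * β)) ^ 3 + a₁ * -(Complex.I * β) +
          a₀ * Complex.sin ((2 * Real.pi : ℝ) * -(Complex.I * β)) = 0
        rw [Odd.neg_pow (by decide), mul_neg ((2 * Real.pi : ℝ) : ℂ), Complex.sin_neg, hI3, hsin]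
        linear_combination -Complex.I * e₁
      · change a₃ * (Complex.I * γ) ^ 3 + a₁ * (Complex.I * γ) +
          a₀ * Complex.sin ((2 * Real.pi : ℝ) * (Complex.I * γ)) = 0
        rw [hI3, hsin]
        linear_combination Complex.I * e₂
      · change a₃ * (-(Complex.I * γ)) ^ 3 + a₁ * -(Complex.I * γ) +
          a₀ * Complex.sin ((2 * Real.pi : ℝ) * -(Complex.I * γ)) = 0
        rw [Odd.neg_pow (by decide), mul_neg ((2 * Real.pi : ℝ) : ℂ), Complex.sin_neg, hI3, hsin]
        linear_combination -Complex.I * e₂)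
    (r := 2 * Real.pi) (by push_cast; linarith) (by
      refine (expBdd_eval _ (by positivity)).add ?_
      have := (expBdd_const a₀).mul (expBdd_trigonometric (2 * Real.pi)).2
      rwa [zero_add, abs_of_pos (by positivity)] at this)
  rw [← w₄_eq] at key
  have h2 := integral_quadratic_mul hT (3 * a₃) (a₃ / 4 + a₁)
  have e : ∀ y : ℝ, (3 * a₃ * (Complex.I * y) ^ 2 + (a₃ / 4 + a₁)) * w₄ β γ (Complex.I * y) =
      ((C a₃ * X ^ 3 + C a₁ * X : ℂ[X]).eval (Complex.I * y + 1 / 2) +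
        a₀ * Complex.sin ((2 * Real.pi : ℝ) * (Complex.I * y + 1 / 2)) -
        (-1) ^ 4 * ((C a₃ * X ^ 3 + C a₁ * X : ℂ[X]).eval (Complex.I * y - 1 / 2) +
        a₀ * Complex.sin ((2 * Real.pi : ℝ) * (Complex.I * y - 1 / 2)))) *
        w₄ β γ (Complex.I * y) := by
    intro y
    have c1 : Complex.sin ((2 * Real.pi : ℝ) * (Complex.I * y + 1 / 2)) =
        Complex.sin ((2 * Real.pi : ℝ) * (Complex.I * y - 1 / 2)) := by
      rw [← Complex.sin_add_two_pi ((2 * Real.pi : ℝ) * (Complex.I * y - 1 / 2))]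
      push_cast
      ring_nf
    rw [c1]
    simp only [eval_add, eval_C, eval_pow, eval_X, eval_mul]
    ring
  simp only [e] at h2
  rw [key] at h2
  exact h2.symm

theorem sinh_two_pi_mul_ne_zero {β : ℂ} {b : ℝ} (hβ : β ^ 2 = b) (hb : -(1 / 4) < b)
    (h0 : β ≠ 0) : Complex.sinh (2 * Real.pi * β) ≠ 0 := by
  have hlt := abs_re_I_mul_lt hβ hb
  have h2 := sin_pi_mul_ne_zero (s := 2 * (Complex.I * β)) (by
    rw [show ((2 : ℂ) * (Complex.I * β)).re = 2 * (Complex.I * β).re by simp, abs_mul, abs_two]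
    linarith) (mul_ne_zero two_ne_zero (mul_ne_zero Complex.I_ne_zero h0))
  intro h
  apply h2
  rw [show (Real.pi : ℂ) * (2 * (Complex.I * β)) = 2 * Real.pi * β * Complex.I by ring,
    Complex.sin_mul_I, h, zero_mul]

theorem parameter_four {β γ : ℂ} {b c : ℝ} (hβ : β ^ 2 = b) (hγ : γ ^ 2 = c)
    (hb : -(1 / 4) < b) (hc : -(1 / 4) < c) (h0 : β ≠ 0) (h0' : γ ≠ 0) (h : β ^ 2 ≠ γ ^ 2)
    {P : ℂ[X]} {T : Alg P →ₗ[ℂ] ℂ} (hT : HasWeight T (w₄ β γ)) (hT1 : T 1 ≠ 0) :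
    parameter T = α₄ β γ := by
  have key := fun a₃ a₁ a₀ => integral_symm_four hβ hγ hb hc h0 h0' h hT (a₃ := a₃) (a₁ := a₁)
    (a₀ := a₀)
  set D := β * Complex.sinh (2 * Real.pi * γ) - γ * Complex.sinh (2 * Real.pi * β) with hD
  -- If D = 0, the conditions have a solution with a₃ = 0 and a₁ = sinh 2πβ ≠ 0, and the relation
  -- would read a₁T(1) = 0.
  have hD0 : D ≠ 0 := by
    intro hD0
    have := key 0 (Complex.sinh (2 * Real.pi * β)) (-β) (by ring)
      (by rw [hD] at hD0; linear_combination -hD0)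
    rw [mul_zero, zero_mul, zero_add, zero_div, zero_add] at this
    exact (mul_ne_zero (sinh_two_pi_mul_ne_zero hβ hb h0) hT1) this
  -- The solution of the two vanishing conditions by Cramer's rule; the parameter is 1/12 +
  -- a₁/(3a₃).
  have := key D (β ^ 3 * Complex.sinh (2 * Real.pi * γ) - γ ^ 3 * Complex.sinh (2 * Real.pi * β))
    (β * γ ^ 3 - γ * β ^ 3) (by rw [hD]; ring) (by rw [hD]; ring)
  rw [parameter_eq_of_mul_add_eq_zero hT1 (mul_ne_zero three_ne_zero hD0) this, α₄, ← hD,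
    add_div, div_div, ← div_div D]
  congr 1
  field_simp
  norm_num

end

/-! ### Coinciding roots: continuity and limits -/

section
/-! ### Continuity of the parameter -/

theorem cos_pair_eq (β : ℂ) (y : ℝ) : Complex.cos (Real.pi * (Complex.I * y - Complex.I * β)) *
    Complex.cos (Real.pi * (Complex.I * y + Complex.I * β)) =
    ((Real.cosh (2 * Real.pi * y) : ℝ) + Complex.cosh (2 * Real.pi * β)) / 2 := by
  have e1 : Complex.cosh (2 * Real.pi * β) = Complex.cos (Real.pi * (Complex.I * y +
      Complex.I * β) - Real.pi * (Complex.I * y - Complex.I * β)) := by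
    rw [← Complex.cos_mul_I]; ring_nf
  have e2 : ((Real.cosh (2 * Real.pi * y) : ℝ) : ℂ) = Complex.cos (Real.pi * (Complex.I * y +
      Complex.I * β) + Real.pi * (Complex.I * y - Complex.I * β)) := by
    rw [Complex.ofReal_cosh, ← Complex.cos_mul_I]; push_cast; ring_nf
  rw [e1, e2, Complex.cos_sub, Complex.cos_add]
  ring

-- At y = 0 the product of the two cosines is (1 + cosh 2πβ)/2, which is positive.
open ComplexOrder in
theorem neg_one_lt_re_cosh {β : ℂ} {b : ℝ} (hβ : β ^ 2 = b) (hb : -(1 / 4) < b) :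
    -1 < (Complex.cosh (2 * Real.pi * β)).re := by
  have h := inv_cos_pair_pos hβ hb 0
  rw [← mul_inv, cos_pair_eq] at h
  set w := ((Real.cosh (2 * Real.pi * 0) : ℝ) + Complex.cosh (2 * Real.pi * β)) / 2 with hw
  have h2 : 0 < w.re := by
    have := (Complex.pos_iff.mp h).1
    rw [Complex.inv_re] at this
    by_contra! h'
    exact absurd this (not_lt.mpr (div_nonpos_of_nonpos_of_nonneg h' (Complex.normSq_nonneg _)))
  rw [hw, Complex.div_ofNat_re, Complex.add_re, Complex.ofReal_re, mul_zero, Real.cosh_zero] at h2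
  linarith

theorem exists_norm_inv_cos_pair_le {β₀ : ℂ} {b : ℝ} (hβ : β₀ ^ 2 = b) (hb : -(1 / 4) < b) :
    ∃ K : ℝ, 0 ≤ K ∧ ∀ᶠ β in 𝓝 β₀, ∀ y : ℝ,
      ‖(Complex.cos (Real.pi * (Complex.I * y - Complex.I * β)))⁻¹ *
        (Complex.cos (Real.pi * (Complex.I * y + Complex.I * β)))⁻¹‖ ≤
        K * (Real.cosh (2 * Real.pi * y))⁻¹ := by
  -- With δ < 1 and Re cosh 2πβ > δ - 1 near β₀, the bound cosh 2πy ≥ 1 gives cosh 2πy + Re cosh 2πβ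
  -- ≥ δ cosh 2πy, uniformly in β.
  obtain ⟨δ, hδ, hδ1⟩ := exists_between (lt_min (neg_lt_iff_pos_add'.mp (neg_one_lt_re_cosh hβ hb))
    one_pos)
  have hcont : ContinuousAt (fun β : ℂ => (Complex.cosh (2 * Real.pi * β)).re) β₀ := by
    have : Continuous fun β : ℂ => (Complex.cosh (2 * Real.pi * β)).re := by fun_prop
    exact this.continuousAt
  have hev := hcont.eventually_const_lt
    (show δ - 1 < (Complex.cosh (2 * Real.pi * β₀)).re by linarith [hδ1.trans_le (min_le_left _ _)])
  refine ⟨2 / δ, by positivity, ?_⟩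
  filter_upwards [hev] with β hre y
  have hδ' : δ < 1 := hδ1.trans_le (min_le_right _ _)
  have h1 := Real.one_le_cosh (2 * Real.pi * y)
  have h2 : δ * Real.cosh (2 * Real.pi * y) / 2 ≤
      ‖((Real.cosh (2 * Real.pi * y) : ℝ) + Complex.cosh (2 * Real.pi * β)) / 2‖ := by
    refine le_trans ?_ (Complex.re_le_norm _)
    rw [Complex.div_ofNat_re, Complex.add_re, Complex.ofReal_re]
    nlinarith
  rw [← mul_inv, cos_pair_eq, norm_inv]
  refine (inv_anti₀ (by positivity) h2).trans_eq ?_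
  rw [inv_div, div_mul_eq_mul_div, mul_comm δ, ← div_div, div_eq_mul_inv 2 (Real.cosh _)]

theorem integrable_sq_mul_inv_cosh (k : ℕ) (K : ℝ) :
    Integrable fun y : ℝ => K * (|y| ^ k * (Real.cosh (Real.pi * y))⁻¹) := by
  have h := integrable_mul_cosWeight (n := 1) (c := fun _ => 0) (by simp)
    (f := fun s => (X ^ k : ℂ[X]).eval s) (Polynomial.continuous _) (r := Real.pi / 2)
    (by push_cast; linarith [Real.pi_pos]) (expBdd_eval _ (by positivity))
  refine (h.norm.const_mul K).congr (Eventually.of_forall fun y => ?_)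
  have e : Complex.cos (Real.pi * (Complex.I * y)) = (Real.cosh (Real.pi * y) : ℝ) := by
    rw [Complex.ofReal_cosh, ← Complex.cos_mul_I]; push_cast; ring_nf
  simp only [cosWeight, Finset.univ_unique, Finset.prod_singleton, sub_zero, e, eval_pow, eval_X,
    norm_mul, norm_pow, Complex.norm_I, one_mul, norm_inv, Complex.norm_real, Real.norm_eq_abs,
    abs_of_pos (Real.cosh_pos _)]

theorem continuousAt_integral_of_le {E : Type*} [TopologicalSpace E] [FirstCountableTopology E]
    {w : E → ℂ → ℂ} {p₀ : E} {K : ℝ}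
    (hm : ∀ p, Measurable fun y : ℝ => w p (Complex.I * y))
    (hK : ∀ᶠ p in 𝓝 p₀, ∀ y : ℝ, ‖w p (Complex.I * y)‖ ≤ K * (Real.cosh (Real.pi * y))⁻¹)
    (hcont : ∀ y : ℝ, ContinuousAt (fun p => w p (Complex.I * y)) p₀) (k : ℕ) :
    ContinuousAt (fun p => ∫ y : ℝ, (Complex.I * y) ^ k * w p (Complex.I * y)) p₀ := by
  refine continuousAt_of_dominated (bound := fun y => K * (|y| ^ k * (Real.cosh (Real.pi * y))⁻¹))
    (Eventually.of_forall fun p => ?_) ?_ (integrable_sq_mul_inv_cosh k K)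
    (Eventually.of_forall fun y => (hcont y).const_mul _)
  · exact (Measurable.mul (by fun_prop) (hm p)).aestronglyMeasurable
  · filter_upwards [hK] with p hp
    refine Eventually.of_forall fun y => ?_
    rw [norm_mul, norm_pow, norm_mul, Complex.norm_I, one_mul, Complex.norm_real,
      Real.norm_eq_abs, mul_left_comm]
    exact mul_le_mul_of_nonneg_left (hp y) (by positivity)

/-- Dominated convergence for the moments of order 0 and 2. It carries the parameter formulas over
to coinciding roots, where the division by ∏ (s - c_j) in `integral_symm_mul_cosWeight` is
unavailable. -/
theorem continuousAt_momentRatio {E : Type*} [TopologicalSpace E] [FirstCountableTopology E]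
    {w : E → ℂ → ℂ} {p₀ : E} {K : ℝ}
    (hm : ∀ p, Measurable fun y : ℝ => w p (Complex.I * y))
    (hK : ∀ᶠ p in 𝓝 p₀, ∀ y : ℝ, ‖w p (Complex.I * y)‖ ≤ K * (Real.cosh (Real.pi * y))⁻¹)
    (hcont : ∀ y : ℝ, ContinuousAt (fun p => w p (Complex.I * y)) p₀)
    (h0 : ∫ y : ℝ, w p₀ (Complex.I * y) ≠ 0) : ContinuousAt (fun p => momentRatio (w p)) p₀ := by
  have h2 := continuousAt_integral_of_le hm hK hcont 2
  have h1 := continuousAt_integral_of_le hm hK hcont 0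
  simp only [pow_zero, one_mul] at h1
  exact (h2.div h1 h0).neg

theorem cosh_pi_le (y : ℝ) : (Real.cosh (2 * Real.pi * y))⁻¹ ≤ (Real.cosh (Real.pi * y))⁻¹ := by
  refine inv_anti₀ (Real.cosh_pos _) (Real.cosh_le_cosh.mpr ?_)
  rw [mul_assoc, abs_mul 2, abs_two]
  linarith [abs_nonneg (Real.pi * y)]

theorem inv_cosh_le_one (y : ℝ) : (Real.cosh y)⁻¹ ≤ 1 := inv_le_one_of_one_le₀ (Real.one_le_cosh y)

theorem continuousAt_momentRatio_w₃ {β₀ : ℂ} {b : ℝ} (hβ : β₀ ^ 2 = b) (hb : -(1 / 4) < b)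
    (h0 : ∫ y : ℝ, w₃ β₀ (Complex.I * y) ≠ 0) :
    ContinuousAt (fun β => momentRatio (w₃ β)) β₀ := by
  obtain ⟨K, hK0, hK⟩ := exists_norm_inv_cos_pair_le hβ hb
  refine continuousAt_momentRatio (K := K) (fun β => ?_) ?_ (fun y => ?_) h0
  · unfold w₃
    exact Measurable.const_div (Continuous.measurable (by fun_prop)) _
  · filter_upwards [hK] with β hβK y
    have e : Complex.cos (Real.pi * (Complex.I * y)) = (Real.cosh (Real.pi * y) : ℝ) := by
      rw [Complex.ofReal_cosh, ← Complex.cos_mul_I]; push_cast; ring_nf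
    rw [w₃, one_div, mul_inv, mul_inv, mul_assoc, norm_mul, e, norm_inv, Complex.norm_real,
      Real.norm_of_nonneg (Real.cosh_pos _).le, mul_comm]
    refine mul_le_mul_of_nonneg_right ((hβK y).trans ?_) (inv_nonneg.mpr (Real.cosh_pos _).le)
    exact mul_le_of_le_one_right hK0 (inv_cosh_le_one _)
  · unfold w₃
    refine ContinuousAt.div₀ continuousAt_const (Continuous.continuousAt (by fun_prop)) ?_
    have h := abs_re_I_mul_lt hβ hb
    refine mul_ne_zero (mul_ne_zero ?_ ?_) ?_ <;> refine cos_pi_mul_ne_zero ?_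
    · simp
    · simpa using h
    · simpa using h

theorem continuousAt_momentRatio_w₄ {p₀ : ℂ × ℂ} {b c : ℝ} (hβ : p₀.1 ^ 2 = b)
    (hγ : p₀.2 ^ 2 = c) (hb : -(1 / 4) < b) (hc : -(1 / 4) < c)
    (h0 : ∫ y : ℝ, w₄ p₀.1 p₀.2 (Complex.I * y) ≠ 0) :
    ContinuousAt (fun p : ℂ × ℂ => momentRatio (w₄ p.1 p.2)) p₀ := by
  obtain ⟨K, hK0, hK⟩ := exists_norm_inv_cos_pair_le hβ hb
  obtain ⟨K', hK0', hK'⟩ := exists_norm_inv_cos_pair_le hγ hc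
  refine continuousAt_momentRatio (w := fun p : ℂ × ℂ => w₄ p.1 p.2) (K := K * K') (fun p => ?_) ?_
    (fun y => ?_) h0
  · unfold w₄
    exact Measurable.const_div (Continuous.measurable (by fun_prop)) _
  · filter_upwards [continuousAt_fst.eventually hK, continuousAt_snd.eventually hK'] with p h1 h2 y
    rw [w₄, one_div, mul_inv, mul_inv, mul_inv, mul_assoc (_ * _), norm_mul, mul_assoc]
    refine mul_le_mul ((h1 y).trans (mul_le_of_le_one_right hK0 (inv_cosh_le_one _)))
      ((h2 y).trans ?_) (norm_nonneg _) hK0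
    exact mul_le_mul_of_nonneg_left (cosh_pi_le y) hK0'
  · unfold w₄
    refine ContinuousAt.div₀ continuousAt_const (Continuous.continuousAt (by fun_prop)) ?_
    have h := abs_re_I_mul_lt hβ hb
    have h' := abs_re_I_mul_lt hγ hc
    refine mul_ne_zero (mul_ne_zero (mul_ne_zero ?_ ?_) ?_) ?_ <;>
      refine cos_pi_mul_ne_zero ?_ <;> simp at h h' ⊢ <;> assumption

/-! ### Limits of the formulas -/

theorem tendsto_sq_div_one_sub_cos :
    Tendsto (fun x : ℂ => x ^ 2 / (1 - Complex.cos x)) (𝓝[≠] 0) (𝓝 2) := by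
  have h1 : Tendsto (fun x : ℂ => Complex.sin x / x) (𝓝[≠] 0) (𝓝 1) := by
    have := (Complex.hasDerivAt_sin 0).tendsto_slope_zero
    simpa [div_eq_inv_mul] using this
  have h2 : Tendsto (fun x : ℂ => x / 2) (𝓝[≠] 0) (𝓝[≠] 0) := by
    refine tendsto_nhdsWithin_iff.mpr ⟨?_, ?_⟩
    · have : Tendsto (fun x : ℂ => x / 2) (𝓝 0) (𝓝 (0 / 2)) :=
        Continuous.tendsto (by fun_prop) 0
      rw [zero_div] at this
      exact this.mono_left nhdsWithin_le_nhds
    · filter_upwards [self_mem_nhdsWithin] with x hx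
      exact div_ne_zero hx two_ne_zero
  have h3 := (((h1.comp h2).pow 2).inv₀ (by norm_num)).const_mul 2
  rw [one_pow, inv_one, mul_one] at h3
  refine h3.congr fun x => ?_
  have h4 : 1 - Complex.cos x = 2 * Complex.sin (x / 2) ^ 2 := by
    have := Complex.cos_sq_add_sin_sq (x / 2)
    have h5 : Complex.cos x = 2 * Complex.cos (x / 2) ^ 2 - 1 := by
      rw [← Complex.cos_two_mul]; ring_nf
    rw [h5]
    linear_combination -2 * this
  rw [h4, Function.comp_apply, div_pow, inv_div, div_pow]
  ring

theorem tendsto_div_one_sub_cos_pi {ι : Type*} {F : Filter ι} {r : ι → ℂ}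
    (hr : Tendsto r F (𝓝 0)) (hr0 : ∀ᶠ i in F, r i ≠ 0) :
    Tendsto (fun i => r i ^ 2 / (1 - Complex.cos (Real.pi * r i))) F
      (𝓝 (2 / (Real.pi : ℂ) ^ 2)) := by
  have hpi : (Real.pi : ℂ) ≠ 0 := by exact_mod_cast Real.pi_ne_zero
  have h1 : Tendsto (fun i => (Real.pi : ℂ) * r i) F (𝓝[≠] 0) := by
    refine tendsto_nhdsWithin_iff.mpr ⟨by simpa using hr.const_mul (Real.pi : ℂ), ?_⟩
    filter_upwards [hr0] with i hi using mul_ne_zero hpi hi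
  refine ((tendsto_sq_div_one_sub_cos.comp h1).div_const ((Real.pi : ℂ) ^ 2)).congr fun i => ?_
  rw [Function.comp_apply, mul_pow, mul_div_assoc, mul_div_cancel_left₀ _ (pow_ne_zero 2 hpi)]

theorem cpow_half_sq (x : ℂ) : (x ^ (1 / 2 : ℂ)) ^ 2 = x := by
  rw [one_div]
  exact Complex.cpow_ofNat_inv_pow x 2

theorem tendsto_α₃ :
    Tendsto α₃ (𝓝[≠] (-(1 / 4))) (𝓝 (1 / 4 - 2 / (Real.pi : ℂ) ^ 2)) := by
  let r : ℝ → ℂ := fun κ => ((κ : ℂ) + 1 / 4) ^ (1 / 2 : ℂ)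
  have hsq : ∀ κ, r κ ^ 2 = (κ : ℂ) + 1 / 4 := fun κ => cpow_half_sq _
  have hr : Tendsto r (𝓝[≠] (-(1 / 4))) (𝓝 0) := by
    -- Convergence of the root is read off from its modulus, so the branch cut plays no role.
    have h1 : Tendsto (fun κ : ℝ => ‖(κ : ℂ) + 1 / 4‖) (𝓝 (-(1 / 4))) (𝓝 0) := by
      have : Continuous fun κ : ℝ => ‖(κ : ℂ) + 1 / 4‖ := by fun_prop
      simpa using this.tendsto (-(1 / 4))
    have h2 := h1.sqrt
    rw [Real.sqrt_zero] at h2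
    refine tendsto_zero_iff_norm_tendsto_zero.mpr ((h2.mono_left nhdsWithin_le_nhds).congr
      fun κ => ?_)
    rw [← hsq, norm_pow, Real.sqrt_sq (norm_nonneg _)]
  have hr0 : ∀ᶠ κ in 𝓝[≠] (-(1 / 4) : ℝ), r κ ≠ 0 := by
    filter_upwards [self_mem_nhdsWithin] with κ hκ h
    have h2 := hsq κ
    rw [h, zero_pow two_ne_zero] at h2
    refine hκ (Set.mem_singleton_iff.mpr ?_)
    have h3 : ((κ + 1 / 4 : ℝ) : ℂ) = 0 := by push_cast; exact h2.symm
    have := Complex.ofReal_eq_zero.mp h3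
    linarith
  refine ((tendsto_div_one_sub_cos_pi hr hr0).const_sub (1 / 4)).congr fun κ => ?_
  rw [hsq, α₃]

theorem α₃_eq {β : ℂ} {b κ : ℝ} (hβ : β ^ 2 = b) (hκ : κ = -b - 1 / 4) :
    α₃ κ = 1 / 4 + β ^ 2 / (1 - Complex.cos (Real.pi * (Complex.I * β))) := by
  have e : (κ : ℂ) + 1 / 4 = -β ^ 2 := by rw [hβ, hκ]; push_cast; ring
  have h : ((κ : ℂ) + 1 / 4) ^ (1 / 2 : ℂ) = Complex.I * β ∨
      ((κ : ℂ) + 1 / 4) ^ (1 / 2 : ℂ) = -(Complex.I * β) := by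
    rw [← sq_eq_sq_iff_eq_or_eq_neg, cpow_half_sq, e, mul_pow, Complex.I_sq, neg_one_mul]
  have hc : Complex.cos (Real.pi * ((κ : ℂ) + 1 / 4) ^ (1 / 2 : ℂ)) =
      Complex.cos (Real.pi * (Complex.I * β)) := by
    rcases h with h | h <;> rw [h]
    rw [mul_neg, Complex.cos_neg]
  rw [α₃, hc, e, neg_div, sub_neg_eq_add]

/-- Along γ = 2β the duplication formula for sinh cancels sinh 2πs. With r = 2is what remains is
1/12 - r²/(1 - cos πr) · (4 - cos πr)/12, whose limit is elementary. -/
theorem tendsto_α₄_diagonal : Tendsto (fun s : ℝ => α₄ s (2 * s)) (𝓝[≠] 0)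
    (𝓝 (1 / 12 - 1 / (2 * (Real.pi : ℂ) ^ 2))) := by
  have hpi : (Real.pi : ℂ) ≠ 0 := by exact_mod_cast Real.pi_ne_zero
  let r : ℝ → ℂ := fun s => 2 * s * Complex.I
  have hr : Tendsto r (𝓝[≠] 0) (𝓝 0) := by
    have : Tendsto r (𝓝 0) (𝓝 (r 0)) := Continuous.tendsto (by fun_prop) 0
    simp only [r, Complex.ofReal_zero, mul_zero, zero_mul] at this
    exact this.mono_left nhdsWithin_le_nhds
  have hne : ∀ s : ℝ, s ≠ 0 → (s : ℂ) ≠ 0 := fun s hs => Complex.ofReal_ne_zero.mpr hs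
  have hr0 : ∀ᶠ s in 𝓝[≠] (0 : ℝ), r s ≠ 0 := by
    filter_upwards [self_mem_nhdsWithin] with s hs
    exact mul_ne_zero (mul_ne_zero two_ne_zero (hne s hs)) Complex.I_ne_zero
  have h1 := tendsto_div_one_sub_cos_pi hr hr0
  have h2 : Tendsto (fun s => Complex.cos (Real.pi * r s)) (𝓝[≠] 0) (𝓝 1) := by
    have := (Complex.continuous_cos.tendsto (Real.pi * 0)).comp (hr.const_mul (Real.pi : ℂ))
    rwa [mul_zero, Complex.cos_zero] at this
  have h3 := (h1.mul ((h2.const_sub 4).div_const 12)).const_sub (1 / 12)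
  have e : (1 : ℂ) / 12 - 2 / (Real.pi : ℂ) ^ 2 * ((4 - 1) / 12) =
      1 / 12 - 1 / (2 * (Real.pi : ℂ) ^ 2) := by
    field_simp
    ring
  rw [e] at h3
  refine h3.congr' ?_
  filter_upwards [self_mem_nhdsWithin] with s hs
  have hs0 := hne s hs
  have hc : Complex.cosh (2 * Real.pi * s) = Complex.cos (Real.pi * r s) := by
    rw [← Complex.cos_mul_I]; simp only [r]; ring_nf
  have hs2 : (s : ℂ) ^ 2 = ((s ^ 2 : ℝ) : ℂ) := by push_cast; rfl
  have hb : -(1 / 4) < s ^ 2 := lt_of_lt_of_le (by norm_num) (sq_nonneg s)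
  have hsinh := sinh_two_pi_mul_ne_zero hs2 hb hs0
  have hcos : Complex.cosh (2 * Real.pi * s) - 1 ≠ 0 := by
    have h22 : (2 * (s : ℂ)) ^ 2 = (((2 * s) ^ 2 : ℝ) : ℂ) := by push_cast; rfl
    have := cos_pi_I_mul_ne_one h22 (lt_of_lt_of_le (by norm_num) (sq_nonneg _))
      (mul_ne_zero two_ne_zero hs0)
    rw [hc, sub_ne_zero]
    simpa only [r, mul_comm Complex.I] using this
  have hr2 : r s ^ 2 = -4 * (s : ℂ) ^ 2 := by
    simp only [r]; rw [mul_pow, Complex.I_sq]; ring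
  have hd : Complex.sinh (2 * Real.pi * (2 * s)) =
      2 * Complex.sinh (2 * Real.pi * s) * Complex.cosh (2 * Real.pi * s) := by
    rw [← Complex.sinh_two_mul]; ring_nf
  have hcos' : 1 - Complex.cosh (2 * Real.pi * s) ≠ 0 := by
    rw [← neg_sub]; exact neg_ne_zero.mpr hcos
  rw [α₄, hd, ← hc, hr2]
  have hD : 3 * ((s : ℂ) * (2 * Complex.sinh (2 * Real.pi * s) * Complex.cosh (2 * Real.pi * s)) -
      2 * s * Complex.sinh (2 * Real.pi * s)) =
      6 * s * Complex.sinh (2 * Real.pi * s) * (Complex.cosh (2 * Real.pi * s) - 1) := by ring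
  rw [hD, sub_eq_add_neg (1 / 12 : ℂ)]
  congr 1
  have h6 : 6 * s * Complex.sinh (2 * Real.pi * s) * (Complex.cosh (2 * Real.pi * s) - 1) ≠ 0 := by
    exact mul_ne_zero (mul_ne_zero (mul_ne_zero (by norm_num) hs0) hsinh) hcos
  rw [div_mul_div_comm, ← neg_div, div_eq_div_iff (mul_ne_zero hcos' (by norm_num)) h6]
  ring

end

/-! ### Moment ratios at all admissible values -/

open ComplexOrder in
theorem weightTrace_one_ne_zero {n : ℕ} {P : ℂ[X]} {c : Fin n → ℂ}
    (hc : ∀ j, |(c j).re| < 1 / 2) (hn : 3 ≤ n)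
    (hw : ∀ y : ℝ, 0 < cosWeight c (Complex.I * y)) : weightTrace P c hc hn 1 ≠ 0 :=
  (weightTrace_one_pos hc hn hw).ne'

theorem integral_w₃_ne_zero {β : ℂ} {b : ℝ} (hβ : β ^ 2 = b) (hb : -(1 / 4) < b) :
    ∫ y : ℝ, w₃ β (Complex.I * y) ≠ 0 := by
  have hc := abs_re_roots₃_lt hβ hb
  have h := (hasWeight_weightTrace (P := P₃ b) hc le_rfl 1).2
  have := weightTrace_one_ne_zero (P := P₃ b) hc le_rfl (cosWeight_roots₃_pos hβ hb)
  simp only [map_one, eval_one, one_mul] at h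
  rwa [w₃_eq, ← h]

theorem integral_w₄_ne_zero {β γ : ℂ} {b c : ℝ} (hβ : β ^ 2 = b) (hγ : γ ^ 2 = c)
    (hb : -(1 / 4) < b) (hc : -(1 / 4) < c) : ∫ y : ℝ, w₄ β γ (Complex.I * y) ≠ 0 := by
  have hr := abs_re_roots₄_lt hβ hγ hb hc
  have h := (hasWeight_weightTrace (P := P₄ b c) hr (by norm_num) 1).2
  have := weightTrace_one_ne_zero (P := P₄ b c) hr (by norm_num)
    (cosWeight_roots₄_pos hβ hγ hb hc)
  simp only [map_one, eval_one, one_mul] at h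
  rwa [w₄_eq, ← h]

theorem momentRatio_w₃ {β : ℂ} {b : ℝ} (hβ : β ^ 2 = b) (hb : -(1 / 4) < b) (h0 : β ≠ 0) :
    momentRatio (w₃ β) =
      1 / 4 + β ^ 2 / (1 - Complex.cos (Real.pi * (Complex.I * β))) := by
  have hc := abs_re_roots₃_lt hβ hb
  have hT := hasWeight_weightTrace (P := P₃ b) hc le_rfl
  rw [← w₃_eq] at hT
  rw [← parameter_eq_momentRatio hT]
  refine parameter_three hβ hb h0 hT ?_
  have := (hT 1).2
  simp only [map_one, eval_one, one_mul] at this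
  rw [this]
  exact integral_w₃_ne_zero hβ hb

theorem momentRatio_w₄ {β γ : ℂ} {b c : ℝ} (hβ : β ^ 2 = b) (hγ : γ ^ 2 = c)
    (hb : -(1 / 4) < b) (hc : -(1 / 4) < c) (h0 : β ≠ 0) (h0' : γ ≠ 0) (h : β ^ 2 ≠ γ ^ 2) :
    momentRatio (w₄ β γ) = α₄ β γ := by
  have hr := abs_re_roots₄_lt hβ hγ hb hc
  have hT := hasWeight_weightTrace (P := P₄ b c) hr (by norm_num)
  rw [← w₄_eq] at hT
  rw [← parameter_eq_momentRatio hT]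
  refine parameter_four hβ hγ hb hc h0 h0' h hT ?_
  have := (hT 1).2
  simp only [map_one, eval_one, one_mul] at this
  rw [this]
  exact integral_w₄_ne_zero hβ hγ hb hc

theorem momentRatio_w₃_zero : momentRatio (w₃ 0) = 1 / 4 - 2 / (Real.pi : ℂ) ^ 2 := by
  have h0 : (0 : ℂ) ^ 2 = ((0 : ℝ) : ℂ) := by simp
  have hb : -(1 / 4) < (0 : ℝ) := by norm_num
  have hcont := continuousAt_momentRatio_w₃ h0 hb (integral_w₃_ne_zero h0 hb)
  have hs : Tendsto (fun s : ℝ => (s : ℂ)) (𝓝[≠] 0) (𝓝 0) := by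
    have : Tendsto (fun s : ℝ => (s : ℂ)) (𝓝 0) (𝓝 ((0 : ℝ) : ℂ)) :=
      Complex.continuous_ofReal.tendsto 0
    rw [Complex.ofReal_zero] at this
    exact this.mono_left nhdsWithin_le_nhds
  have hI : Tendsto (fun s : ℝ => Complex.I * (s : ℂ)) (𝓝[≠] 0) (𝓝 0) := by
    simpa using hs.const_mul Complex.I
  have hne : ∀ᶠ s : ℝ in 𝓝[≠] 0, (s : ℂ) ≠ 0 := by
    filter_upwards [self_mem_nhdsWithin] with s hs using Complex.ofReal_ne_zero.mpr hs
  have h1 := (tendsto_div_one_sub_cos_pi hI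
    (hne.mono fun s hs => mul_ne_zero Complex.I_ne_zero hs)).const_sub (1 / 4)
  refine tendsto_nhds_unique (hcont.tendsto.comp hs) (h1.congr' ?_)
  filter_upwards [hne] with s hs0
  have hs2 : (s : ℂ) ^ 2 = ((s ^ 2 : ℝ) : ℂ) := by push_cast; rfl
  rw [Function.comp_apply, momentRatio_w₃ hs2 (lt_of_lt_of_le (by norm_num) (sq_nonneg s)) hs0,
    mul_pow, Complex.I_sq, neg_one_mul, neg_div, sub_neg_eq_add]

/-- On `generic₄` the formula is the moment ratio, which is continuous at every admissible point. -/
theorem tendsto_α₄ {β γ : ℂ} {b c : ℝ} (hβ : β ^ 2 = b) (hγ : γ ^ 2 = c)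
    (hb : -(1 / 4) < b) (hc : -(1 / 4) < c) :
    Tendsto (fun p : ℂ × ℂ => α₄ p.1 p.2) (𝓝[generic₄] (β, γ)) (𝓝 (momentRatio (w₄ β γ))) := by
  have hcont := continuousAt_momentRatio_w₄ (p₀ := (β, γ)) hβ hγ hb hc
    (integral_w₄_ne_zero hβ hγ hb hc)
  refine (hcont.tendsto.mono_left nhdsWithin_le_nhds).congr' ?_
  filter_upwards [self_mem_nhdsWithin] with p hp
  obtain ⟨⟨b', hb', e⟩, ⟨c', hc', e'⟩, h1, h2, h3⟩ := hp
  exact momentRatio_w₄ e e' hb' hc' h1 h2 h3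

theorem momentRatio_w₄_zero :
    momentRatio (w₄ 0 0) = 1 / 12 - 1 / (2 * (Real.pi : ℂ) ^ 2) := by
  have h0 : (0 : ℂ) ^ 2 = ((0 : ℝ) : ℂ) := by simp
  have hb : -(1 / 4) < (0 : ℝ) := by norm_num
  have hs : Tendsto (fun s : ℝ => ((s : ℂ), 2 * (s : ℂ))) (𝓝[≠] 0) (𝓝[generic₄] (0, 0)) := by
    refine tendsto_nhdsWithin_iff.mpr ⟨?_, ?_⟩
    · have : Tendsto (fun s : ℝ => ((s : ℂ), 2 * (s : ℂ))) (𝓝 0)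
          (𝓝 (((0 : ℝ) : ℂ), 2 * ((0 : ℝ) : ℂ))) := Continuous.tendsto (by fun_prop) 0
      rw [Complex.ofReal_zero, mul_zero] at this
      exact this.mono_left nhdsWithin_le_nhds
    · filter_upwards [self_mem_nhdsWithin] with s hs
      have hs0 : (s : ℂ) ≠ 0 := Complex.ofReal_ne_zero.mpr hs
      refine ⟨⟨s ^ 2, lt_of_lt_of_le (by norm_num) (sq_nonneg s), by push_cast; rfl⟩,
        ⟨(2 * s) ^ 2, lt_of_lt_of_le (by norm_num) (sq_nonneg _), by push_cast; rfl⟩, hs0,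
        mul_ne_zero two_ne_zero hs0, fun h => pow_ne_zero 2 hs0 ?_⟩
      have h' : (s : ℂ) ^ 2 = (2 * (s : ℂ)) ^ 2 := h
      linear_combination (-1 / 3 : ℂ) * h'
  -- The limit over `generic₄` exists, so the single path (s, 2s) suffices to compute it.
  exact tendsto_nhds_unique ((tendsto_α₄ h0 h0 hb hb).comp hs) tendsto_α₄_diagonal

end KleinianA

end

/-! ### The main theorem -/

theorem mainTheorem7 :
    -- the case n = 3, with κ = -β² - 1/4
    (∀ (b κ : ℝ) (β : ℂ), β ^ 2 = (b : ℂ) → -(1 / 4) < b → κ = -b - 1 / 4 →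
      -- even traces are determined by their parameter
      (∀ T T' : KleinianA.Alg (KleinianA.P₃ b) →ₗ[ℂ] ℂ,
        KleinianA.IsTwistedTrace (KleinianA.s₃ b) T →
        KleinianA.IsTwistedTrace (KleinianA.s₃ b) T' →
        KleinianA.IsSigmaInvariant (KleinianA.σ₃ b) T →
        KleinianA.IsSigmaInvariant (KleinianA.σ₃ b) T' →
        T 1 = 1 → T' 1 = 1 →
        KleinianA.parameter T = KleinianA.parameter T' → T = T') ∧
      -- the unitary trace, unique up to scaling
      ∃ T : KleinianA.Alg (KleinianA.P₃ b) →ₗ[ℂ] ℂ,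
        KleinianA.HasWeight T (KleinianA.w₃ β) ∧
        (∀ T' : KleinianA.Alg (KleinianA.P₃ b) →ₗ[ℂ] ℂ,
          KleinianA.IsUnitaryTrace (KleinianA.s₃ b) (KleinianA.ρ₃ b) T' ↔
            ∃ r : ℝ, 0 < r ∧ T' = (r : ℂ) • T) ∧
        KleinianA.IsSigmaInvariant (KleinianA.σ₃ b) T ∧
        T 1 ≠ 0 ∧
        (κ ≠ -(1 / 4) → KleinianA.parameter T = KleinianA.α₃ κ) ∧
        (κ = -(1 / 4) → KleinianA.parameter T = 1 / 4 - 2 / (Real.pi : ℂ) ^ 2)) ∧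
    Tendsto KleinianA.α₃ (𝓝[≠] (-(1 / 4))) (𝓝 (1 / 4 - 2 / (Real.pi : ℂ) ^ 2)) ∧
    -- the case n = 4
    (∀ (b c : ℝ) (β γ : ℂ), β ^ 2 = (b : ℂ) → γ ^ 2 = (c : ℂ) →
      -(1 / 4) < b → -(1 / 4) < c →
      (∀ T T' : KleinianA.Alg (KleinianA.P₄ b c) →ₗ[ℂ] ℂ,
        KleinianA.IsTwistedTrace (KleinianA.s₄ b c) T →
        KleinianA.IsTwistedTrace (KleinianA.s₄ b c) T' →
        KleinianA.IsSigmaInvariant (KleinianA.σ₄ b c) T →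
        KleinianA.IsSigmaInvariant (KleinianA.σ₄ b c) T' →
        T 1 = 1 → T' 1 = 1 →
        KleinianA.parameter T = KleinianA.parameter T' → T = T') ∧
      ∃ T : KleinianA.Alg (KleinianA.P₄ b c) →ₗ[ℂ] ℂ,
        KleinianA.HasWeight T (KleinianA.w₄ β γ) ∧
        (∀ T' : KleinianA.Alg (KleinianA.P₄ b c) →ₗ[ℂ] ℂ,
          KleinianA.IsUnitaryTrace (KleinianA.s₄ b c) (KleinianA.ρ₄ b c) T' ↔
            ∃ r : ℝ, 0 < r ∧ T' = (r : ℂ) • T) ∧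
        KleinianA.IsSigmaInvariant (KleinianA.σ₄ b c) T ∧
        T 1 ≠ 0 ∧
        -- for β, γ, β² - γ² all nonzero the formula holds as it stands,
        -- otherwise the parameter is the limit of the formula
        (β ≠ 0 → γ ≠ 0 → β ^ 2 ≠ γ ^ 2 →
          KleinianA.parameter T = KleinianA.α₄ β γ) ∧
        Tendsto (fun p : ℂ × ℂ => KleinianA.α₄ p.1 p.2) (𝓝[KleinianA.generic₄] (β, γ))
          (𝓝 (KleinianA.parameter T)) ∧
        (β = 0 → γ = 0 →
          KleinianA.parameter T = 1 / 12 - 1 / (2 * (Real.pi : ℂ) ^ 2))) := by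
  refine ⟨?_, KleinianA.tendsto_α₃, ?_⟩
  · intro b κ β hβ hb hκ
    have hr := KleinianA.abs_re_roots₃_lt hβ hb
    have hP := KleinianA.P₃_eq_prod hβ
    have hdet : ∀ τ : ℂ[X] →ₗ[ℂ] ℂ, KleinianA.IsTraceFunctional (KleinianA.P₃ b) ((-1) ^ 3) τ →
        (∀ i : Fin 3, τ (X ^ (i : ℕ)) = 0) → τ = 0 := fun τ hτ h =>
      hτ.eq_zero_of_natDegree_eq_three (KleinianA.P₃_monic b) (KleinianA.P₃_natDegree b) h
    have hW := KleinianA.hasWeight_weightTrace (P := KleinianA.P₃ b) hr le_rfl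
    rw [← KleinianA.w₃_eq] at hW
    have h1 : KleinianA.weightTrace (KleinianA.P₃ b) _ hr le_rfl 1 ≠ 0 :=
      KleinianA.weightTrace_one_ne_zero hr le_rfl (KleinianA.cosWeight_roots₃_pos hβ hb)
    refine ⟨fun T T' hT hT' hσ hσ' e e' h => KleinianA.eq_of_parameter_eq hdet hT hT' hσ hσ' e e' h,
      KleinianA.weightTrace (KleinianA.P₃ b) _ hr le_rfl, hW, ?_, ?_, h1, fun h => ?_, fun h => ?_⟩
    · exact KleinianA.isUnitaryTrace_iff hr le_rfl hP (KleinianA.cosWeight_roots₃_pos hβ hb)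
        (KleinianA.sinWeight_roots₃_pos hβ hb) (by norm_num) (KleinianA.P₃_conj b) hdet
    · refine KleinianA.isSigmaInvariant_weightTrace hr le_rfl hP (fun x => ?_) _
      rw [← KleinianA.w₃_eq, KleinianA.w₃_neg]
    · have h0 : β ≠ 0 := by
        rintro rfl
        rw [zero_pow two_ne_zero] at hβ
        have := Complex.ofReal_eq_zero.mp hβ.symm
        exact h (by rw [hκ, this]; norm_num)
      rw [KleinianA.parameter_eq_momentRatio hW, KleinianA.momentRatio_w₃ hβ hb h0,
        KleinianA.α₃_eq hβ hκ]
    · have hb0 : b = 0 := by linarith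
      have h0 : β = 0 := by
        rw [hb0, Complex.ofReal_zero] at hβ
        exact pow_eq_zero_iff two_ne_zero |>.mp hβ
      rw [KleinianA.parameter_eq_momentRatio hW, h0, KleinianA.momentRatio_w₃_zero]
  · intro b c β γ hβ hγ hb hc
    have hr := KleinianA.abs_re_roots₄_lt hβ hγ hb hc
    have hP := KleinianA.P₄_eq_prod hβ hγ
    have hn : 3 ≤ 4 := by norm_num
    have hdet : ∀ τ : ℂ[X] →ₗ[ℂ] ℂ,
        KleinianA.IsTraceFunctional (KleinianA.P₄ b c) ((-1) ^ 4) τ →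
        (∀ i : Fin 3, τ (X ^ (i : ℕ)) = 0) → τ = 0 := fun τ hτ h =>
      hτ.eq_zero_of_natDegree_eq_four (KleinianA.P₄_monic b c) (KleinianA.P₄_natDegree b c) h
    have hW := KleinianA.hasWeight_weightTrace (P := KleinianA.P₄ b c) hr hn
    rw [← KleinianA.w₄_eq] at hW
    have h1 : KleinianA.weightTrace (KleinianA.P₄ b c) _ hr hn 1 ≠ 0 :=
      KleinianA.weightTrace_one_ne_zero hr hn (KleinianA.cosWeight_roots₄_pos hβ hγ hb hc)
    refine ⟨fun T T' hT hT' hσ hσ' e e' h => KleinianA.eq_of_parameter_eq hdet hT hT' hσ hσ' e e' h,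
      KleinianA.weightTrace (KleinianA.P₄ b c) _ hr hn, hW, ?_, ?_, h1, fun h h' h'' => ?_, ?_,
      fun h h' => ?_⟩
    · exact KleinianA.isUnitaryTrace_iff hr hn hP (KleinianA.cosWeight_roots₄_pos hβ hγ hb hc)
        (KleinianA.sinWeight_roots₄_pos hβ hγ hb hc) (by norm_num) (KleinianA.P₄_conj b c) hdet
    · refine KleinianA.isSigmaInvariant_weightTrace hr hn hP (fun x => ?_) _
      rw [← KleinianA.w₄_eq, KleinianA.w₄_neg]
    · rw [KleinianA.parameter_eq_momentRatio hW, KleinianA.momentRatio_w₄ hβ hγ hb hc h h' h'']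
    · rw [KleinianA.parameter_eq_momentRatio hW]
      exact KleinianA.tendsto_α₄ hβ hγ hb hc
    · rw [KleinianA.parameter_eq_momentRatio hW, h, h', KleinianA.momentRatio_w₄_zero]
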